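/- Let $(M^{2n},J)$ be a compact complex manifold of complex dimension $n$. For a Hermitian metric $g$ compatible with $J$, write $g_{i\bar j}$ for its components in local holomorphic coordinates, normalized so that $\omega=\frac{\sqrt{-1}}2 g_{i\bar j}\,dz^i\wedge d\bar z^j$ (so $g_{i\bar j}=\delta_{ij}$ for the Euclidean metric and $dV=\det(g_{i\bar j})$ times Lebesgue measure). Let $\nabla$ be the Chern connection, $\Gamma_{ij}^k=g^{k\bar l}\partial_i g_{j\bar l}$, with torsion $T_{ij\bar k}=\partial_i g_{j\bar k}-\partial_j g_{i\bar k}$, $T_{\bar i\bar j k}=\overline{T_{ij\bar k}}$, and curvature $\Omega_{l\bar m j\bar k}=-g_{p\bar k}\partial_{\bar m}\Gamma_{lj}^p$. Put $S_{j\bar k}=g^{l\bar m}\Omega_{l\bar m j\bar k}$ and $Q=\frac12Q^1-\frac14Q^2-\frac12Q^3+Q^4$, where $$Q^1_{i\bar j}=g^{k\bar l}g^{m\bar n}T_{ik\bar n}T_{\bar j\bar l m},\qquad Q^2_{i\bar j}=g^{k\bar l}g^{m\bar n}T_{\bar l\bar n i}T_{km\bar j},\qquad Q^3_{i\bar j}=g^{k\bar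 l}g^{m\bar n}T_{ik\bar l}T_{\bar j\bar n m},$$ $$Q^4_{i\bar j}=\tfrac12 g^{k\bar l}g^{m\bar n}\left(T_{mk\bar l}T_{\bar n\bar j i}+T_{\bar n\bar l k}T_{mi\bar j}\right).$$ Define the volume-normalized Hermitian curvature flow operator $$\mathcal F(g)=S-Q-\frac1n\left(\int_M \operatorname{tr}_g(S-Q)\,dV\right)g .$$ **Proposition.** Let $g(a)$, $a\in(-\varepsilon,\varepsilon)$, be a smooth one-parameter family of Hermitian metrics on $M$ compatible with $J$, all of unit volume, with $\frac{\partial}{\partial a}g(a)\big|_{a=0}=h$, and suppose that $g(0)$ is Kähler–Einstein, i.e. Kähler with Ricci curvature equal to a constant real multiple of $g(0)$. Then $$\frac{\partial}{\partial a}\mathcal F(g(a))\Big|_{a=0}=\nabla^*\nabla h-\overset{\circ}{R}(h),$$ where, with respect to $g(0)$, $$(\nabla^*\nabla h)_{j\bar k}=-g^{l\bar m}\nabla_l\nabla_{\bar m}h_{j\bar k},\qquad \overset{\circ}{R}(h)_{k\bar l}=h^{i\bar j}R_{k\bar j i\bar l},\qquad h^{i\bar j}=g^{i\bar q}g^{p\bar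 j}h_{p\bar q},$$ and $R=\Omega(g(0))$ is the curvature of the Kähler metric $g(0)$. -/

import Mathlib

open scoped Manifold ContDiff

noncomputable section

namespace HermitianFlow

/-! ### Hermitian calculus in a coordinate domain of `ℂⁿ`

A Hermitian metric enters through its coefficient matrix `G z i j = g_{i j̄}(z)`, and a `(1,1)`-tensor
`h` through `H z i j = h_{i j̄}(z)`. All differentiations are real differentiations on `ℂⁿ`. -/

section Local

variable {n : ℕ}

/-- The Wirtinger derivative `∂ f / ∂ zⁱ`. -/
def dz (i : Fin n) (f : (Fin n → ℂ) → ℂ) (z : Fin n → ℂ) : ℂ :=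
  (1 / 2 : ℂ) * (fderiv ℝ f z (Pi.single i 1) - Complex.I * fderiv ℝ f z (Pi.single i Complex.I))

/-- The Wirtinger derivative `∂ f / ∂ z̄ⁱ`. -/
def dzbar (i : Fin n) (f : (Fin n → ℂ) → ℂ) (z : Fin n → ℂ) : ℂ :=
  (1 / 2 : ℂ) * (fderiv ℝ f z (Pi.single i 1) + Complex.I * fderiv ℝ f z (Pi.single i Complex.I))

variable (G : (Fin n → ℂ) → Matrix (Fin n) (Fin n) ℂ)

/-- The inverse metric `g^{k l̄}`, normalised by `∑ l, g^{k l̄} g_{j l̄} = δ_{jk}`. -/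
def gInv (z : Fin n → ℂ) (k l : Fin n) : ℂ := (G z)⁻¹ l k

/-- The Christoffel symbols `Γ_{ij}^k = g^{k l̄} ∂_i g_{j l̄}` of the Chern connection. -/
def chernGamma (z : Fin n → ℂ) (i j k : Fin n) : ℂ :=
  ∑ l, gInv G z k l * dz i (fun w => G w j l) z

/-- The torsion of the Chern connection with its last index lowered,
`T_{i j k̄} = ∂_i g_{j k̄} - ∂_j g_{i k̄}`. -/
def torsion (z : Fin n → ℂ) (i j k : Fin n) : ℂ :=
  dz i (fun w => G w j k) z - dz j (fun w => G w i k) z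

/-- The conjugate torsion `T_{ī j̄ k}`. -/
def torsionBar (z : Fin n → ℂ) (i j k : Fin n) : ℂ := star (torsion G z i j k)

/-- The Chern curvature `Ω_{l m̄ j k̄} = - g_{p k̄} ∂_m̄ Γ_{l j}^p`. -/
def chernCurv (z : Fin n → ℂ) (l m j k : Fin n) : ℂ :=
  -∑ p, G z p k * dzbar m (fun w => chernGamma G w l j p) z

/-- `S_{j k̄} = g^{l m̄} Ω_{l m̄ j k̄}`. -/
def chernS (z : Fin n → ℂ) (j k : Fin n) : ℂ :=
  ∑ l, ∑ m, gInv G z l m * chernCurv G z l m j k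

/-- `Q¹_{i j̄} = g^{k l̄} g^{m n̄} T_{i k n̄} T_{j̄ l̄ m}`. -/
def Q1 (z : Fin n → ℂ) (i j : Fin n) : ℂ :=
  ∑ k, ∑ l, ∑ m, ∑ q, gInv G z k l * gInv G z m q * torsion G z i k q * torsionBar G z j l m

/-- `Q²_{i j̄} = g^{k l̄} g^{m n̄} T_{l̄ n̄ i} T_{k m j̄}`. -/
def Q2 (z : Fin n → ℂ) (i j : Fin n) : ℂ :=
  ∑ k, ∑ l, ∑ m, ∑ q, gInv G z k l * gInv G z m q * torsionBar G z l q i * torsion G z k m j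

/-- `Q³_{i j̄} = g^{k l̄} g^{m n̄} T_{i k l̄} T_{j̄ n̄ m}`. -/
def Q3 (z : Fin n → ℂ) (i j : Fin n) : ℂ :=
  ∑ k, ∑ l, ∑ m, ∑ q, gInv G z k l * gInv G z m q * torsion G z i k l * torsionBar G z j q m

/-- `Q⁴_{i j̄} = ½ g^{k l̄} g^{m n̄} (T_{m k l̄} T_{n̄ j̄ i} + T_{n̄ l̄ k} T_{m i j̄})`. -/
def Q4 (z : Fin n → ℂ) (i j : Fin n) : ℂ :=
  (1 / 2 : ℂ) * ∑ k, ∑ l, ∑ m, ∑ q, gInv G z k l * gInv G z m q *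
    (torsion G z m k l * torsionBar G z q j i + torsionBar G z q l k * torsion G z m i j)

/-- `Q = ½ Q¹ - ¼ Q² - ½ Q³ + Q⁴`. -/
def torsionQ (z : Fin n → ℂ) (i j : Fin n) : ℂ :=
  (1 / 2 : ℂ) * Q1 G z i j - (1 / 4 : ℂ) * Q2 G z i j - (1 / 2 : ℂ) * Q3 G z i j + Q4 G z i j

/-- The trace `tr_g (S - Q) = g^{i j̄} (S - Q)_{i j̄}`. -/
def traceSQ (z : Fin n → ℂ) : ℂ :=
  ∑ i, ∑ j, gInv G z i j * (chernS G z i j - torsionQ G z i j)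

/-- The covariant derivative `∇_m̄ h_{j k̄} = ∂_m̄ h_{j k̄} - Γ_{m̄ k̄}^{p̄} h_{j p̄}` of a
`(1,1)`-tensor, where `Γ_{m̄ k̄}^{p̄}` is the conjugate of `Γ_{m k}^p`. -/
def covBar (H : (Fin n → ℂ) → Matrix (Fin n) (Fin n) ℂ) (z : Fin n → ℂ) (m j k : Fin n) : ℂ :=
  dzbar m (fun w => H w j k) z - ∑ p, star (chernGamma G z m k p) * H z j p

/-- The second covariant derivative
`∇_l ∇_m̄ h_{j k̄} = ∂_l (∇_m̄ h_{j k̄}) - Γ_{l j}^p ∇_m̄ h_{p k̄}`. -/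
def cov2 (H : (Fin n → ℂ) → Matrix (Fin n) (Fin n) ℂ) (z : Fin n → ℂ) (l m j k : Fin n) : ℂ :=
  dz l (fun w => covBar G H w m j k) z - ∑ p, chernGamma G z l j p * covBar G H z m p k

/-- The rough Laplacian `(∇*∇ h)_{j k̄} = - g^{l m̄} ∇_l ∇_m̄ h_{j k̄}`. -/
def roughLaplacian (H : (Fin n → ℂ) → Matrix (Fin n) (Fin n) ℂ) (z : Fin n → ℂ)
    (j k : Fin n) : ℂ :=
  -∑ l, ∑ m, gInv G z l m * cov2 G H z l m j k

/-- `h^{i j̄} = g^{i q̄} g^{p j̄} h_{p q̄}`. -/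
def raise (H : (Fin n → ℂ) → Matrix (Fin n) (Fin n) ℂ) (z : Fin n → ℂ) (i j : Fin n) : ℂ :=
  ∑ p, ∑ q, gInv G z i q * gInv G z p j * H z p q

/-- `R̊(h)_{k l̄} = h^{i j̄} R_{k j̄ i l̄}`. -/
def curvAction (H : (Fin n → ℂ) → Matrix (Fin n) (Fin n) ℂ) (z : Fin n → ℂ)
    (k l : Fin n) : ℂ :=
  ∑ i, ∑ j, raise G H z i j * chernCurv G z k j i l

end Local

/-! ### Hermitian metrics on a complex manifold -/

section Global

variable {n : ℕ} {M : Type*} [TopologicalSpace M] [ChartedSpace (Fin n → ℂ) M]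

/-- The (real) tangent space at `x`; its almost complex structure `J` is multiplication by `i`. -/
abbrev Tan (x : M) : Type := TangentSpace 𝓘(ℂ, Fin n → ℂ) x

/-- The coefficients `b_{i j̄}(z)`, in a holomorphic chart `e` with coordinates `zⁱ = xⁱ + √-1 yⁱ`,
of a `J`-invariant real symmetric `2`-tensor `b`:
`b_{i j̄} = b(∂/∂xⁱ, ∂/∂xʲ) + √-1 b(∂/∂xⁱ, J ∂/∂xʲ)`, so that `b` is the real part of
`∑ b_{i j̄} dzⁱ ⊗ dz̄ʲ`. For the Euclidean metric of `ℂⁿ` the coefficients are `δ_{ij}`. -/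
def coeff (b : ∀ x : M, LinearMap.BilinForm ℝ (Tan (n := n) x))
    (e : OpenPartialHomeomorph M (Fin n → ℂ)) (z : Fin n → ℂ) : Matrix (Fin n) (Fin n) ℂ :=
  Matrix.of fun i j =>
    let X : Fin n → Tan (n := n) (e.symm z) := fun k =>
      mfderiv 𝓘(ℂ, Fin n → ℂ) 𝓘(ℂ, Fin n → ℂ) e.symm z
        (Pi.single k 1 : Fin n → ℂ)
    (b (e.symm z) (X i) (X j) : ℂ) + Complex.I * (b (e.symm z) (X i) (Complex.I • X j) : ℂ)

variable (n M) in
/-- A smooth Riemannian metric on the complex manifold `M` that is compatible with the complex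
structure `J`. -/
structure HermitianMetric where
  form : ∀ x : M, LinearMap.BilinForm ℝ (Tan (n := n) x)
  symm : ∀ x u v, form x u v = form x v u
  compat : ∀ x u v, form x (Complex.I • u) (Complex.I • v) = form x u v
  pos : ∀ x u, u ≠ 0 → 0 < form x u u
  smooth : ∀ e ∈ IsManifold.maximalAtlas 𝓘(ℂ, Fin n → ℂ) ω M, ∀ i j,
    ContDiffOn ℝ ∞ (fun z => coeff form e z i j) e.target

namespace HermitianMetric

/-- The coefficient matrix `g_{i j̄}` in a holomorphic chart. -/
def mat (g : HermitianMetric n M) (e : OpenPartialHomeomorph M (Fin n → ℂ)) (z : Fin n → ℂ) :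
    Matrix (Fin n) (Fin n) ℂ := coeff g.form e z

/-- The Riemannian volume measure: in every holomorphic chart it is `det (g_{i j̄})` times Lebesgue
measure. It is built as the least upper bound, among measures on `M`, of these mutually compatible
measures on the chart domains. -/
def vol [MeasurableSpace M] (g : HermitianMetric n M) : MeasureTheory.Measure M :=
  ⨆ e ∈ IsManifold.maximalAtlas 𝓘(ℂ, Fin n → ℂ) ω M,
    MeasureTheory.Measure.map e.symm
      ((MeasureTheory.volume.restrict e.target).withDensity
        fun z => ENNReal.ofReal (g.mat e z).det.re)

/-- The function `tr_g (S - Q)` on `M`; a scalar, so it may be computed in any chart. -/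
def traceSQ (g : HermitianMetric n M) (x : M) : ℂ :=
  HermitianFlow.traceSQ (g.mat (chartAt (Fin n → ℂ) x)) (chartAt (Fin n → ℂ) x x)

/-- The volume-normalised operator `𝓕(g) = S - Q - (1/n) (∫_M tr_g (S - Q) dV) g`, in components
in the chart `e`. -/
def opF [MeasurableSpace M] (g : HermitianMetric n M)
    (e : OpenPartialHomeomorph M (Fin n → ℂ)) (z : Fin n → ℂ) (j k : Fin n) : ℂ :=
  chernS (g.mat e) z j k - torsionQ (g.mat e) z j k
    - (1 / n : ℂ) * (∫ x, g.traceSQ x ∂g.vol) * g.mat e z j k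

/-- `g` is Kähler: the torsion of its Chern connection vanishes (equivalently `dω = 0`). -/
def IsKahler (g : HermitianMetric n M) : Prop :=
  ∀ e ∈ IsManifold.maximalAtlas 𝓘(ℂ, Fin n → ℂ) ω M, ∀ z ∈ e.target, ∀ i j k,
    torsion (g.mat e) z i j k = 0

/-- `g` is Kähler–Einstein: it is Kähler and its Ricci curvature, which for a Kähler metric is `S`,
is a constant real multiple of `g`. -/
def IsKahlerEinstein (g : HermitianMetric n M) : Prop :=
  g.IsKahler ∧ ∃ c : ℝ, ∀ e ∈ IsManifold.maximalAtlas 𝓘(ℂ, Fin n → ℂ) ω M, ∀ z ∈ e.target,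
    ∀ j k, chernS (g.mat e) z j k = (c : ℂ) * g.mat e z j k

end HermitianMetric

/-- The family `g(a)`, `|a| < ε`, depends smoothly on the parameter and the point jointly. -/
def SmoothFamily (g : ℝ → HermitianMetric n M) (ε : ℝ) : Prop :=
  ∀ e ∈ IsManifold.maximalAtlas 𝓘(ℂ, Fin n → ℂ) ω M, ∀ i j,
    ContDiffOn ℝ ∞ (fun p : ℝ × (Fin n → ℂ) => (g p.1).mat e p.2 i j)
      (Set.Ioo (-ε) ε ×ˢ e.target)

end Global

end HermitianFlow

end

/-!
`Q` is quadratic in the torsion, so it vanishes to second order at a Kähler metric and does not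
contribute to the linearization. Varying `S_{j k̄} = g^{l m̄} Ω_{l m̄ j k̄}` at a Kähler metric
gives `h g⁻¹ S - g^{l m̄} ∇_l ∇_m̄ h - h^{l m̄} Ω_{l m̄}`. If `S = c g`, then the first term is
`c h`, and the last one is `R̊(h)` by the Kähler symmetries of the curvature. Consequently
`tr_g (S - Q)` varies by `-Δ (tr h) - c tr h`. Here `Δ (tr h)` integrates to zero by the
divergence theorem, and `∫ tr h = 0` because the volume is fixed, so `∫ tr_g (S - Q) = n c`
is stationary. The normalizing term therefore contributes `-c h`, which cancels the `c h`
coming from `S`.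
-/

namespace HermitianFlow

open Complex Filter MeasureTheory Topology
open scoped ComplexOrder Matrix Matrix.Norms.Operator

/-! ### Derivatives along complexified directions -/

section Directions

variable {X : Type*} [AddCommGroup X]

/-- The conjugate `v - √-1 w` of a complexified direction `v + √-1 w`, encoded as the pair
`(v, w)`. -/
def conjDir (ξ : X × X) : X × X := (ξ.1, -ξ.2)

@[simp] lemma conjDir_conjDir (ξ : X × X) : conjDir (conjDir ξ) = ξ := by simp [conjDir]

end Directions

noncomputable section Calculus

variable {X E F : Type*} [NormedAddCommGroup X] [NormedSpace ℝ X]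
  [NormedAddCommGroup E] [NormedSpace ℂ E] [NormedAddCommGroup F] [NormedSpace ℂ F]
  {ξ η : X × X} {x : X}

/-- The derivative of `f` along the complexified direction `ξ.1 + √-1 ξ.2`; it treats the Wirtinger
derivatives `∂_i`, `∂_ī` and the derivative in the parameter of a family on the same footing. -/
def dirDeriv (ξ : X × X) (f : X → E) (x : X) : E :=
  fderiv ℝ f x ξ.1 + I • fderiv ℝ f x ξ.2

lemma dirDeriv_congr {f g : X → E} (h : f =ᶠ[𝓝 x] g) : dirDeriv ξ f x = dirDeriv ξ g x := by
  simp only [dirDeriv, h.fderiv_eq]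

lemma dirDeriv_const (c : E) : dirDeriv ξ (fun _ => c) x = 0 := by simp [dirDeriv]

lemma dirDeriv_add {f g : X → E} (hf : DifferentiableAt ℝ f x) (hg : DifferentiableAt ℝ g x) :
    dirDeriv ξ (fun y => f y + g y) x = dirDeriv ξ f x + dirDeriv ξ g x := by
  simp only [dirDeriv, fderiv_fun_add hf hg, _root_.add_apply, smul_add]
  abel

lemma dirDeriv_sub {f g : X → E} (hf : DifferentiableAt ℝ f x) (hg : DifferentiableAt ℝ g x) :
    dirDeriv ξ (fun y => f y - g y) x = dirDeriv ξ f x - dirDeriv ξ g x := by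
  simp only [dirDeriv, fderiv_fun_sub hf hg, _root_.sub_apply, smul_sub]
  abel

lemma dirDeriv_sum {κ : Type*} {s : Finset κ} {f : κ → X → E}
    (hf : ∀ i ∈ s, DifferentiableAt ℝ (f i) x) :
    dirDeriv ξ (fun y => ∑ i ∈ s, f i y) x = ∑ i ∈ s, dirDeriv ξ (f i) x := by
  simp only [dirDeriv, fderiv_fun_sum hf, _root_.sum_apply, Finset.sum_add_distrib,
    Finset.smul_sum]

lemma dirDeriv_clm_comp (L : E →L[ℂ] F) {f : X → E} (hf : DifferentiableAt ℝ f x) :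
    dirDeriv ξ (fun y => L (f y)) x = L (dirDeriv ξ f x) := by
  have : HasFDerivAt (fun y => L (f y)) (L.restrictScalars ℝ ∘L fderiv ℝ f x) x :=
    (L.restrictScalars ℝ).hasFDerivAt.comp x hf.hasFDerivAt
  simp [dirDeriv, this.fderiv]

lemma dirDeriv_smul {f : X → ℂ} {g : X → E} (hf : DifferentiableAt ℝ f x)
    (hg : DifferentiableAt ℝ g x) :
    dirDeriv ξ (fun y => f y • g y) x = dirDeriv ξ f x • g x + f x • dirDeriv ξ g x := by
  simp only [dirDeriv, fderiv_fun_smul hf hg, _root_.add_apply, _root_.smul_apply,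
    ContinuousLinearMap.smulRight_apply, smul_add, add_smul, smul_assoc, smul_comm I (f x)]
  abel

lemma dirDeriv_mul {A : Type*} [NormedRing A] [NormedAlgebra ℂ A] {f g : X → A}
    (hf : DifferentiableAt ℝ f x) (hg : DifferentiableAt ℝ g x) :
    dirDeriv ξ (fun y => f y * g y) x = dirDeriv ξ f x * g x + f x * dirDeriv ξ g x := by
  simp only [dirDeriv, fderiv_fun_mul' hf hg, _root_.add_apply, _root_.smul_apply, smul_eq_mul,
    MulOpposite.smul_eq_mul_unop, MulOpposite.unop_op, smul_add, add_mul, mul_add,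
    smul_mul_assoc, mul_smul_comm]
  abel

lemma dirDeriv_star [StarAddMonoid E] [StarModule ℂ E] [ContinuousStar E] (f : X → E) :
    dirDeriv ξ (fun y => star (f y)) x = star (dirDeriv (conjDir ξ) f x) := by
  have : fderiv ℝ (fun y => star (f y)) x =
      (starL' ℝ : E ≃L[ℝ] E).toContinuousLinearMap ∘L fderiv ℝ f x :=
    (starL' ℝ : E ≃L[ℝ] E).comp_fderiv
  simp [dirDeriv, this, conjDir]

lemma contDiffAt_dirDeriv {m k : WithTop ℕ∞} {f : X → E} (hf : ContDiffAt ℝ k f x)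
    (hm : m + 1 ≤ k := by norm_num) : ContDiffAt ℝ m (dirDeriv ξ f) x := by
  have h := hf.fderiv_right hm
  exact (h.clm_apply contDiffAt_const).add ((h.clm_apply contDiffAt_const).const_smul I)

lemma dirDeriv_dirDeriv {f : X → E} (hf : ContDiffAt ℝ 2 f x) :
    dirDeriv ξ (dirDeriv η f) x =
      fderiv ℝ (fderiv ℝ f) x ξ.1 η.1 + I • fderiv ℝ (fderiv ℝ f) x ξ.1 η.2 +
      I • (fderiv ℝ (fderiv ℝ f) x ξ.2 η.1 + I • fderiv ℝ (fderiv ℝ f) x ξ.2 η.2) := by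
  have hd : DifferentiableAt ℝ (fderiv ℝ f) x :=
    (hf.fderiv_right (m := 1) (by norm_num)).differentiableAt (by norm_num)
  have happly (v : X) : HasFDerivAt (fun y => fderiv ℝ f y v)
      ((fderiv ℝ (fderiv ℝ f) x).flip v) x := by
    simpa using hd.hasFDerivAt.clm_apply (hasFDerivAt_const v x)
  have : HasFDerivAt (dirDeriv η f) ((fderiv ℝ (fderiv ℝ f) x).flip η.1 +
      I • (fderiv ℝ (fderiv ℝ f) x).flip η.2) x := (happly _).add ((happly _).const_smul I)
  simp [dirDeriv, this.fderiv]

lemma dirDeriv_comm {f : X → E} (hf : ContDiffAt ℝ 2 f x) :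
    dirDeriv ξ (dirDeriv η f) x = dirDeriv η (dirDeriv ξ f) x := by
  have hsymm : IsSymmSndFDerivAt ℝ f x := hf.isSymmSndFDerivAt (by simp)
  rw [dirDeriv_dirDeriv hf, dirDeriv_dirDeriv hf, hsymm.eq ξ.1 η.1, hsymm.eq ξ.1 η.2,
    hsymm.eq ξ.2 η.1, hsymm.eq ξ.2 η.2]
  simp only [smul_add]
  abel

end Calculus

noncomputable section MatrixCalculus

section

variable {X ι : Type*} [TopologicalSpace X] [Fintype ι] [DecidableEq ι] {F : X → Matrix ι ι ℂ}
  {x : X}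

lemma eventually_isUnit (hF : ContinuousAt F x) (hx : IsUnit (F x)) :
    ∀ᶠ y in 𝓝 x, IsUnit (F y) := by
  have : CompleteSpace (Matrix ι ι ℂ) := FiniteDimensional.complete ℂ _
  exact hF (Units.isOpen.mem_nhds hx)

end

variable {X : Type*} [NormedAddCommGroup X] [NormedSpace ℝ X] {ι : Type*} [Fintype ι]
  {k : WithTop ℕ∞} {ξ : X × X} {F : X → Matrix ι ι ℂ} {x : X}

/-- The coordinate function `A ↦ A i j`, used to pass between a matrix-valued function and its
entries. -/
def entryCLM (i j : ι) : Matrix ι ι ℂ →L[ℂ] ℂ :=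
  (Matrix.entryLinearMap ℂ ℂ i j).toContinuousLinearMap

/-- The trace as a continuous linear map. -/
def traceCLM (ι : Type*) [Fintype ι] : Matrix ι ι ℂ →L[ℂ] ℂ :=
  (Matrix.traceLinearMap ι ℂ ℂ).toContinuousLinearMap

/-- The conjugate transpose as a real continuous linear map. -/
def conjTransposeCLM (ι : Type*) [Fintype ι] : Matrix ι ι ℂ →L[ℝ] Matrix ι ι ℂ :=
  LinearMap.toContinuousLinearMap
    { toFun A := Aᴴ, map_add' A B := Matrix.conjTranspose_add A B, map_smul' c A := by simp }

lemma contDiffAt_matrix_iff :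
    ContDiffAt ℝ k F x ↔ ∀ i j, ContDiffAt ℝ k (fun y => F y i j) x := by
  classical
  refine ⟨fun h i j => ((entryCLM i j).restrictScalars ℝ).contDiff.contDiffAt.comp x h,
    fun h => ?_⟩
  have hsum : F = fun y => ∑ i, ∑ j, F y i j • Matrix.single i j (1 : ℂ) := by
    funext y
    simpa [Matrix.smul_single] using Matrix.matrix_eq_sum_single (F y)
  rw [hsum]
  exact ContDiffAt.sum fun i _ => ContDiffAt.sum fun j _ => (h i j).smul contDiffAt_const

lemma contDiffAt_trace (hF : ContDiffAt ℝ k F x) : ContDiffAt ℝ k (fun y => (F y).trace) x :=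
  ((traceCLM ι).restrictScalars ℝ).contDiff.contDiffAt.comp x hF

lemma contDiffAt_conjTranspose (hF : ContDiffAt ℝ k F x) : ContDiffAt ℝ k (fun y => (F y)ᴴ) x :=
  (conjTransposeCLM ι).contDiff.contDiffAt.comp x hF

lemma dirDeriv_apply (hF : DifferentiableAt ℝ F x) (i j : ι) :
    dirDeriv ξ (fun y => F y i j) x = dirDeriv ξ F x i j :=
  dirDeriv_clm_comp (entryCLM i j) hF

lemma dirDeriv_trace (hF : DifferentiableAt ℝ F x) :
    dirDeriv ξ (fun y => (F y).trace) x = (dirDeriv ξ F x).trace :=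
  dirDeriv_clm_comp (traceCLM ι) hF

lemma dirDeriv_conjTranspose (hF : DifferentiableAt ℝ F x) :
    dirDeriv ξ (fun y => (F y)ᴴ) x = (dirDeriv (conjDir ξ) F x)ᴴ := by
  have hstar : DifferentiableAt ℝ (fun y => (F y)ᴴ) x :=
    (conjTransposeCLM ι).differentiableAt.comp x hF
  ext i j
  rw [← dirDeriv_apply hstar, Matrix.conjTranspose_apply, ← dirDeriv_apply hF]
  exact dirDeriv_star fun y => F y j i

lemma conjTranspose_dirDeriv_of_isHermitian (hF : DifferentiableAt ℝ F x)
    (hherm : ∀ᶠ y in 𝓝 x, (F y).IsHermitian) :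
    (dirDeriv ξ F x)ᴴ = dirDeriv (conjDir ξ) F x := by
  rw [← dirDeriv_congr (ξ := conjDir ξ) (f := fun y => (F y)ᴴ) hherm, dirDeriv_conjTranspose hF,
    conjDir_conjDir]

variable [DecidableEq ι]

lemma contDiffAt_det (hF : ContDiffAt ℝ k F x) : ContDiffAt ℝ k (fun y => (F y).det) x := by
  simp only [Matrix.det_apply]
  exact ContDiffAt.sum fun σ _ =>
    (contDiffAt_prod fun i _ => contDiffAt_matrix_iff.1 hF _ _).const_smul _

lemma contDiffAt_inv (hF : ContDiffAt ℝ k F x) (hx : IsUnit (F x)) :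
    ContDiffAt ℝ k (fun y => (F y)⁻¹) x := by
  have : CompleteSpace (Matrix ι ι ℂ) := FiniteDimensional.complete ℂ _
  simp only [Matrix.nonsing_inv_eq_ringInverse]
  exact ContDiffAt.comp x (hx.unit_spec ▸ contDiffAt_ringInverse ℝ hx.unit) hF

lemma inv_mul_cancel_of_isUnit {A : Matrix ι ι ℂ} (hA : IsUnit A) : A⁻¹ * A = 1 :=
  A.nonsing_inv_mul ((Matrix.isUnit_iff_isUnit_det A).1 hA)

lemma mul_inv_cancel_of_isUnit {A : Matrix ι ι ℂ} (hA : IsUnit A) : A * A⁻¹ = 1 :=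
  A.mul_nonsing_inv ((Matrix.isUnit_iff_isUnit_det A).1 hA)

lemma differentiableAt_inv (hF : DifferentiableAt ℝ F x) (hx : IsUnit (F x)) :
    DifferentiableAt ℝ (fun y => (F y)⁻¹) x := by
  have : CompleteSpace (Matrix ι ι ℂ) := FiniteDimensional.complete ℂ _
  simp only [Matrix.nonsing_inv_eq_ringInverse]
  exact DifferentiableAt.comp x (hx.unit_spec ▸ differentiableAt_inverse (𝕜 := ℝ) hx.unit.isUnit) hF

lemma dirDeriv_inv (hF : DifferentiableAt ℝ F x) (hx : IsUnit (F x)) :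
    dirDeriv ξ (fun y => (F y)⁻¹) x = -((F x)⁻¹ * dirDeriv ξ F x * (F x)⁻¹) := by
  have hprod : dirDeriv ξ (fun y => F y * (F y)⁻¹) x = 0 := by
    rw [dirDeriv_congr ((eventually_isUnit hF.continuousAt hx).mono
      fun y hy => mul_inv_cancel_of_isUnit hy), dirDeriv_const]
  rw [dirDeriv_mul hF (differentiableAt_inv hF hx)] at hprod
  rw [← one_mul (dirDeriv ξ _ x), ← inv_mul_cancel_of_isUnit hx, mul_assoc,
    eq_neg_of_add_eq_zero_right hprod, mul_neg, mul_assoc]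

lemma sum_det_updateRow_eq_trace (A B : Matrix ι ι ℂ) :
    ∑ i, (A.updateRow i (B i)).det = (A.adjugate * B).trace := by
  rw [Matrix.trace_mul_comm]
  refine Finset.sum_congr rfl fun i _ => ?_
  rw [← Matrix.cramer_transpose_apply, Matrix.cramer_eq_adjugate_mulVec,
    ← Matrix.adjugate_transpose]
  simp [Matrix.mul_apply, Matrix.mulVec, dotProduct, mul_comm]

lemma dirDeriv_det_eq_sum (hF : DifferentiableAt ℝ F x) :
    dirDeriv ξ (fun y => (F y).det) x = ∑ i, ((F x).updateRow i (dirDeriv ξ F x i)).det := by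
  let detRow : ContinuousMultilinearMap ℝ (fun _ : ι => ι → ℂ) ℂ :=
    { Matrix.detRowAlternating.toMultilinearMap.restrictScalars ℝ with
      cont := Continuous.matrix_det continuous_id }
  have hrow (i : ι) : HasFDerivAt (fun y => F y i)
      (ContinuousLinearMap.pi fun j => (entryCLM i j).restrictScalars ℝ ∘L fderiv ℝ F x) x :=
    hasFDerivAt_pi.2 fun j => ((entryCLM i j).restrictScalars ℝ).hasFDerivAt.comp x hF.hasFDerivAt
  have hdet (v : X) :
      fderiv ℝ (fun y => (F y).det) x v = ∑ i, ((F x).updateRow i (fderiv ℝ F x v i)).det := by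
    rw [show fderiv ℝ (fun y => (F y).det) x = _ from
      (HasFDerivAt.multilinear_comp detRow hrow).fderiv]
    simp
    rfl
  simp only [dirDeriv, hdet, smul_eq_mul, Finset.mul_sum, ← Finset.sum_add_distrib]
  refine Finset.sum_congr rfl fun i _ => ?_
  change _ = ((F x).updateRow i (fderiv ℝ F x ξ.1 i + I • fderiv ℝ F x ξ.2 i)).det
  rw [Matrix.det_updateRow_add, Matrix.det_updateRow_smul]

lemma dirDeriv_det (hF : DifferentiableAt ℝ F x) (hx : IsUnit (F x)) :
    dirDeriv ξ (fun y => (F y).det) x = (F x).det * ((F x)⁻¹ * dirDeriv ξ F x).trace := by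
  have hadj : (F x).adjugate = (F x).det • (F x)⁻¹ := by
    rw [Matrix.inv_def, smul_smul,
      Ring.mul_inverse_cancel _ ((Matrix.isUnit_iff_isUnit_det _).1 hx), one_smul]
  rw [dirDeriv_det_eq_sum hF, sum_det_updateRow_eq_trace, hadj, Matrix.smul_mul,
    Matrix.trace_smul, smul_eq_mul]

end MatrixCalculus

/-! ### The Chern connection in matrix form -/

noncomputable section ChernConnection

variable {X : Type*} [NormedAddCommGroup X] [NormedSpace ℝ X] {ι : Type*} [Fintype ι]
  [DecidableEq ι] {ζ η τ : X × X} {G H : X → Matrix ι ι ℂ} {x : X} {m k : WithTop ℕ∞}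

/-- The matrix `(Γ_{ζ j}^p)_{jp}` of the Christoffel symbols of the Chern connection in the
direction `ζ`. -/
def christoffel (ζ : X × X) (G : X → Matrix ι ι ℂ) (x : X) : Matrix ι ι ℂ :=
  dirDeriv ζ G x * (G x)⁻¹

/-- The matrix `(Ω_{ζ η j k̄})_{jk}` of the Chern curvature; `ζ` is meant to be of type `(1,0)` and
`η` of type `(0,1)`. -/
def curvature (ζ η : X × X) (G : X → Matrix ι ι ℂ) (x : X) : Matrix ι ι ℂ :=
  -(dirDeriv η (christoffel ζ G) x * G x)

/-- The matrix `(∇_η h_{j k̄})_{jk}` of a covariant derivative in a `(0,1)` direction `η`, which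
only involves the connection through the index `k̄`. -/
def covDerivBar (η : X × X) (G H : X → Matrix ι ι ℂ) (x : X) : Matrix ι ι ℂ :=
  dirDeriv η H x - H x * (G x)⁻¹ * dirDeriv η G x

/-- The matrix `(∇_ζ ∇_η h_{j k̄})_{jk}` for `ζ` of type `(1,0)` and `η` of type `(0,1)`. -/
def secondCovDeriv (ζ η : X × X) (G H : X → Matrix ι ι ℂ) (x : X) : Matrix ι ι ℂ :=
  dirDeriv ζ (covDerivBar η G H) x - christoffel ζ G x * covDerivBar η G H x

lemma contDiffAt_christoffel (hG : ContDiffAt ℝ k G x) (hx : IsUnit (G x))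
    (hm : m + 1 ≤ k := by norm_num) : ContDiffAt ℝ m (christoffel ζ G) x :=
  (contDiffAt_dirDeriv hG hm).mul (contDiffAt_inv (hG.of_le (le_self_add.trans hm)) hx)

lemma contDiffAt_covDerivBar (hG : ContDiffAt ℝ k G x) (hx : IsUnit (G x))
    (hH : ContDiffAt ℝ k H x) (hm : m + 1 ≤ k := by norm_num) :
    ContDiffAt ℝ m (covDerivBar η G H) x :=
  have hmk : m ≤ k := le_self_add.trans hm
  (contDiffAt_dirDeriv hH hm).sub
    (((hH.of_le hmk).mul (contDiffAt_inv (hG.of_le hmk) hx)).mul (contDiffAt_dirDeriv hG hm))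

lemma secondCovDeriv_congr {H' : X → Matrix ι ι ℂ} (hH : H =ᶠ[𝓝 x] H') :
    secondCovDeriv ζ η G H x = secondCovDeriv ζ η G H' x := by
  have hcov : covDerivBar η G H =ᶠ[𝓝 x] covDerivBar η G H' := by
    filter_upwards [hH.eventuallyEq_nhds] with y hy
    rw [covDerivBar, covDerivBar, dirDeriv_congr hy, hy.self_of_nhds]
  rw [secondCovDeriv, secondCovDeriv, dirDeriv_congr hcov, hcov.self_of_nhds]

lemma curvature_eq (hG : ContDiffAt ℝ 2 G x) (hx : IsUnit (G x)) :
    curvature ζ η G x =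
      dirDeriv ζ G x * (G x)⁻¹ * dirDeriv η G x - dirDeriv η (dirDeriv ζ G) x := by
  have hG' : DifferentiableAt ℝ G x := hG.differentiableAt (by norm_num)
  have hprod : dirDeriv η (christoffel ζ G) x = _ :=
    dirDeriv_mul ((contDiffAt_dirDeriv (m := 1) hG).differentiableAt (by norm_num))
      (differentiableAt_inv hG' hx)
  rw [curvature, hprod, dirDeriv_inv hG' hx]
  simp only [add_mul, mul_neg, neg_mul, mul_assoc, inv_mul_cancel_of_isUnit hx, mul_one]
  abel

lemma contDiffAt_curvature (hG : ContDiffAt ℝ k G x) (hx : IsUnit (G x))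
    (hm : m + 1 + 1 ≤ k := by norm_num) : ContDiffAt ℝ m (curvature ζ η G) x :=
  ((contDiffAt_dirDeriv (contDiffAt_christoffel hG hx hm) le_rfl).mul
    (hG.of_le (le_self_add.trans (le_self_add.trans hm)))).neg

lemma dirDeriv_mul_inv_mul {A B : X → Matrix ι ι ℂ} (hA : DifferentiableAt ℝ A x)
    (hG : DifferentiableAt ℝ G x) (hB : DifferentiableAt ℝ B x) (hx : IsUnit (G x)) :
    dirDeriv ζ (fun y => A y * (G y)⁻¹ * B y) x =
      dirDeriv ζ A x * (G x)⁻¹ * B x - A x * (G x)⁻¹ * dirDeriv ζ G x * (G x)⁻¹ * B x +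
        A x * (G x)⁻¹ * dirDeriv ζ B x := by
  have hI := differentiableAt_inv hG hx
  rw [dirDeriv_mul (hA.fun_mul hI) hB, dirDeriv_mul hA hI, dirDeriv_inv hG hx]
  noncomm_ring

lemma dirDeriv_curvature (hG : ContDiffAt ℝ 3 G x) (hx : IsUnit (G x)) :
    dirDeriv τ (curvature ζ η G) x =
      dirDeriv τ G x * (G x)⁻¹ * curvature ζ η G x - secondCovDeriv ζ η G (dirDeriv τ G) x := by
  have hG2 : ContDiffAt ℝ 2 G x := hG.of_le (by norm_num)
  have hG1 : DifferentiableAt ℝ G x := hG.differentiableAt (by norm_num)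
  have hD (ξ : X × X) : ContDiffAt ℝ 2 (dirDeriv ξ G) x := contDiffAt_dirDeriv hG
  have hD1 (ξ : X × X) : DifferentiableAt ℝ (dirDeriv ξ G) x :=
    (hD ξ).differentiableAt (by norm_num)
  have hDD (ξ ξ' : X × X) : DifferentiableAt ℝ (dirDeriv ξ (dirDeriv ξ' G)) x :=
    (contDiffAt_dirDeriv (m := 1) (hD ξ')).differentiableAt (by norm_num)
  have hprod (ξ : X × X) :
      DifferentiableAt ℝ (fun y => dirDeriv ξ G y * (G y)⁻¹ * dirDeriv η G y) x :=
    ((hD1 ξ).mul (differentiableAt_inv hG1 hx)).mul (hD1 η)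
  have hcurv : curvature ζ η G =ᶠ[𝓝 x] fun y =>
      dirDeriv ζ G y * (G y)⁻¹ * dirDeriv η G y - dirDeriv η (dirDeriv ζ G) y := by
    filter_upwards [hG2.eventually (by norm_num), eventually_isUnit hG.continuousAt hx]
      with y hy hy' using curvature_eq hy hy'
  have hcov : dirDeriv ζ (covDerivBar η G (dirDeriv τ G)) x = _ :=
    dirDeriv_sub (hDD η τ) (hprod τ)
  have hthird : dirDeriv τ (dirDeriv η (dirDeriv ζ G)) x =
      dirDeriv ζ (dirDeriv η (dirDeriv τ G)) x := by
    rw [dirDeriv_comm (hD ζ), dirDeriv_congr ((hG2.eventually (by norm_num)).mono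
      fun y hy => dirDeriv_comm (ξ := τ) (η := ζ) hy), dirDeriv_comm (hD τ)]
  rw [dirDeriv_congr hcurv, dirDeriv_sub (hprod ζ) (hDD η ζ), secondCovDeriv, hcov,
    dirDeriv_mul_inv_mul (hD1 ζ) hG1 (hD1 η) hx, dirDeriv_mul_inv_mul (hD1 τ) hG1 (hD1 η) hx,
    curvature_eq hG2 hx, christoffel, covDerivBar, hthird, dirDeriv_comm (ξ := τ) (η := ζ) hG2,
    dirDeriv_comm (ξ := τ) (η := η) hG2, dirDeriv_comm (ξ := ζ) (η := η) hG2]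
  noncomm_ring

lemma dirDeriv_trace_inv_mul (hG : DifferentiableAt ℝ G x) (hx : IsUnit (G x))
    (hH : DifferentiableAt ℝ H x) :
    dirDeriv ζ (fun y => ((G y)⁻¹ * H y).trace) x =
      ((G x)⁻¹ * (dirDeriv ζ H x - dirDeriv ζ G x * (G x)⁻¹ * H x)).trace := by
  have hI := differentiableAt_inv hG hx
  rw [dirDeriv_trace (hI.fun_mul hH), dirDeriv_mul hI hH, dirDeriv_inv hG hx]
  congr 1
  noncomm_ring

lemma trace_inv_mul_covDerivBar (hG : DifferentiableAt ℝ G x) (hx : IsUnit (G x))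
    (hH : DifferentiableAt ℝ H x) :
    ((G x)⁻¹ * covDerivBar η G H x).trace = dirDeriv η (fun y => ((G y)⁻¹ * H y).trace) x := by
  have hcyclic : ((G x)⁻¹ * (H x * (G x)⁻¹ * dirDeriv η G x)).trace =
      ((G x)⁻¹ * (dirDeriv η G x * (G x)⁻¹ * H x)).trace := by
    simpa only [mul_assoc] using
      Matrix.trace_mul_comm ((G x)⁻¹ * H x) ((G x)⁻¹ * dirDeriv η G x)
  rw [dirDeriv_trace_inv_mul hG hx hH, covDerivBar, mul_sub, mul_sub, Matrix.trace_sub,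
    Matrix.trace_sub, hcyclic]

lemma trace_inv_mul_secondCovDeriv (hG : ContDiffAt ℝ 2 G x) (hx : IsUnit (G x))
    (hH : ContDiffAt ℝ 2 H x) :
    ((G x)⁻¹ * secondCovDeriv ζ η G H x).trace =
      dirDeriv ζ (dirDeriv η fun y => ((G y)⁻¹ * H y).trace) x := by
  have hbar : dirDeriv η (fun y => ((G y)⁻¹ * H y).trace) =ᶠ[𝓝 x]
      fun y => ((G y)⁻¹ * covDerivBar η G H y).trace := by
    filter_upwards [hG.eventually (by norm_num), hH.eventually (by norm_num),
      eventually_isUnit hG.continuousAt hx] with y hGy hHy hy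
    exact (trace_inv_mul_covDerivBar (hGy.differentiableAt (by norm_num)) hy
      (hHy.differentiableAt (by norm_num))).symm
  rw [dirDeriv_congr hbar, dirDeriv_trace_inv_mul (hG.differentiableAt (by norm_num)) hx
    ((contDiffAt_covDerivBar (m := 1) hG hx hH).differentiableAt (by norm_num)), secondCovDeriv,
    christoffel]

end ChernConnection

/-! ### Quadratic expressions in the torsion -/

section Contraction

variable {ι E : Type*} [Fintype ι] [AddCommMonoid E] [Module ℂ E]

/-- The contraction `g^{i j̄} f_{i j̄}`, where `P = G⁻¹` is the inverse of the matrix of the metric,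
so that `g^{i j̄} = P j i`. -/
def contract (P : Matrix ι ι ℂ) (f : ι → ι → E) : E := ∑ i, ∑ j, P j i • f i j

variable {P A : Matrix ι ι ℂ}

lemma trace_mul_eq_contract (B : Matrix ι ι ℂ) : (P * B).trace = contract P fun k l => B k l :=
  Finset.sum_comm

lemma mul_contract (f : ι → ι → Matrix ι ι ℂ) :
    A * contract P f = contract P fun i j => A * f i j := by
  simp only [contract, Matrix.mul_sum, Matrix.mul_smul]

lemma trace_contract (f : ι → ι → Matrix ι ι ℂ) :
    (contract P f).trace = contract P fun i j => (f i j).trace := by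
  simp only [contract, Matrix.trace_sum, Matrix.trace_smul]

lemma contract_eq_sum_prod (f : ι → ι → E) :
    contract P f = ∑ p : ι × ι, P p.2 p.1 • f p.1 p.2 :=
  (Fintype.sum_prod_type' fun i j => P j i • f i j).symm

lemma contract_add (f f' : ι → ι → E) :
    contract P (fun i j => f i j + f' i j) = contract P f + contract P f' := by
  simp only [contract, smul_add, Finset.sum_add_distrib]

lemma contract_sum {κ : Type*} (s : Finset κ) (f : κ → ι → ι → E) :
    contract P (fun i j => ∑ a ∈ s, f a i j) = ∑ a ∈ s, contract P (f a) := by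
  simp only [contract_eq_sum_prod, Finset.smul_sum]
  exact Finset.sum_comm

lemma contract_smul_const (c : ι → ι → ℂ) (v : E) :
    contract P (fun i j => c i j • v) = contract P c • v := by
  simp only [contract, Finset.sum_smul, smul_assoc]

lemma contract_comm (f : ι → ι → ι → ι → E) :
    contract P (fun i j => contract P (f i j)) =
      contract P fun k l => contract P fun i j => f i j k l := by
  simp only [contract_eq_sum_prod, Finset.smul_sum]
  rw [Finset.sum_comm]
  exact Finset.sum_congr rfl fun _ _ => Finset.sum_congr rfl fun _ _ => smul_comm _ _ _

lemma contract_mul_contract (f f' : ι → ι → ℂ) :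
    contract P f * contract P f' = contract P fun i j => contract P fun k l => f i j * f' k l := by
  rw [← smul_eq_mul, ← contract_smul_const]
  simp only [contract, smul_eq_mul, Finset.mul_sum, mul_left_comm]

lemma contract_apply (f : ι → ι → Matrix ι ι ℂ) (k l : ι) :
    contract P f k l = contract P fun i j => f i j k l := by
  simp only [contract, Matrix.sum_apply, Matrix.smul_apply]

lemma contract_neg_left {E : Type*} [AddCommGroup E] [Module ℂ E] (f : ι → ι → E) :
    contract (-P) f = -contract P f := by
  simp only [contract, Matrix.neg_apply, neg_smul, Finset.sum_neg_distrib]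

lemma contract_sub {E : Type*} [AddCommGroup E] [Module ℂ E] (f f' : ι → ι → E) :
    contract P (fun i j => f i j - f' i j) = contract P f - contract P f' := by
  simp only [contract, smul_sub, Finset.sum_sub_distrib]

lemma mul_mul_apply_eq_contract (A B : Matrix ι ι ℂ) (k l : ι) :
    (A * P * B) k l = contract P fun i j => A k j * B i l := by
  simp only [contract, Matrix.mul_apply, Finset.sum_mul, smul_eq_mul]
  exact Finset.sum_congr rfl fun i _ => Finset.sum_congr rfl fun j _ => by ring

lemma trace_mul_mul_mul_eq_contract (A B : Matrix ι ι ℂ) :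
    (P * A * P * B).trace =
      contract P fun k l => contract P fun m q => A k q * B m l := by
  rw [mul_assoc, mul_assoc, ← mul_assoc A, trace_mul_eq_contract]
  simp only [mul_mul_apply_eq_contract]

lemma contract_conjTranspose_mul_mul (f : ι → ι → E) :
    contract (Aᴴ * P * A) f =
      contract P fun i j => ∑ a, ∑ b, (A i a * star (A j b)) • f a b := by
  rw [show contract (Aᴴ * P * A) f = ∑ a, ∑ b, (Aᴴ * P * A) b a • f a b from rfl]
  simp only [contract_sum, contract_smul_const, mul_mul_apply_eq_contract,
    Matrix.conjTranspose_apply, mul_comm (star _)]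

end Contraction

noncomputable section TorsionQuadratic

variable {ι : Type*} [Fintype ι] {P A : Matrix ι ι ℂ} {T : ι → Matrix ι ι ℂ}

/-- The matrix `(Q_{i j̄})_{ij}` as a quadratic expression in the matrices `T i = (T_{i j k̄})_{jk}`
of the torsion, `P` being the inverse of the matrix of the metric. -/
def torsionQuadratic (P : Matrix ι ι ℂ) (T : ι → Matrix ι ι ℂ) : Matrix ι ι ℂ :=
  (1 / 2 : ℂ) • Matrix.of (fun i j => (P * T i * P * (T j)ᴴ).trace)
    - (1 / 4 : ℂ) • contract P (fun k l => (T l)ᴴ * P * T k)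
    - (1 / 2 : ℂ) • Matrix.of (fun i j => (P * T i).trace * star (P * T j).trace)
    + (1 / 2 : ℂ) • contract P fun m q => (P * T m).trace • (T q)ᴴ + star (P * T q).trace • T m

lemma torsionQuadratic_zero : torsionQuadratic P 0 = 0 := by
  ext i j
  simp [torsionQuadratic, contract]

/-- The squared norm of the torsion. -/
def torsionNormSq (P : Matrix ι ι ℂ) (T : ι → Matrix ι ι ℂ) : ℂ :=
  contract P fun i j => (P * T i * P * (T j)ᴴ).trace

/-- The squared norm of the trace `T_{i k l̄} g^{k l̄}` of the torsion. -/
def torsionTraceNormSq (P : Matrix ι ι ℂ) (T : ι → Matrix ι ι ℂ) : ℂ :=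
  contract P fun i j => (P * T i).trace * star (P * T j).trace

lemma trace_mul_conjTranspose_of_isHermitian (hP : P.IsHermitian) (B : Matrix ι ι ℂ) :
    (P * Bᴴ).trace = star (P * B).trace := by
  rw [← Matrix.trace_conjTranspose, Matrix.conjTranspose_mul, hP.eq, Matrix.trace_mul_comm]

lemma torsionQuadratic_apply (hP : P.IsHermitian) (i j : ι) :
    torsionQuadratic P T i j =
      (1 / 2 : ℂ) * contract P (fun k l => contract P fun m q => T i k q * star (T j l m))
      - (1 / 4 : ℂ) * contract P (fun k l => contract P fun m q => star (T l q i) * T k m j)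
      - (1 / 2 : ℂ) * contract P (fun k l => contract P fun m q => T i k l * star (T j q m))
      + (1 / 2 : ℂ) * contract P (fun k l => contract P fun m q =>
          T m k l * star (T q j i) + star (T q l k) * T m i j) := by
  have hstar (q : ι) : star (P * T q).trace = contract P fun k l => star (T q l k) := by
    rw [← trace_mul_conjTranspose_of_isHermitian hP, trace_mul_eq_contract]
    rfl
  have hdiag : (P * T i).trace * star (P * T j).trace =
      contract P fun k l => contract P fun m q => T i k l * star (T j q m) := by
    rw [hstar, trace_mul_eq_contract, contract_mul_contract]
  have hmul (f : ι → ι → ℂ) (c : ℂ) :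
      contract P f * c = contract P fun k l => f k l * c := (contract_smul_const f c).symm
  have hswap := contract_comm (P := P) fun k l m q =>
    T m k l * star (T q j i) + star (T q l k) * T m i j
  simp only [hdiag, hswap, torsionQuadratic, Matrix.add_apply, Matrix.sub_apply, Matrix.smul_apply,
    Matrix.of_apply, contract_apply, trace_mul_mul_mul_eq_contract, mul_mul_apply_eq_contract,
    Matrix.conjTranspose_apply, smul_eq_mul]
  simp only [hstar]
  simp only [trace_mul_eq_contract, hmul, contract_add]

lemma trace_mul_torsionQuadratic (hP : P.IsHermitian) :
    (P * torsionQuadratic P T).trace =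
      (1 / 4 : ℂ) * torsionNormSq P T + (1 / 2 : ℂ) * torsionTraceNormSq P T := by
  have hcyclic (k l : ι) : (P * ((T l)ᴴ * P * T k)).trace = (P * T k * P * (T l)ᴴ).trace := by
    simpa only [mul_assoc] using Matrix.trace_mul_comm (P * (T l)ᴴ) (P * T k)
  have hquad : (P * contract P fun k l => (T l)ᴴ * P * T k).trace = torsionNormSq P T := by
    simp only [mul_contract, trace_contract, hcyclic, torsionNormSq]
  have hmixed : (P * contract P fun m q =>
      (P * T m).trace • (T q)ᴴ + star (P * T q).trace • T m).trace =
        2 * torsionTraceNormSq P T := by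
    simp only [mul_contract, trace_contract, Matrix.mul_add, Matrix.mul_smul, Matrix.trace_add,
      Matrix.trace_smul, trace_mul_conjTranspose_of_isHermitian hP, smul_eq_mul,
      contract_add]
    rw [two_mul, torsionTraceNormSq]
    simp only [mul_comm (star _)]
  have hdiag (f : ι → ι → ℂ) : (P * Matrix.of f).trace = contract P f := trace_mul_eq_contract _
  rw [torsionQuadratic, Matrix.mul_add, Matrix.mul_sub, Matrix.mul_sub, Matrix.trace_add,
    Matrix.trace_sub, Matrix.trace_sub]
  simp only [Matrix.mul_smul, Matrix.trace_smul, hquad, hmixed, hdiag, smul_eq_mul]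
  rw [← torsionNormSq, ← torsionTraceNormSq]
  ring

variable {T' : ι → Matrix ι ι ℂ}

/- The torsion of a metric transforms under a change of holomorphic coordinates with Jacobian
matrix `A` by `T i = ∑ a, A i a • (A * T' a * Aᴴ)`. -/
lemma torsionNormSq_changeFrame (hT : ∀ i, T i = ∑ a, A i a • (A * T' a * Aᴴ)) :
    torsionNormSq P T = torsionNormSq (Aᴴ * P * A) T' := by
  have hcyclic (a b : ι) : (P * (A * T' a * Aᴴ) * P * (A * T' b * Aᴴ)ᴴ).trace =
      (Aᴴ * P * A * T' a * (Aᴴ * P * A) * (T' b)ᴴ).trace := by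
    simp only [Matrix.conjTranspose_mul, Matrix.conjTranspose_conjTranspose, mul_assoc]
    rw [Matrix.trace_mul_comm Aᴴ]
    simp only [mul_assoc]
  have htrace (i j : ι) : (P * T i * P * (T j)ᴴ).trace = ∑ a, ∑ b, (A i a * star (A j b)) •
      (Aᴴ * P * A * T' a * (Aᴴ * P * A) * (T' b)ᴴ).trace := by
    simp only [hT, ← hcyclic, Matrix.conjTranspose_sum, Matrix.conjTranspose_smul, Matrix.mul_sum,
      Matrix.sum_mul, Matrix.mul_smul, Matrix.smul_mul, Matrix.trace_sum, Matrix.trace_smul,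
      mul_smul, Finset.smul_sum]
    rw [Finset.sum_comm]
    exact Finset.sum_congr rfl fun a _ => Finset.sum_congr rfl fun b _ => smul_comm _ _ _
  rw [torsionNormSq, torsionNormSq, contract_conjTranspose_mul_mul]
  simp only [htrace]

lemma torsionTraceNormSq_changeFrame (hT : ∀ i, T i = ∑ a, A i a • (A * T' a * Aᴴ)) :
    torsionTraceNormSq P T = torsionTraceNormSq (Aᴴ * P * A) T' := by
  have htrace (i : ι) : (P * T i).trace = ∑ a, A i a * (Aᴴ * P * A * T' a).trace := by
    have hcyclic (a : ι) : (P * (A * T' a * Aᴴ)).trace = (Aᴴ * P * A * T' a).trace := by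
      simpa only [mul_assoc] using Matrix.trace_mul_comm (P * A * T' a) Aᴴ
    simp only [hT, Matrix.mul_sum, Matrix.mul_smul, Matrix.trace_sum, Matrix.trace_smul,
      smul_eq_mul, hcyclic]
  rw [torsionTraceNormSq, torsionTraceNormSq, contract_conjTranspose_mul_mul]
  simp only [htrace, star_sum, star_mul', Finset.sum_mul_sum, smul_eq_mul, mul_mul_mul_comm]

end TorsionQuadratic

noncomputable section ContractionCalculus

variable {X E : Type*} [NormedAddCommGroup X] [NormedSpace ℝ X] [NormedAddCommGroup E]
  [NormedSpace ℂ E] {ι : Type*} [Fintype ι] {ξ : X × X} {x : X} {k : WithTop ℕ∞}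

section

variable {P : X → Matrix ι ι ℂ} {f : ι → ι → X → E}

lemma contDiffAt_contract (hP : ContDiffAt ℝ k P x) (hf : ∀ i j, ContDiffAt ℝ k (f i j) x) :
    ContDiffAt ℝ k (fun y => contract (P y) fun i j => f i j y) x :=
  ContDiffAt.sum fun i _ => ContDiffAt.sum fun j _ => (contDiffAt_matrix_iff.1 hP j i).smul (hf i j)

lemma dirDeriv_contract (hP : DifferentiableAt ℝ P x) (hf : ∀ i j, DifferentiableAt ℝ (f i j) x) :
    dirDeriv ξ (fun y => contract (P y) fun i j => f i j y) x =
      contract (dirDeriv ξ P x) (fun i j => f i j x) +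
        contract (P x) fun i j => dirDeriv ξ (f i j) x := by
  have hentry (i j : ι) : DifferentiableAt ℝ (fun y => P y j i) x :=
    ((entryCLM j i).restrictScalars ℝ).differentiableAt.comp x hP
  simp only [contract_eq_sum_prod]
  rw [dirDeriv_sum fun p _ => (hentry p.1 p.2).smul (hf p.1 p.2), ← Finset.sum_add_distrib]
  refine Finset.sum_congr rfl fun p _ => ?_
  rw [dirDeriv_smul (hentry p.1 p.2) (hf p.1 p.2), dirDeriv_apply hP]

end

section

open Asymptotics

variable {Y : Type*} {l : Filter Y} {u : Y → ℝ} {P : Y → Matrix ι ι ℂ}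

lemma isBigO_contract (hP : P =O[l] fun _ => (1 : ℝ)) {f : ι → ι → Y → E}
    (hf : ∀ i j, f i j =O[l] u) : (fun y => contract (P y) fun i j => f i j y) =O[l] u := by
  have hentry (i j : ι) : (fun y => P y j i) =O[l] fun _ => (1 : ℝ) :=
    ((entryCLM j i).isBigO_comp P l).trans hP
  have hterm (i j : ι) : (fun y => P y j i • f i j y) =O[l] u := by
    simpa using (hentry i j).smul (hf i j)
  exact IsBigO.fun_sum fun i _ => IsBigO.fun_sum fun j _ => hterm i j

lemma isBigO_torsionQuadratic_apply {T : Y → ι → Matrix ι ι ℂ}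
    (hP : P =O[l] fun _ => (1 : ℝ))
    (hT : ∀ i, (T · i) =O[l] u) (i j : ι) :
    (fun y => torsionQuadratic (P y) (T y) i j) =O[l] fun y => u y * u y := by
  classical
  have hstar (i : ι) : (fun y => (T y i)ᴴ) =O[l] u :=
    ((conjTransposeCLM ι).isBigO_comp _ l).trans (hT i)
  have hPT (i : ι) : (fun y => P y * T y i) =O[l] u := by simpa using hP.mul (hT i)
  have htrace {A : Y → Matrix ι ι ℂ} {a : Y → ℝ} (hA : A =O[l] a) :
      (fun y => (A y).trace) =O[l] a := ((traceCLM ι).isBigO_comp A l).trans hA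
  have htraceStar (i : ι) : (fun y => star (P y * T y i).trace) =O[l] u :=
    (htrace (hPT i)).norm_left.congr_left (fun y => (norm_star _).symm) |>.of_norm_left
  have hentry {A : Y → Matrix ι ι ℂ} {a : Y → ℝ} (hA : A =O[l] a) :
      (fun y => A y i j) =O[l] a := ((entryCLM i j).isBigO_comp A l).trans hA
  simp only [torsionQuadratic, Matrix.add_apply, Matrix.sub_apply, Matrix.smul_apply,
    Matrix.of_apply, smul_eq_mul]
  refine IsBigO.add (IsBigO.sub (IsBigO.sub ?_ ?_) ?_) ?_ <;> refine IsBigO.const_mul_left ?_ _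
  · refine htrace (A := fun y => P y * T y i * P y * (T y j)ᴴ) ?_
    simpa using ((hPT i).mul hP).mul (hstar j)
  · refine hentry (isBigO_contract hP fun k l => ?_)
    simpa using ((hstar l).mul hP).mul (hT k)
  · exact (htrace (hPT i)).mul (htraceStar j)
  · refine hentry (isBigO_contract hP fun k l => ?_)
    exact ((htrace (hPT k)).smul (hstar l)).add ((htraceStar l).smul (hT k))

end

end ContractionCalculus

/-! ### First variation of `S - Q` -/

noncomputable section Variation

variable {X : Type*} [NormedAddCommGroup X] [NormedSpace ℝ X] {ι : Type*}
  {ζ : ι → X × X} {τ : X × X} {G : X → Matrix ι ι ℂ} {x : X} {m k : WithTop ℕ∞}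

/-- The matrices `(T_{i j k̄})_{jk}` of the torsion of the Chern connection, for a frame `ζ` of
directions of type `(1,0)`. -/
def torsionMatrix [Fintype ι] (ζ : ι → X × X) (G : X → Matrix ι ι ℂ) (x : X) (i : ι) :
    Matrix ι ι ℂ :=
  Matrix.of fun j k => dirDeriv (ζ i) G x j k - dirDeriv (ζ j) G x i k

variable [Fintype ι]

lemma contDiffAt_torsionMatrix (hG : ContDiffAt ℝ k G x) (i : ι) (hm : m + 1 ≤ k := by norm_num) :
    ContDiffAt ℝ m (torsionMatrix ζ G · i) x :=
  contDiffAt_matrix_iff.2 fun j l =>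
    (contDiffAt_matrix_iff.1 (contDiffAt_dirDeriv hG hm) j l).sub
      (contDiffAt_matrix_iff.1 (contDiffAt_dirDeriv hG hm) i l)

lemma contDiffAt_torsionQuadratic {P : X → Matrix ι ι ℂ} {T : X → ι → Matrix ι ι ℂ}
    (hP : ContDiffAt ℝ k P x) (hT : ∀ i, ContDiffAt ℝ k (T · i) x) :
    ContDiffAt ℝ k (fun y => torsionQuadratic (P y) (T y)) x := by
  classical
  have hstar (i : ι) : ContDiffAt ℝ k (fun y => (T y i)ᴴ) x := contDiffAt_conjTranspose (hT i)
  have htrace (i : ι) : ContDiffAt ℝ k (fun y => (P y * T y i).trace) x :=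
    contDiffAt_trace (hP.mul (hT i))
  have htraceStar (i : ι) : ContDiffAt ℝ k (fun y => star (P y * T y i).trace) x :=
    (starL' ℝ : ℂ ≃L[ℝ] ℂ).contDiff.contDiffAt.comp x (htrace i)
  refine ContDiffAt.add (ContDiffAt.sub (ContDiffAt.sub ?_ ?_) ?_) ?_ <;>
    refine ContDiffAt.const_smul _ ?_
  · exact contDiffAt_matrix_iff.2 fun i j =>
      contDiffAt_trace (((hP.mul (hT i)).mul hP).mul (hstar j))
  · exact contDiffAt_contract hP fun i j => ((hstar j).mul hP).mul (hT i)
  · exact contDiffAt_matrix_iff.2 fun i j => (htrace i).mul (htraceStar j)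
  · exact contDiffAt_contract hP fun i j =>
      ((htrace i).smul (hstar j)).add ((htraceStar j).smul (hT i))

/- `Q` is quadratic in the torsion, hence vanishes to second order where the torsion vanishes. -/
lemma dirDeriv_torsionQuadratic_of_eq_zero {P : X → Matrix ι ι ℂ} {T : X → ι → Matrix ι ι ℂ}
    (hP : DifferentiableAt ℝ P x) (hT : ∀ i, DifferentiableAt ℝ (T · i) x) (hT0 : T x = 0)
    (hQ : DifferentiableAt ℝ (fun y => torsionQuadratic (P y) (T y)) x) :
    dirDeriv τ (fun y => torsionQuadratic (P y) (T y)) x = 0 := by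
  have hTO (i : ι) : (T · i) =O[𝓝 x] fun y => ‖y - x‖ := by
    simpa [hT0] using (hT i).isBigO_sub.norm_right
  ext i j
  have hQO : (fun y => torsionQuadratic (P y) (T y) i j) =O[𝓝 x] fun y => ‖y - x‖ ^ 2 := by
    have hPO : P =O[𝓝 x] fun _ => (1 : ℝ) := hP.continuousAt.isBigO_one ℝ
    simpa only [sq] using isBigO_torsionQuadratic_apply hPO hTO i j
  have hzero : HasFDerivAt (𝕜 := ℝ) (fun y => torsionQuadratic (P y) (T y) i j) 0 x :=
    hQO.hasFDerivAt (𝕜 := ℝ) one_lt_two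
  rw [← dirDeriv_apply hQ]
  simp only [dirDeriv, hzero.fderiv, _root_.zero_apply, smul_zero, add_zero, Matrix.zero_apply]

variable [DecidableEq ι]

/-- The matrix `(S_{j k̄})_{jk}` of the second Ricci curvature
`S_{j k̄} = g^{l m̄} Ω_{l m̄ j k̄}`. -/
def secondRicci (ζ : ι → X × X) (G : X → Matrix ι ι ℂ) (x : X) : Matrix ι ι ℂ :=
  contract (G x)⁻¹ fun l m => curvature (ζ l) (conjDir (ζ m)) G x

/-- The matrix of the tensor `S - Q`, the velocity of the unnormalized Hermitian curvature flow. -/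
def flowTensor (ζ : ι → X × X) (G : X → Matrix ι ι ℂ) (x : X) : Matrix ι ι ℂ :=
  secondRicci ζ G x - torsionQuadratic (G x)⁻¹ (torsionMatrix ζ G x)

/-- The scalar `tr_g (S - Q)`. -/
def flowScalar (ζ : ι → X × X) (G : X → Matrix ι ι ℂ) (x : X) : ℂ :=
  ((G x)⁻¹ * flowTensor ζ G x).trace

/-- The complex Laplacian `g^{l m̄} ∂_l ∂_m̄ v`. -/
def laplacian (ζ : ι → X × X) (G : X → Matrix ι ι ℂ) (v : X → ℂ) (x : X) : ℂ :=
  contract (G x)⁻¹ fun l m => dirDeriv (ζ l) (dirDeriv (conjDir (ζ m)) v) x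

lemma contDiffAt_secondRicci (hG : ContDiffAt ℝ k G x) (hx : IsUnit (G x))
    (hm : m + 1 + 1 ≤ k := by norm_num) : ContDiffAt ℝ m (secondRicci ζ G) x :=
  contDiffAt_contract (contDiffAt_inv (hG.of_le (le_self_add.trans (le_self_add.trans hm))) hx)
    fun _ _ => contDiffAt_curvature hG hx hm

lemma contDiffAt_torsionQuadratic_torsionMatrix (hG : ContDiffAt ℝ k G x) (hx : IsUnit (G x))
    (hm : m + 1 ≤ k := by norm_num) :
    ContDiffAt ℝ m (fun y => torsionQuadratic (G y)⁻¹ (torsionMatrix ζ G y)) x :=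
  contDiffAt_torsionQuadratic (contDiffAt_inv (hG.of_le (le_self_add.trans hm)) hx)
    fun i => contDiffAt_torsionMatrix hG i hm

lemma contDiffAt_flowTensor (hG : ContDiffAt ℝ k G x) (hx : IsUnit (G x))
    (hm : m + 1 + 1 ≤ k := by norm_num) : ContDiffAt ℝ m (flowTensor ζ G) x :=
  (contDiffAt_secondRicci hG hx hm).sub
    (contDiffAt_torsionQuadratic_torsionMatrix hG hx (le_self_add.trans hm))

lemma contDiffAt_flowScalar (hG : ContDiffAt ℝ k G x) (hx : IsUnit (G x))
    (hm : m + 1 + 1 ≤ k := by norm_num) : ContDiffAt ℝ m (flowScalar ζ G) x :=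
  contDiffAt_trace <| (contDiffAt_inv (hG.of_le (le_self_add.trans (le_self_add.trans hm))) hx).mul
    (contDiffAt_flowTensor hG hx hm)

lemma flowScalar_eq (hherm : (G x).IsHermitian) : flowScalar ζ G x =
    contract (G x)⁻¹ (fun l m => ((G x)⁻¹ * curvature (ζ l) (conjDir (ζ m)) G x).trace) -
      ((1 / 4 : ℂ) * torsionNormSq (G x)⁻¹ (torsionMatrix ζ G x) +
        (1 / 2 : ℂ) * torsionTraceNormSq (G x)⁻¹ (torsionMatrix ζ G x)) := by
  rw [flowScalar, flowTensor, mul_sub, Matrix.trace_sub, trace_mul_torsionQuadratic hherm.inv,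
    secondRicci, mul_contract, trace_contract]

lemma flowScalar_congr {H : X → Matrix ι ι ℂ} (h : G =ᶠ[𝓝 x] H) :
    flowScalar ζ G x = flowScalar ζ H x := by
  have hderiv (ξ : X × X) : dirDeriv ξ G =ᶠ[𝓝 x] dirDeriv ξ H :=
    h.eventuallyEq_nhds.mono fun _ hy => dirDeriv_congr hy
  have hΓ (ξ : X × X) : christoffel ξ G =ᶠ[𝓝 x] christoffel ξ H := by
    filter_upwards [hderiv ξ, h] with y hdy hy
    rw [christoffel, christoffel, hdy, hy]
  have hT : torsionMatrix ζ G x = torsionMatrix ζ H x := by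
    funext i
    rw [torsionMatrix, torsionMatrix]
    simp only [(hderiv _).self_of_nhds]
  simp only [flowScalar, flowTensor, secondRicci, curvature, hT, dirDeriv_congr (hΓ _),
    h.self_of_nhds]

lemma dirDeriv_secondRicci (hG : ContDiffAt ℝ 3 G x) (hx : IsUnit (G x)) :
    dirDeriv τ (secondRicci ζ G) x =
      dirDeriv τ G x * (G x)⁻¹ * secondRicci ζ G x
      - contract (G x)⁻¹ (fun l m => secondCovDeriv (ζ l) (conjDir (ζ m)) G (dirDeriv τ G) x)
      - contract ((G x)⁻¹ * dirDeriv τ G x * (G x)⁻¹)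
          fun l m => curvature (ζ l) (conjDir (ζ m)) G x := by
  have hG1 : DifferentiableAt ℝ G x := hG.differentiableAt (by norm_num)
  have hderiv : dirDeriv τ (secondRicci ζ G) x = _ :=
    dirDeriv_contract (differentiableAt_inv hG1 hx) fun l m =>
      (contDiffAt_curvature (m := 1) (ζ := ζ l) (η := conjDir (ζ m)) hG hx).differentiableAt
        (by norm_num)
  simp only [hderiv, dirDeriv_inv hG1 hx, dirDeriv_curvature hG hx, secondRicci, mul_contract,
    contract_sub, contract_neg_left]
  abel

lemma dirDeriv_flowTensor (hG : ContDiffAt ℝ 3 G x) (hx : IsUnit (G x))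
    (hT : torsionMatrix ζ G x = 0) :
    dirDeriv τ (flowTensor ζ G) x = dirDeriv τ (secondRicci ζ G) x := by
  have hQ := (contDiffAt_torsionQuadratic_torsionMatrix (m := 1) (ζ := ζ)
    (hG.of_le (by norm_num : (2 : WithTop ℕ∞) ≤ 3)) hx).differentiableAt (by norm_num)
  have hsub : dirDeriv τ (flowTensor ζ G) x = _ := dirDeriv_sub
    ((contDiffAt_secondRicci (m := 1) hG hx).differentiableAt (by norm_num)) hQ
  rw [hsub, dirDeriv_torsionQuadratic_of_eq_zero
    (differentiableAt_inv (hG.differentiableAt (by norm_num)) hx)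
    (fun i => (contDiffAt_torsionMatrix (m := 2) hG i).differentiableAt (by norm_num)) hT hQ,
    sub_zero]

lemma dirDeriv_flowScalar (hG : ContDiffAt ℝ 3 G x) (hx : IsUnit (G x))
    (hT : torsionMatrix ζ G x = 0) {c : ℂ} (hS : secondRicci ζ G x = c • G x)
    (hsymm : ∀ l m j k, curvature (ζ l) (conjDir (ζ m)) G x j k =
      curvature (ζ j) (conjDir (ζ k)) G x l m) :
    dirDeriv τ (flowScalar ζ G) x =
      -laplacian ζ G (fun y => ((G y)⁻¹ * dirDeriv τ G y).trace) x
        - c * ((G x)⁻¹ * dirDeriv τ G x).trace := by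
  have htraceCurv (l m : ι) : ((G x)⁻¹ * curvature (ζ l) (conjDir (ζ m)) G x).trace =
      c * G x l m := by
    rw [trace_mul_eq_contract, ← smul_eq_mul, ← Matrix.smul_apply, ← hS]
    simp only [secondRicci, contract, Matrix.sum_apply, Matrix.smul_apply, hsymm l m]
  have htraceCov (l m : ι) :
      ((G x)⁻¹ * secondCovDeriv (ζ l) (conjDir (ζ m)) G (dirDeriv τ G) x).trace = _ :=
    trace_inv_mul_secondCovDeriv (hG.of_le (by norm_num)) hx (contDiffAt_dirDeriv hG)
  have hcontract (B : Matrix ι ι ℂ) :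
      contract B (fun l m => c * G x l m) = c * (B * G x).trace := by
    rw [trace_mul_eq_contract]
    simp only [contract, Finset.mul_sum, smul_eq_mul, mul_left_comm]
  have hcancel (A B C : Matrix ι ι ℂ) : A - B - C - A = -B - C := by abel
  have hcyclic : ((G x)⁻¹ * dirDeriv τ G x * (G x)⁻¹ * G x).trace =
      ((G x)⁻¹ * dirDeriv τ G x).trace := by
    simp only [mul_assoc, inv_mul_cancel_of_isUnit hx, mul_one]
  have hderiv : dirDeriv τ (flowScalar ζ G) x = _ :=
    dirDeriv_trace_inv_mul (hG.differentiableAt (by norm_num)) hx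
      ((contDiffAt_flowTensor (m := 1) hG hx).differentiableAt (by norm_num))
  rw [hderiv, dirDeriv_flowTensor hG hx hT, dirDeriv_secondRicci hG hx, flowTensor, hT,
    torsionQuadratic_zero, sub_zero, hcancel]
  simp only [mul_sub, mul_neg, Matrix.trace_sub, Matrix.trace_neg, mul_contract, trace_contract,
    htraceCurv, htraceCov, hcontract, hcyclic, laplacian]

end Variation

/-! ### Kähler metrics -/

section Kaehler

variable {X : Type*} [NormedAddCommGroup X] [NormedSpace ℝ X] {ι : Type*} [Fintype ι]
  {ζ : ι → X × X} {η : X × X} {G : X → Matrix ι ι ℂ} {x : X}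

lemma dirDeriv_symm_of_torsionMatrix_eq_zero (hT : torsionMatrix ζ G x = 0) (i j k : ι) :
    dirDeriv (ζ i) G x j k = dirDeriv (ζ j) G x i k :=
  sub_eq_zero.1 (congr_fun₂ (congr_fun hT i) j k)

variable [DecidableEq ι]

lemma curvature_symm_left (hG : ContDiffAt ℝ 2 G x) (hx : IsUnit (G x))
    (hT : ∀ᶠ y in 𝓝 x, torsionMatrix ζ G y = 0) (i j k : ι) :
    curvature (ζ i) η G x j k = curvature (ζ j) η G x i k := by
  have hdiff (i : ι) : DifferentiableAt ℝ (christoffel (ζ i) G) x :=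
    (contDiffAt_christoffel (m := 1) hG hx).differentiableAt (by norm_num)
  have hsymm (p : ι) : (fun y => christoffel (ζ i) G y j p) =ᶠ[𝓝 x]
      fun y => christoffel (ζ j) G y i p := by
    filter_upwards [hT] with y hy
    simp only [christoffel, Matrix.mul_apply, dirDeriv_symm_of_torsionMatrix_eq_zero hy i j]
  simp only [curvature, Matrix.neg_apply, Matrix.mul_apply, ← dirDeriv_apply (hdiff _),
    dirDeriv_congr (hsymm _)]

lemma conjTranspose_curvature (hG : ContDiffAt ℝ 2 G x) (hx : IsUnit (G x))
    (hherm : ∀ᶠ y in 𝓝 x, (G y).IsHermitian) (ξ η : X × X) :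
    (curvature ξ η G x)ᴴ = curvature (conjDir η) (conjDir ξ) G x := by
  have hG' : DifferentiableAt ℝ G x := hG.differentiableAt (by norm_num)
  have hfirst : (fun y => (dirDeriv ξ G y)ᴴ) =ᶠ[𝓝 x] dirDeriv (conjDir ξ) G := by
    filter_upwards [hG.eventually (by norm_num), hherm.eventually_nhds] with y hy hherm'
    exact conjTranspose_dirDeriv_of_isHermitian (hy.differentiableAt (by norm_num)) hherm'
  have hsecond : (dirDeriv η (dirDeriv ξ G) x)ᴴ =
      dirDeriv (conjDir ξ) (dirDeriv (conjDir η) G) x := by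
    have hstar := dirDeriv_conjTranspose (ξ := conjDir η)
      ((contDiffAt_dirDeriv (m := 1) (ξ := ξ) hG).differentiableAt (by norm_num))
    rw [conjDir_conjDir, dirDeriv_congr hfirst] at hstar
    have hcomm : dirDeriv (conjDir η) (dirDeriv (conjDir ξ) G) x = _ := dirDeriv_comm hG
    rw [← hstar, hcomm]
  rw [curvature_eq hG hx, curvature_eq hG hx, Matrix.conjTranspose_sub, hsecond,
    Matrix.conjTranspose_mul, Matrix.conjTranspose_mul, hherm.self_of_nhds.inv.eq, mul_assoc,
    conjTranspose_dirDeriv_of_isHermitian hG' hherm,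
    conjTranspose_dirDeriv_of_isHermitian hG' hherm]

lemma curvature_symm (hG : ContDiffAt ℝ 2 G x) (hx : IsUnit (G x))
    (hherm : ∀ᶠ y in 𝓝 x, (G y).IsHermitian) (hT : ∀ᶠ y in 𝓝 x, torsionMatrix ζ G y = 0)
    (l m j k : ι) :
    curvature (ζ l) (conjDir (ζ m)) G x j k = curvature (ζ j) (conjDir (ζ k)) G x l m := by
  have hconj (l m j k : ι) : curvature (ζ l) (conjDir (ζ m)) G x j k =
      star (curvature (ζ m) (conjDir (ζ l)) G x k j) := by
    rw [← Matrix.conjTranspose_apply, conjTranspose_curvature hG hx hherm, conjDir_conjDir]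
  rw [curvature_symm_left hG hx hT l j k, hconj, curvature_symm_left hG hx hT m k l, ← hconj]

lemma dirDeriv_det_mul_inv (hG : ContDiffAt ℝ 1 G x) (hx : IsUnit (G x)) (m l : ι) :
    dirDeriv η (fun y => (G y).det * (G y)⁻¹ m l) x = (G x).det *
      (((G x)⁻¹ * dirDeriv η G x).trace * (G x)⁻¹ m l -
        ((G x)⁻¹ * dirDeriv η G x * (G x)⁻¹) m l) := by
  have hG' : DifferentiableAt ℝ G x := hG.differentiableAt (by norm_num)
  have hI := differentiableAt_inv hG' hx
  have hentry : DifferentiableAt ℝ (fun y => (G y)⁻¹ m l) x :=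
    (contDiffAt_matrix_iff.1 (contDiffAt_inv hG hx) m l).differentiableAt (by norm_num)
  rw [dirDeriv_mul ((contDiffAt_det hG).differentiableAt (by norm_num)) hentry,
    dirDeriv_det hG' hx, dirDeriv_apply hI, dirDeriv_inv hG' hx, Matrix.neg_apply]
  ring

lemma sum_dirDeriv_det_mul_inv_eq_zero (hG : ContDiffAt ℝ 1 G x) (hx : IsUnit (G x))
    (hT : torsionMatrix ζ G x = 0) (m : ι) :
    ∑ l, dirDeriv (ζ l) (fun y => (G y).det * (G y)⁻¹ m l) x = 0 := by
  have hcomm : ∑ l, ((G x)⁻¹ * dirDeriv (ζ l) G x * (G x)⁻¹) m l =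
      ∑ l, ((G x)⁻¹ * dirDeriv (ζ l) G x).trace * (G x)⁻¹ m l := by
    simp only [mul_assoc, Matrix.mul_apply (M := (G x)⁻¹) (i := m)]
    rw [Finset.sum_comm]
    refine Finset.sum_congr rfl fun p _ => ?_
    rw [← Finset.mul_sum, mul_comm, Matrix.trace_mul_comm]
    simp only [Matrix.trace, Matrix.diag, Matrix.mul_apply,
      dirDeriv_symm_of_torsionMatrix_eq_zero hT p]
  simp only [dirDeriv_det_mul_inv hG hx, ← Finset.mul_sum, Finset.sum_sub_distrib, hcomm, sub_self,
    mul_zero]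

lemma det_mul_laplacian (hG : ContDiffAt ℝ 1 G x) (hx : IsUnit (G x))
    (hT : torsionMatrix ζ G x = 0) {v : X → ℂ} (hv : ContDiffAt ℝ 2 v x) :
    (G x).det * laplacian ζ G v x =
      ∑ l, dirDeriv (ζ l)
        (fun y => ∑ m, (G y).det * (G y)⁻¹ m l * dirDeriv (conjDir (ζ m)) v y) x := by
  have hdv (m : ι) : DifferentiableAt ℝ (dirDeriv (conjDir (ζ m)) v) x :=
    (contDiffAt_dirDeriv (m := 1) hv).differentiableAt (by norm_num)
  have hcoeff (m l : ι) : DifferentiableAt ℝ (fun y => (G y).det * (G y)⁻¹ m l) x :=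
    ((contDiffAt_det hG).mul (contDiffAt_matrix_iff.1 (contDiffAt_inv hG hx) m l)).differentiableAt
      (by norm_num)
  have hterm (l : ι) :
      dirDeriv (ζ l) (fun y => ∑ m, (G y).det * (G y)⁻¹ m l * dirDeriv (conjDir (ζ m)) v y) x =
        ∑ m, (dirDeriv (ζ l) (fun y => (G y).det * (G y)⁻¹ m l) x * dirDeriv (conjDir (ζ m)) v x +
          (G x).det * (G x)⁻¹ m l * dirDeriv (ζ l) (dirDeriv (conjDir (ζ m)) v) x) := by
    rw [dirDeriv_sum fun m _ => (hcoeff m l).fun_mul (hdv m)]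
    exact Finset.sum_congr rfl fun m _ => dirDeriv_mul (hcoeff m l) (hdv m)
  simp only [hterm, Finset.sum_add_distrib]
  rw [Finset.sum_comm (f := fun l m =>
    dirDeriv (ζ l) (fun y => (G y).det * (G y)⁻¹ m l) x * dirDeriv (conjDir (ζ m)) v x)]
  simp only [← Finset.sum_mul, sum_dirDeriv_det_mul_inv_eq_zero hG hx hT, zero_mul,
    Finset.sum_const_zero, zero_add, laplacian, contract, smul_eq_mul, Finset.mul_sum, mul_assoc]

end Kaehler

/-! ### Holomorphic directions -/

noncomputable section Holomorphic

variable {V W E : Type*} [NormedAddCommGroup V] [NormedSpace ℂ V] [NormedAddCommGroup W]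
  [NormedSpace ℂ W] [NormedAddCommGroup E] [NormedSpace ℂ E] {f : V → E} {x : V}

/-- The direction of type `(1,0)` of a complex vector `v`: it is `½ (v - √-1 J v)`, where `J` is the
multiplication by `I` in `V`, whereas `√-1` is the formal one of the complexification. -/
def holDir {V : Type*} [AddCommGroup V] [Module ℂ V] (v : V) : V × V :=
  ((1 / 2 : ℝ) • v, -((1 / 2 : ℝ) • I • v))

lemma dirDeriv_holDir (f : V → E) (x v : V) : dirDeriv (holDir v) f x =
    (1 / 2 : ℂ) • (fderiv ℝ f x v - I • fderiv ℝ f x (I • v)) := by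
  simp only [dirDeriv, holDir, map_neg, map_smul]
  simp only [← Complex.coe_smul]
  push_cast
  module

lemma dirDeriv_conjDir_holDir (f : V → E) (x v : V) : dirDeriv (conjDir (holDir v)) f x =
    (1 / 2 : ℂ) • (fderiv ℝ f x v + I • fderiv ℝ f x (I • v)) := by
  simp only [dirDeriv, holDir, conjDir, neg_neg, map_smul]
  simp only [← Complex.coe_smul]
  push_cast
  module

lemma fderiv_complex_smul (f : V → E) (x v : V) (c : ℂ) : fderiv ℝ f x (c • v) =
    (c.re : ℂ) • fderiv ℝ f x v + (c.im : ℂ) • fderiv ℝ f x (I • v) := by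
  have hc : c • v = c.re • v + c.im • I • v := by
    conv_lhs => rw [← Complex.re_add_im c]
    rw [add_smul, mul_smul, Complex.coe_smul, Complex.coe_smul]
  rw [hc, map_add, map_smul, map_smul, Complex.coe_smul, Complex.coe_smul]

lemma dirDeriv_holDir_smul (f : V → E) (x v : V) (c : ℂ) :
    dirDeriv (holDir (c • v)) f x = c • dirDeriv (holDir v) f x := by
  rw [dirDeriv_holDir, dirDeriv_holDir, fderiv_complex_smul, smul_smul I c v,
    fderiv_complex_smul f x v (I * c)]
  nth_rewrite 5 [← Complex.re_add_im c]
  simp only [I_mul_re, I_mul_im, ofReal_neg, smul_sub, smul_add, smul_smul]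
  match_scalars
  · ring
  · linear_combination (c.im / 2 : ℂ) * I_sq

lemma dirDeriv_conjDir_holDir_smul (f : V → E) (x v : V) (c : ℂ) :
    dirDeriv (conjDir (holDir (c • v))) f x = star c • dirDeriv (conjDir (holDir v)) f x := by
  rw [dirDeriv_conjDir_holDir, dirDeriv_conjDir_holDir, fderiv_complex_smul, smul_smul I c v,
    fderiv_complex_smul f x v (I * c)]
  nth_rewrite 5 [← Complex.re_add_im c]
  simp only [I_mul_re, I_mul_im, ofReal_neg, smul_add, smul_smul, star_add, star_mul,
    Complex.star_def, conj_I, conj_ofReal]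
  match_scalars
  · ring
  · linear_combination (c.im / 2 : ℂ) * I_sq

lemma dirDeriv_holDir_sum_smul {κ : Type*} [Fintype κ] (f : V → E) (x : V) (c : κ → ℂ)
    (v : κ → V) : dirDeriv (holDir (∑ a, c a • v a)) f x =
      ∑ a, c a • dirDeriv (holDir (v a)) f x := by
  simp only [← dirDeriv_holDir_smul]
  simp only [dirDeriv_holDir, Finset.smul_sum, map_sum,
    ← Finset.sum_sub_distrib]

lemma dirDeriv_conjDir_holDir_sum_smul {κ : Type*} [Fintype κ] (f : V → E) (x : V) (c : κ → ℂ)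
    (v : κ → V) : dirDeriv (conjDir (holDir (∑ a, c a • v a))) f x =
      ∑ a, star (c a) • dirDeriv (conjDir (holDir (v a))) f x := by
  simp only [← dirDeriv_conjDir_holDir_smul]
  simp only [dirDeriv_conjDir_holDir, Finset.smul_sum, map_sum,
    ← Finset.sum_add_distrib]

lemma dirDeriv_holDir_of_differentiableAt (hf : DifferentiableAt ℂ f x) (v : V) :
    dirDeriv (holDir v) f x = fderiv ℂ f x v := by
  rw [dirDeriv_holDir, (hf.hasFDerivAt.restrictScalars ℝ).fderiv,
    ContinuousLinearMap.coe_restrictScalars', map_smul, smul_smul, I_mul_I]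
  module

lemma dirDeriv_conjDir_holDir_of_differentiableAt (hf : DifferentiableAt ℂ f x) (v : V) :
    dirDeriv (conjDir (holDir v)) f x = 0 := by
  rw [dirDeriv_conjDir_holDir, (hf.hasFDerivAt.restrictScalars ℝ).fderiv,
    ContinuousLinearMap.coe_restrictScalars', map_smul, smul_smul, I_mul_I]
  module

section Comp

variable {φ : V → W} {g : W → E} (hφ : DifferentiableAt ℂ φ x)
  (hg : DifferentiableAt ℝ g (φ x))
include hφ hg

lemma fderiv_real_comp (v : V) :
    fderiv ℝ (fun y => g (φ y)) x v = fderiv ℝ g (φ x) (fderiv ℂ φ x v) :=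
  congrArg (· v) (hg.hasFDerivAt.comp x (hφ.hasFDerivAt.restrictScalars ℝ)).fderiv

lemma dirDeriv_holDir_comp (v : V) :
    dirDeriv (holDir v) (fun y => g (φ y)) x = dirDeriv (holDir (fderiv ℂ φ x v)) g (φ x) := by
  simp only [dirDeriv_holDir, fderiv_real_comp hφ hg, map_smul]

lemma dirDeriv_conjDir_holDir_comp (v : V) : dirDeriv (conjDir (holDir v)) (fun y => g (φ y)) x =
    dirDeriv (conjDir (holDir (fderiv ℂ φ x v))) g (φ x) := by
  simp only [dirDeriv_conjDir_holDir, fderiv_real_comp hφ hg, map_smul]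

end Comp

end Holomorphic

/-! ### Coordinates of `ℂⁿ` -/

noncomputable section Coordinates

variable {n : ℕ} {G H : (Fin n → ℂ) → Matrix (Fin n) (Fin n) ℂ} {z : Fin n → ℂ}

/-- The direction `∂/∂zⁱ = ½ (∂/∂xⁱ - √-1 ∂/∂yⁱ)` of type `(1,0)`. -/
def hol (i : Fin n) : (Fin n → ℂ) × (Fin n → ℂ) := holDir (Pi.single i 1)

lemma dz_eq (i : Fin n) : dz i = dirDeriv (hol i) := by
  funext f z
  rw [dz, hol, dirDeriv_holDir, ← Pi.single_smul, smul_eq_mul I 1, mul_one, smul_eq_mul,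
    smul_eq_mul]

lemma dzbar_eq (i : Fin n) : dzbar i = dirDeriv (conjDir (hol i)) := by
  funext f z
  rw [dzbar, hol, dirDeriv_conjDir_holDir, ← Pi.single_smul, smul_eq_mul I 1, mul_one, smul_eq_mul,
    smul_eq_mul]

lemma chernGamma_eq (hG : DifferentiableAt ℝ G z) (i j k : Fin n) :
    chernGamma G z i j k = christoffel (hol i) G z j k := by
  simp only [chernGamma, christoffel, gInv, dz_eq, Matrix.mul_apply, dirDeriv_apply hG, mul_comm]

lemma chernCurv_eq (hG : ContDiffAt ℝ 2 G z) (hz : IsUnit (G z)) (l m j k : Fin n) :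
    chernCurv G z l m j k = curvature (hol l) (conjDir (hol m)) G z j k := by
  have hΓ (p : Fin n) : (fun w => chernGamma G w l j p) =ᶠ[𝓝 z]
      fun w => christoffel (hol l) G w j p := by
    filter_upwards [hG.eventually (by norm_num)] with w hw
      using chernGamma_eq (hw.differentiableAt (by norm_num)) l j p
  have hdiff : DifferentiableAt ℝ (christoffel (hol l) G) z :=
    (contDiffAt_christoffel (m := 1) hG hz).differentiableAt (by norm_num)
  simp only [chernCurv, curvature, dzbar_eq, dirDeriv_congr (hΓ _), dirDeriv_apply hdiff,
    Matrix.neg_apply, Matrix.mul_apply, mul_comm]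

lemma chernS_eq (hG : ContDiffAt ℝ 2 G z) (hz : IsUnit (G z)) (j k : Fin n) :
    chernS G z j k = secondRicci hol G z j k := by
  simp only [chernS, secondRicci, contract, chernCurv_eq hG hz, gInv, Matrix.sum_apply,
    Matrix.smul_apply, smul_eq_mul]

lemma torsion_eq (hG : DifferentiableAt ℝ G z) (i j k : Fin n) :
    torsion G z i j k = torsionMatrix hol G z i j k := by
  simp only [torsion, torsionMatrix, dz_eq, dirDeriv_apply hG, Matrix.of_apply]

lemma torsionQ_eq (hG : DifferentiableAt ℝ G z) (hherm : (G z).IsHermitian) (i j : Fin n) :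
    torsionQ G z i j = torsionQuadratic (G z)⁻¹ (torsionMatrix hol G z) i j := by
  have hsum (f : Fin n → Fin n → Fin n → Fin n → ℂ) :
      ∑ k, ∑ l, ∑ m, ∑ q, gInv G z k l * gInv G z m q * f k l m q =
        contract (G z)⁻¹ fun k l => contract (G z)⁻¹ fun m q => f k l m q := by
    simp only [contract, gInv, smul_eq_mul, Finset.mul_sum, mul_assoc]
  simp only [torsionQuadratic_apply hherm.inv, torsionQ, Q1, Q2, Q3, Q4, torsionBar, torsion_eq hG,
    mul_assoc (_ * _), hsum]

lemma traceSQ_eq (hG : ContDiffAt ℝ 2 G z) (hz : IsUnit (G z)) (hherm : (G z).IsHermitian) :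
    traceSQ G z = flowScalar hol G z := by
  rw [flowScalar, trace_mul_eq_contract]
  simp only [traceSQ, contract, flowTensor, chernS_eq hG hz,
    torsionQ_eq (hG.differentiableAt (by norm_num)) hherm, gInv, Matrix.sub_apply, smul_eq_mul]

lemma covBar_eq (hG : DifferentiableAt ℝ G z) (hherm : ∀ᶠ w in 𝓝 z, (G w).IsHermitian)
    (hH : DifferentiableAt ℝ H z) (m j k : Fin n) :
    covBar G H z m j k = covDerivBar (conjDir (hol m)) G H z j k := by
  have hstar (p : Fin n) : star (chernGamma G z m k p) =
      ((G z)⁻¹ * dirDeriv (conjDir (hol m)) G z) p k := by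
    rw [chernGamma_eq hG, ← Matrix.conjTranspose_apply, christoffel, Matrix.conjTranspose_mul,
      hherm.self_of_nhds.inv.eq, conjTranspose_dirDeriv_of_isHermitian hG hherm]
  rw [covDerivBar, mul_assoc, Matrix.sub_apply, Matrix.mul_apply, ← dirDeriv_apply hH]
  simp only [covBar, hstar, dzbar_eq, mul_comm]

lemma cov2_eq (hG : ContDiffAt ℝ 2 G z) (hz : IsUnit (G z))
    (hherm : ∀ᶠ w in 𝓝 z, (G w).IsHermitian) (hH : ContDiffAt ℝ 2 H z) (l m j k : Fin n) :
    cov2 G H z l m j k = secondCovDeriv (hol l) (conjDir (hol m)) G H z j k := by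
  have hcov : ∀ᶠ w in 𝓝 z, ∀ p, covBar G H w m p k =
      covDerivBar (conjDir (hol m)) G H w p k := by
    filter_upwards [hG.eventually (by norm_num), hH.eventually (by norm_num),
      hherm.eventually_nhds] with w hGw hHw hhermw p
    exact covBar_eq (hGw.differentiableAt (by norm_num)) hhermw
      (hHw.differentiableAt (by norm_num)) m p k
  have hdiff : DifferentiableAt ℝ (covDerivBar (conjDir (hol m)) G H) z :=
    (contDiffAt_covDerivBar (m := 1) hG hz hH).differentiableAt (by norm_num)
  have hderiv : dz l (fun w => covBar G H w m j k) z =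
      dirDeriv (hol l) (covDerivBar (conjDir (hol m)) G H) z j k := by
    rw [dz_eq, dirDeriv_congr (hcov.mono fun w hw => hw j), dirDeriv_apply hdiff]
  simp only [cov2, hderiv, hcov.self_of_nhds, chernGamma_eq (hG.differentiableAt (by norm_num)),
    secondCovDeriv, Matrix.sub_apply, Matrix.mul_apply]

lemma roughLaplacian_eq (hG : ContDiffAt ℝ 2 G z) (hz : IsUnit (G z))
    (hherm : ∀ᶠ w in 𝓝 z, (G w).IsHermitian) (hH : ContDiffAt ℝ 2 H z) (j k : Fin n) :
    roughLaplacian G H z j k =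
      -contract (G z)⁻¹ (fun l m => secondCovDeriv (hol l) (conjDir (hol m)) G H z) j k := by
  simp only [roughLaplacian, cov2_eq hG hz hherm hH, gInv, contract, Matrix.sum_apply,
    Matrix.smul_apply, smul_eq_mul]

lemma curvAction_eq (hG : ContDiffAt ℝ 2 G z) (hz : IsUnit (G z))
    (hT : ∀ᶠ w in 𝓝 z, torsionMatrix hol G w = 0) (j k : Fin n) :
    curvAction G H z j k = contract ((G z)⁻¹ * H z * (G z)⁻¹)
      (fun l m => curvature (hol l) (conjDir (hol m)) G z) j k := by
  have hraise (l m : Fin n) : raise G H z l m = ((G z)⁻¹ * H z * (G z)⁻¹) m l := by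
    simp only [raise, gInv, Matrix.mul_apply, Finset.sum_mul]
    rw [Finset.sum_comm]
    exact Finset.sum_congr rfl fun q _ => Finset.sum_congr rfl fun p _ => by ring
  simp only [curvAction, hraise, chernCurv_eq hG hz, curvature_symm_left hG hz hT j, contract,
    Matrix.sum_apply, Matrix.smul_apply, smul_eq_mul]

end Coordinates

/-! ### One-parameter families -/

noncomputable section Families

variable {X E ι : Type*} [NormedAddCommGroup X] [NormedSpace ℝ X] [NormedAddCommGroup E]
  [NormedSpace ℂ E] {ξ η : X × X} {ζ : ι → X × X} {a : ℝ} {x : X}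

/-- A complexified direction of `X`, seen as a direction of the slices `{a} × X` of `ℝ × X`. -/
def sliceDir {X : Type*} (ξ : X × X) : (ℝ × X) × (ℝ × X) := ((0, ξ.1), (0, ξ.2))

/-- The direction in `ℝ × X` of the parameter of a family. -/
def paramDir (X : Type*) [Zero X] : (ℝ × X) × (ℝ × X) := ((1, 0), 0)

lemma conjDir_sliceDir {X : Type*} [AddCommGroup X] (ξ : X × X) :
    conjDir (sliceDir ξ) = sliceDir (conjDir ξ) := by
  simp [conjDir, sliceDir]

lemma eventually_slice {X : Type*} [TopologicalSpace X] {x : X} {p : ℝ × X → Prop}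
    (hp : ∀ᶠ q in 𝓝 (a, x), p q) : ∀ᶠ y in 𝓝 x, p (a, y) :=
  hp.curry_nhds.self_of_nhds

lemma contDiffAt_slice {k : WithTop ℕ∞} {f : ℝ × X → E} (hf : ContDiffAt ℝ k f (a, x)) :
    ContDiffAt ℝ k (fun y => f (a, y)) x :=
  hf.comp x (contDiffAt_const.prodMk contDiffAt_id)

lemma hasDerivAt_dirDeriv_paramDir {f : ℝ × X → E} (hf : DifferentiableAt ℝ f (a, x)) :
    HasDerivAt (fun s => f (s, x)) (dirDeriv (paramDir X) f (a, x)) a := by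
  simpa [dirDeriv, paramDir, Function.comp_def] using
    (hf.hasFDerivAt.comp a (hasFDerivAt_prodMk_left a x)).hasDerivAt

lemma dirDeriv_slice {f : ℝ × X → E} (hf : DifferentiableAt ℝ f (a, x)) :
    dirDeriv ξ (fun y => f (a, y)) x = dirDeriv (sliceDir ξ) f (a, x) := by
  have : fderiv ℝ (fun y => f (a, y)) x = fderiv ℝ f (a, x) ∘L ContinuousLinearMap.inr ℝ ℝ X :=
    (hf.hasFDerivAt.comp x (hasFDerivAt_prodMk_right a x)).fderiv
  simp [dirDeriv, this, sliceDir]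

lemma dirDeriv_dirDeriv_slice {f : ℝ × X → E} (hf : ContDiffAt ℝ 2 f (a, x)) :
    dirDeriv η (dirDeriv ξ fun y => f (a, y)) x =
      dirDeriv (sliceDir η) (dirDeriv (sliceDir ξ) f) (a, x) := by
  have hfirst : (dirDeriv ξ fun y => f (a, y)) =ᶠ[𝓝 x] fun y => dirDeriv (sliceDir ξ) f (a, y) := by
    filter_upwards [eventually_slice (hf.eventually (by norm_num))] with y hy
      using dirDeriv_slice (hy.differentiableAt (by norm_num))
  rw [dirDeriv_congr hfirst,
    dirDeriv_slice ((contDiffAt_dirDeriv (m := 1) hf).differentiableAt (by norm_num))]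

variable [Fintype ι] {F H : ℝ × X → Matrix ι ι ℂ}

lemma torsionMatrix_slice (hF : DifferentiableAt ℝ F (a, x)) :
    torsionMatrix ζ (fun y => F (a, y)) x = torsionMatrix (fun i => sliceDir (ζ i)) F (a, x) := by
  funext i
  simp only [torsionMatrix, dirDeriv_slice hF]

variable [DecidableEq ι]

lemma curvature_slice (hF : ContDiffAt ℝ 2 F (a, x)) (hx : IsUnit (F (a, x))) :
    curvature ξ η (fun y => F (a, y)) x = curvature (sliceDir ξ) (sliceDir η) F (a, x) := by
  have hF' : DifferentiableAt ℝ F (a, x) := hF.differentiableAt (by norm_num)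
  rw [curvature_eq (contDiffAt_slice hF) hx, curvature_eq hF hx, dirDeriv_dirDeriv_slice hF,
    dirDeriv_slice hF', dirDeriv_slice hF']

lemma secondCovDeriv_slice (hF : ContDiffAt ℝ 2 F (a, x)) (hx : IsUnit (F (a, x)))
    (hH : ContDiffAt ℝ 2 H (a, x)) :
    secondCovDeriv ξ η (fun y => F (a, y)) (fun y => H (a, y)) x =
      secondCovDeriv (sliceDir ξ) (sliceDir η) F H (a, x) := by
  have hbar : covDerivBar η (fun y => F (a, y)) (fun y => H (a, y)) =ᶠ[𝓝 x]
      fun y => covDerivBar (sliceDir η) F H (a, y) := by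
    filter_upwards [eventually_slice (hF.eventually (by norm_num)),
      eventually_slice (hH.eventually (by norm_num))] with y hFy hHy
    simp only [covDerivBar, dirDeriv_slice (hFy.differentiableAt (by norm_num)),
      dirDeriv_slice (hHy.differentiableAt (by norm_num))]
  rw [secondCovDeriv, secondCovDeriv, dirDeriv_congr hbar, hbar.self_of_nhds, christoffel,
    christoffel, dirDeriv_slice (hF.differentiableAt (by norm_num)),
    dirDeriv_slice ((contDiffAt_covDerivBar (m := 1) hF hx hH).differentiableAt (by norm_num))]

lemma secondRicci_slice (hF : ContDiffAt ℝ 2 F (a, x)) (hx : IsUnit (F (a, x))) :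
    secondRicci ζ (fun y => F (a, y)) x = secondRicci (fun i => sliceDir (ζ i)) F (a, x) := by
  simp only [secondRicci, curvature_slice hF hx, conjDir_sliceDir]

lemma flowTensor_slice (hF : ContDiffAt ℝ 2 F (a, x)) (hx : IsUnit (F (a, x))) :
    flowTensor ζ (fun y => F (a, y)) x = flowTensor (fun i => sliceDir (ζ i)) F (a, x) := by
  simp only [flowTensor, secondRicci_slice hF hx,
    torsionMatrix_slice (hF.differentiableAt (by norm_num))]

lemma flowScalar_slice (hF : ContDiffAt ℝ 2 F (a, x)) (hx : IsUnit (F (a, x))) :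
    flowScalar ζ (fun y => F (a, y)) x = flowScalar (fun i => sliceDir (ζ i)) F (a, x) := by
  simp only [flowScalar, flowTensor_slice hF hx]

lemma laplacian_slice {v : ℝ × X → ℂ} (hv : ContDiffAt ℝ 2 v (a, x)) :
    laplacian ζ (fun y => F (a, y)) (fun y => v (a, y)) x =
      laplacian (fun i => sliceDir (ζ i)) F v (a, x) := by
  simp only [laplacian, dirDeriv_dirDeriv_slice hv, conjDir_sliceDir]

/- Along a family through a Kähler–Einstein metric with `S = c g`, the term `h g⁻¹ S` in the
variation of `S` is `c h`. -/
lemma hasDerivAt_flowTensor_slice (hF : ContDiffAt ℝ 3 F (a, x)) (hx : IsUnit (F (a, x)))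
    (hT : torsionMatrix ζ (fun y => F (a, y)) x = 0) {c : ℂ}
    (hS : secondRicci ζ (fun y => F (a, y)) x = c • F (a, x)) :
    HasDerivAt (fun s => flowTensor ζ (fun y => F (s, y)) x)
      (c • dirDeriv (paramDir X) F (a, x)
        - contract (F (a, x))⁻¹ (fun l m => secondCovDeriv (ζ l) (conjDir (ζ m))
            (fun y => F (a, y)) (fun y => dirDeriv (paramDir X) F (a, y)) x)
        - contract ((F (a, x))⁻¹ * dirDeriv (paramDir X) F (a, x) * (F (a, x))⁻¹)
            fun l m => curvature (ζ l) (conjDir (ζ m)) (fun y => F (a, y)) x) a := by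
  have hF2 : ContDiffAt ℝ 2 F (a, x) := hF.of_le (by norm_num)
  rw [torsionMatrix_slice (hF.differentiableAt (by norm_num))] at hT
  rw [secondRicci_slice hF2 hx] at hS
  have hslice : (fun s => flowTensor ζ (fun y => F (s, y)) x) =ᶠ[𝓝 a]
      fun s => flowTensor (fun i => sliceDir (ζ i)) F (s, x) := by
    have hgerm : ∀ᶠ q in 𝓝 (a, x), ContDiffAt ℝ 2 F q ∧ IsUnit (F q) :=
      (hF2.eventually (by norm_num)).and (eventually_isUnit hF.continuousAt hx)
    filter_upwards [(Continuous.prodMk_left x).continuousAt.eventually hgerm] with s hs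
      using flowTensor_slice hs.1 hs.2
  refine ((hasDerivAt_dirDeriv_paramDir ((contDiffAt_flowTensor (m := 1) hF hx).differentiableAt
    (by norm_num))).congr_of_eventuallyEq hslice).congr_deriv ?_
  rw [dirDeriv_flowTensor hF hx hT, dirDeriv_secondRicci hF hx, hS, Matrix.mul_smul, mul_assoc,
    inv_mul_cancel_of_isUnit hx, mul_one]
  simp only [secondCovDeriv_slice hF2 hx (contDiffAt_dirDeriv hF), curvature_slice hF2 hx,
    conjDir_sliceDir]

lemma dirDeriv_flowScalar_slice (hF : ContDiffAt ℝ 3 F (a, x))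
    (hx : IsUnit (F (a, x))) (hherm : ∀ᶠ y in 𝓝 x, (F (a, y)).IsHermitian)
    (hT : ∀ᶠ y in 𝓝 x, torsionMatrix ζ (fun y => F (a, y)) y = 0) {c : ℂ}
    (hS : secondRicci ζ (fun y => F (a, y)) x = c • F (a, x)) :
    dirDeriv (paramDir X) (flowScalar (fun i => sliceDir (ζ i)) F) (a, x) =
      -laplacian ζ (fun y => F (a, y))
          (fun y => ((F (a, y))⁻¹ * dirDeriv (paramDir X) F (a, y)).trace) x
        - c * ((F (a, x))⁻¹ * dirDeriv (paramDir X) F (a, x)).trace := by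
  have hF2 : ContDiffAt ℝ 2 F (a, x) := hF.of_le (by norm_num)
  have hT0 := torsionMatrix_slice (hF.differentiableAt (by norm_num)) ▸ hT.self_of_nhds
  have hsymm (l m j k : ι) : curvature (sliceDir (ζ l)) (conjDir (sliceDir (ζ m))) F (a, x) j k =
      curvature (sliceDir (ζ j)) (conjDir (sliceDir (ζ k))) F (a, x) l m := by
    simp only [conjDir_sliceDir, ← curvature_slice hF2 hx]
    exact curvature_symm (contDiffAt_slice hF2) hx hherm hT l m j k
  rw [dirDeriv_flowScalar hF hx hT0 (secondRicci_slice hF2 hx ▸ hS) hsymm,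
    laplacian_slice (contDiffAt_trace ((contDiffAt_inv hF2 hx).mul (contDiffAt_dirDeriv hF)))]

end Families

/-! ### Changes of holomorphic coordinates -/

section ChangeOfFrame

variable {X ι : Type*} [NormedAddCommGroup X] [NormedSpace ℝ X] [Fintype ι]
  {ζ η : X × X} {A F : X → Matrix ι ι ℂ} {x : X}

lemma dirDeriv_mul_mul_conjTranspose (hA : DifferentiableAt ℝ A x) (hF : DifferentiableAt ℝ F x)
    (hζ : dirDeriv (conjDir ζ) A x = 0) :
    dirDeriv ζ (fun y => A y * F y * (A y)ᴴ) x =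
      dirDeriv ζ A x * F x * (A x)ᴴ + A x * dirDeriv ζ F x * (A x)ᴴ := by
  classical
  have hAstar : DifferentiableAt ℝ (fun y => (A y)ᴴ) x :=
    (conjTransposeCLM ι).differentiableAt.comp x hA
  rw [dirDeriv_mul (hA.fun_mul hF) hAstar, dirDeriv_mul hA hF, dirDeriv_conjTranspose hA, hζ,
    Matrix.conjTranspose_zero, mul_zero, add_zero, add_mul]

lemma inv_mul_mul_conjTranspose [DecidableEq ι] {P Q : Matrix ι ι ℂ} (hP : IsUnit P) :
    Pᴴ * (P * Q * Pᴴ)⁻¹ * P = Q⁻¹ := by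
  have hPstar : IsUnit Pᴴ := (Matrix.isUnit_conjTranspose P).2 hP
  rw [Matrix.mul_inv_rev, Matrix.mul_inv_rev, ← mul_assoc, mul_inv_cancel_of_isUnit hPstar,
    one_mul, mul_assoc, inv_mul_cancel_of_isUnit hP, mul_one]

variable [DecidableEq ι]

lemma christoffel_mul_mul_conjTranspose (hA : DifferentiableAt ℝ A x)
    (hF : DifferentiableAt ℝ F x) (hAx : IsUnit (A x)) (hFx : IsUnit (F x))
    (hζ : dirDeriv (conjDir ζ) A x = 0) :
    christoffel ζ (fun y => A y * F y * (A y)ᴴ) x =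
      dirDeriv ζ A x * (A x)⁻¹ + A x * christoffel ζ F x * (A x)⁻¹ := by
  have hAstar : IsUnit (A x)ᴴ := (Matrix.isUnit_conjTranspose _).2 hAx
  have hcancel (B : Matrix ι ι ℂ) :
      B * (A x)ᴴ * (A x * F x * (A x)ᴴ)⁻¹ = B * (F x)⁻¹ * (A x)⁻¹ := by
    rw [Matrix.mul_inv_rev, Matrix.mul_inv_rev, ← mul_assoc, mul_assoc B,
      mul_inv_cancel_of_isUnit hAstar, mul_one, mul_assoc]
  rw [christoffel, dirDeriv_mul_mul_conjTranspose hA hF hζ, add_mul, hcancel, hcancel,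
    mul_assoc _ (F x), mul_inv_cancel_of_isUnit hFx, mul_one, christoffel, mul_assoc (A x)]

/- The inhomogeneous term of the Christoffel symbols is holomorphic, so `∂̄` annihilates it. -/
lemma curvature_mul_mul_conjTranspose (hA : ContDiffAt ℝ 2 A x) (hF : ContDiffAt ℝ 2 F x)
    (hAx : IsUnit (A x)) (hFx : IsUnit (F x)) (hη : ∀ᶠ y in 𝓝 x, dirDeriv η A y = 0)
    (hζ : ∀ᶠ y in 𝓝 x, dirDeriv (conjDir ζ) A y = 0) :
    curvature ζ η (fun y => A y * F y * (A y)ᴴ) x = A x * curvature ζ η F x * (A x)ᴴ := by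
  have hA1 : DifferentiableAt ℝ A x := hA.differentiableAt (by norm_num)
  have hΓ : christoffel ζ (fun y => A y * F y * (A y)ᴴ) =ᶠ[𝓝 x]
      fun y => (dirDeriv ζ A y + A y * christoffel ζ F y) * (A y)⁻¹ := by
    filter_upwards [hA.eventually (by norm_num), hF.eventually (by norm_num), hζ,
      eventually_isUnit hA.continuousAt hAx, eventually_isUnit hF.continuousAt hFx]
      with y hAy hFy hζy hAy' hFy'
    rw [christoffel_mul_mul_conjTranspose (hAy.differentiableAt (by norm_num))
      (hFy.differentiableAt (by norm_num)) hAy' hFy' hζy, add_mul]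
  have hΓF : DifferentiableAt ℝ (christoffel ζ F) x :=
    (contDiffAt_christoffel (m := 1) hF hFx).differentiableAt (by norm_num)
  have hAζ : DifferentiableAt ℝ (dirDeriv ζ A) x :=
    (contDiffAt_dirDeriv (m := 1) hA).differentiableAt (by norm_num)
  have hmixed : dirDeriv η (dirDeriv ζ A) x = 0 := by
    rw [dirDeriv_comm hA, dirDeriv_congr hη, dirDeriv_const]
  have hsum : dirDeriv η (fun y => dirDeriv ζ A y + A y * christoffel ζ F y) x =
      A x * dirDeriv η (christoffel ζ F) x := by
    rw [dirDeriv_add hAζ (hA1.fun_mul hΓF), hmixed, zero_add, dirDeriv_mul hA1 hΓF,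
      hη.self_of_nhds, zero_mul, zero_add]
  rw [curvature, dirDeriv_congr hΓ, dirDeriv_mul (hAζ.fun_add (hA1.fun_mul hΓF))
    (differentiableAt_inv hA1 hAx), hsum, dirDeriv_inv hA1 hAx, hη.self_of_nhds]
  simp only [mul_zero, zero_mul, neg_zero, add_zero, curvature, mul_neg, neg_mul, mul_assoc]
  rw [← mul_assoc (A x)⁻¹ (A x), inv_mul_cancel_of_isUnit hAx, one_mul]

end ChangeOfFrame

noncomputable section Pullback

variable {n : ℕ} {φ : (Fin n → ℂ) → (Fin n → ℂ)} {z : Fin n → ℂ}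
  {G : (Fin n → ℂ) → Matrix (Fin n) (Fin n) ℂ}

/-- The Jacobian matrix `(∂φᵃ/∂zⁱ)_{ia}` of a holomorphic map. -/
def jac (φ : (Fin n → ℂ) → (Fin n → ℂ)) (z : Fin n → ℂ) : Matrix (Fin n) (Fin n) ℂ :=
  Matrix.of fun i a => fderiv ℂ φ z (Pi.single i 1) a

/-- The coefficient matrix of the pullback of a Hermitian form by a holomorphic map. -/
def pullbackMetric (φ : (Fin n → ℂ) → (Fin n → ℂ)) (G : (Fin n → ℂ) → Matrix (Fin n) (Fin n) ℂ)
    (z : Fin n → ℂ) : Matrix (Fin n) (Fin n) ℂ :=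
  jac φ z * G (φ z) * (jac φ z)ᴴ

lemma fderiv_single_eq_sum_jac (φ : (Fin n → ℂ) → (Fin n → ℂ)) (z : Fin n → ℂ) (i : Fin n) :
    fderiv ℂ φ z (Pi.single i 1) = ∑ a, jac φ z i a • (Pi.single a 1 : Fin n → ℂ) :=
  pi_eq_sum_univ' _

section Hol

variable {E : Type*} [NormedAddCommGroup E] [NormedSpace ℂ E] {f : (Fin n → ℂ) → E}

lemma dirDeriv_hol_comp (hφ : DifferentiableAt ℂ φ z) (hf : DifferentiableAt ℝ f (φ z))
    (i : Fin n) : dirDeriv (hol i) (fun w => f (φ w)) z =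
      ∑ a, jac φ z i a • dirDeriv (hol a) f (φ z) := by
  rw [hol, dirDeriv_holDir_comp hφ hf, fderiv_single_eq_sum_jac, dirDeriv_holDir_sum_smul]
  rfl

lemma dirDeriv_conjDir_hol_comp (hφ : DifferentiableAt ℂ φ z) (hf : DifferentiableAt ℝ f (φ z))
    (i : Fin n) : dirDeriv (conjDir (hol i)) (fun w => f (φ w)) z =
      ∑ a, star (jac φ z i a) • dirDeriv (conjDir (hol a)) f (φ z) := by
  rw [hol, dirDeriv_conjDir_holDir_comp hφ hf, fderiv_single_eq_sum_jac,
    dirDeriv_conjDir_holDir_sum_smul]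
  rfl

end Hol

lemma contDiffAt_jac_apply {k m : WithTop ℕ∞} (hφ : ContDiffAt ℂ k φ z) (i a : Fin n)
    (hm : m + 1 ≤ k := by norm_num) : ContDiffAt ℂ m (fun w => jac φ w i a) z :=
  contDiffAt_pi.1 ((hφ.fderiv_right hm).clm_apply contDiffAt_const) a

lemma contDiffAt_jac {k m : WithTop ℕ∞} (hφ : ContDiffAt ℂ k φ z)
    (hm : m + 1 ≤ k := by norm_num) : ContDiffAt ℝ m (jac φ) z :=
  contDiffAt_matrix_iff.2 fun i a => (contDiffAt_jac_apply hφ i a hm).restrict_scalars ℝ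

lemma dirDeriv_conjDir_hol_jac (hφ : ContDiffAt ℂ 2 φ z) (i : Fin n) :
    dirDeriv (conjDir (hol i)) (jac φ) z = 0 := by
  ext j a
  rw [← dirDeriv_apply ((contDiffAt_jac (m := 1) hφ).differentiableAt (by norm_num))]
  exact dirDeriv_conjDir_holDir_of_differentiableAt
    ((contDiffAt_jac_apply (m := 1) hφ j a).differentiableAt (by norm_num)) _

lemma dirDeriv_hol_jac_symm (hφ : ContDiffAt ℂ 2 φ z) (i j a : Fin n) :
    dirDeriv (hol i) (jac φ) z j a = dirDeriv (hol j) (jac φ) z i a := by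
  have hsecond (i j : Fin n) : dirDeriv (hol i) (jac φ) z j a =
      fderiv ℂ (fderiv ℂ φ) z (Pi.single i 1) (Pi.single j 1) a := by
    have hfderiv : DifferentiableAt ℂ (fderiv ℂ φ) z :=
      (hφ.fderiv_right (m := 1) (by norm_num)).differentiableAt (by norm_num)
    have hentry : HasFDerivAt (fun w => jac φ w j a) _ z := (hasFDerivAt_pi'.1
      (hfderiv.hasFDerivAt.clm_apply (hasFDerivAt_const (Pi.single j 1) z))) a
    rw [← dirDeriv_apply ((contDiffAt_jac (m := 1) hφ).differentiableAt (by norm_num)), hol,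
      dirDeriv_holDir_of_differentiableAt hentry.differentiableAt, hentry.fderiv]
    simp
  have hsymm : IsSymmSndFDerivAt ℂ φ z := hφ.isSymmSndFDerivAt (by simp)
  rw [hsecond, hsecond, hsymm.eq]

lemma torsionMatrix_pullbackMetric (hφ : ContDiffAt ℂ 2 φ z) (hG : DifferentiableAt ℝ G (φ z))
    (i : Fin n) : torsionMatrix hol (pullbackMetric φ G) z i =
      ∑ a, jac φ z i a • (jac φ z * torsionMatrix hol G (φ z) a * (jac φ z)ᴴ) := by
  have hφ1 : DifferentiableAt ℂ φ z := hφ.differentiableAt (by norm_num)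
  have hderiv (i : Fin n) : dirDeriv (hol i) (pullbackMetric φ G) z =
      dirDeriv (hol i) (jac φ) z * (G (φ z) * (jac φ z)ᴴ) +
        jac φ z * ((∑ a, jac φ z i a • dirDeriv (hol a) G (φ z)) * (jac φ z)ᴴ) := by
    rw [← dirDeriv_hol_comp hφ1 hG, ← mul_assoc, ← mul_assoc]
    exact dirDeriv_mul_mul_conjTranspose
      ((contDiffAt_jac (m := 1) hφ).differentiableAt (by norm_num))
      (hG.comp z (hφ1.restrictScalars ℝ)) (dirDeriv_conjDir_hol_jac hφ i)
  have hsymm (j k : Fin n) : (dirDeriv (hol i) (jac φ) z * (G (φ z) * (jac φ z)ᴴ)) j k =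
      (dirDeriv (hol j) (jac φ) z * (G (φ z) * (jac φ z)ᴴ)) i k := by
    simp only [Matrix.mul_apply, dirDeriv_hol_jac_symm hφ i j]
  have hT (a b k : Fin n) : (torsionMatrix hol G (φ z) a * (jac φ z)ᴴ) b k =
      (dirDeriv (hol a) G (φ z) * (jac φ z)ᴴ) b k -
        (dirDeriv (hol b) G (φ z) * (jac φ z)ᴴ) a k := by
    simp only [Matrix.mul_apply, torsionMatrix, Matrix.of_apply, sub_mul, Finset.sum_sub_distrib]
  ext j k
  rw [torsionMatrix, Matrix.of_apply, hderiv, hderiv, Matrix.add_apply, Matrix.add_apply, hsymm,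
    add_sub_add_left_eq_sub]
  simp only [mul_assoc, Matrix.sum_mul, Matrix.smul_mul, Matrix.mul_sum, Matrix.mul_smul,
    Matrix.sum_apply, Matrix.smul_apply, smul_eq_mul]
  simp only [Matrix.mul_apply (M := jac φ z), hT, mul_sub, Finset.sum_sub_distrib, Finset.mul_sum]
  exact congrArg _ (Finset.sum_comm.trans
    (Finset.sum_congr rfl fun a _ => Finset.sum_congr rfl fun b _ => mul_left_comm _ _ _))

lemma dirDeriv_hol_dirDeriv_conjDir_hol_comp {E : Type*} [NormedAddCommGroup E] [NormedSpace ℂ E]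
    {f : (Fin n → ℂ) → E} (hφ : ContDiffAt ℂ 2 φ z) (hf : ContDiffAt ℝ 2 f (φ z)) (l m : Fin n) :
    dirDeriv (hol l) (dirDeriv (conjDir (hol m)) fun w => f (φ w)) z =
      ∑ a, ∑ b, (jac φ z l a * star (jac φ z m b)) •
        dirDeriv (hol a) (dirDeriv (conjDir (hol b)) f) (φ z) := by
  have hφ1 : DifferentiableAt ℂ φ z := hφ.differentiableAt (by norm_num)
  have hfirst : dirDeriv (conjDir (hol m)) (fun w => f (φ w)) =ᶠ[𝓝 z]
      fun w => ∑ b, star (jac φ w m b) • dirDeriv (conjDir (hol b)) f (φ w) := by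
    filter_upwards [hφ.eventually (by norm_num),
      hφ.continuousAt.eventually (hf.eventually (by norm_num))] with w hφw hfw
    exact dirDeriv_conjDir_hol_comp (hφw.differentiableAt (by norm_num))
      (hfw.differentiableAt (by norm_num)) m
  have hjac : DifferentiableAt ℝ (jac φ) z :=
    (contDiffAt_jac (m := 1) hφ).differentiableAt (by norm_num)
  have hstar (b : Fin n) : DifferentiableAt ℝ (fun w => star (jac φ w m b)) z :=
    (starL' ℝ : ℂ ≃L[ℝ] ℂ).differentiableAt.comp z
      (((contDiffAt_jac_apply (m := 1) hφ m b).differentiableAt (by norm_num)).restrictScalars ℝ)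
  have hf' (b : Fin n) : DifferentiableAt ℝ (dirDeriv (conjDir (hol b)) f) (φ z) :=
    (contDiffAt_dirDeriv (m := 1) hf).differentiableAt (by norm_num)
  have hfφ (b : Fin n) : DifferentiableAt ℝ (fun w => dirDeriv (conjDir (hol b)) f (φ w)) z :=
    (hf' b).comp z (hφ1.restrictScalars ℝ)
  have hstarDeriv (b : Fin n) : dirDeriv (hol l) (fun w => star (jac φ w m b)) z = 0 := by
    rw [dirDeriv_star, dirDeriv_apply hjac, dirDeriv_conjDir_hol_jac hφ, Matrix.zero_apply,
      star_zero]
  rw [dirDeriv_congr hfirst, dirDeriv_sum fun b _ => (hstar b).fun_smul (hfφ b), Finset.sum_comm]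
  refine Finset.sum_congr rfl fun b _ => ?_
  have hprod : dirDeriv (hol l) (fun w => star (jac φ w m b) • dirDeriv (conjDir (hol b)) f (φ w)) z
      = _ := dirDeriv_smul (hstar b) (hfφ b)
  rw [hprod, hstarDeriv, zero_smul, zero_add, dirDeriv_hol_comp hφ1 (hf' b), Finset.smul_sum]
  simp only [smul_smul, mul_comm]

lemma curvature_comp (hφ : ContDiffAt ℂ 2 φ z) (hG : ContDiffAt ℝ 2 G (φ z))
    (hz : IsUnit (G (φ z))) (l m : Fin n) :
    curvature (hol l) (conjDir (hol m)) (fun w => G (φ w)) z =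
      ∑ a, ∑ b, (jac φ z l a * star (jac φ z m b)) •
        curvature (hol a) (conjDir (hol b)) G (φ z) := by
  have hφ1 : DifferentiableAt ℂ φ z := hφ.differentiableAt (by norm_num)
  have hG1 : DifferentiableAt ℝ G (φ z) := hG.differentiableAt (by norm_num)
  have hGφ : ContDiffAt ℝ 2 (fun w => G (φ w)) z := hG.comp z (hφ.restrict_scalars ℝ)
  rw [curvature_eq hGφ hz, dirDeriv_comm hGφ, dirDeriv_hol_dirDeriv_conjDir_hol_comp hφ hG,
    dirDeriv_hol_comp hφ1 hG1, dirDeriv_conjDir_hol_comp hφ1 hG1]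
  simp only [curvature_eq hG hz, dirDeriv_comm (ξ := conjDir _) hG, Matrix.sum_mul, Matrix.mul_sum,
    Matrix.smul_mul, Matrix.mul_smul, smul_sub, Finset.sum_sub_distrib, Finset.smul_sum, smul_smul]
  rw [Finset.sum_comm]
  simp only [mul_comm (star _)]

lemma laplacian_pullbackMetric (hφ : ContDiffAt ℂ 2 φ z) (hjac : IsUnit (jac φ z))
    {v : (Fin n → ℂ) → ℂ} (hv : ContDiffAt ℝ 2 v (φ z)) :
    laplacian hol (pullbackMetric φ G) (fun w => v (φ w)) z = laplacian hol G v (φ z) := by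
  rw [laplacian, laplacian, ← inv_mul_mul_conjTranspose (Q := G (φ z)) hjac,
    contract_conjTranspose_mul_mul]
  simp only [dirDeriv_hol_dirDeriv_conjDir_hol_comp hφ hv]
  rfl

lemma flowScalar_pullbackMetric (hφ : ContDiffAt ℂ 3 φ z) (hjac : IsUnit (jac φ z))
    (hG : ContDiffAt ℝ 2 G (φ z)) (hz : IsUnit (G (φ z))) (hherm : (G (φ z)).IsHermitian) :
    flowScalar hol (pullbackMetric φ G) z = flowScalar hol G (φ z) := by
  have hφ2 : ContDiffAt ℂ 2 φ z := hφ.of_le (by norm_num)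
  have hcurv (l m : Fin n) : curvature (hol l) (conjDir (hol m)) (pullbackMetric φ G) z =
      jac φ z * (∑ a, ∑ b, (jac φ z l a * star (jac φ z m b)) •
        curvature (hol a) (conjDir (hol b)) G (φ z)) * (jac φ z)ᴴ := by
    have hconj (i : Fin n) : ∀ᶠ w in 𝓝 z, dirDeriv (conjDir (hol i)) (jac φ) w = 0 :=
      (hφ2.eventually (by norm_num)).mono fun w hw => dirDeriv_conjDir_hol_jac hw i
    rw [← curvature_comp hφ2 hG hz]
    exact curvature_mul_mul_conjTranspose (contDiffAt_jac hφ)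
      (hG.comp z (hφ2.restrict_scalars ℝ)) hjac hz (hconj m) (hconj l)
  have hinv : (jac φ z)ᴴ * (pullbackMetric φ G z)⁻¹ * jac φ z = (G (φ z))⁻¹ :=
    inv_mul_mul_conjTranspose hjac
  have htrace (B : Matrix (Fin n) (Fin n) ℂ) : ((pullbackMetric φ G z)⁻¹ *
      (jac φ z * B * (jac φ z)ᴴ)).trace = ((G (φ z))⁻¹ * B).trace := by
    rw [← hinv]
    simpa only [mul_assoc] using Matrix.trace_mul_comm
      ((pullbackMetric φ G z)⁻¹ * jac φ z * B) (jac φ z)ᴴ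
  have hT := torsionMatrix_pullbackMetric hφ2 (hG.differentiableAt (by norm_num))
  have hherm' : (pullbackMetric φ G z).IsHermitian :=
    Matrix.isHermitian_mul_mul_conjTranspose _ hherm
  rw [flowScalar_eq hherm', flowScalar_eq hherm,
    torsionNormSq_changeFrame hT, torsionTraceNormSq_changeFrame hT, hinv]
  congr 1
  rw [← hinv, contract_conjTranspose_mul_mul, hinv]
  simp only [hcurv, htrace]
  simp only [Matrix.mul_sum, Matrix.trace_sum, Matrix.mul_smul, Matrix.trace_smul]

end Pullback

section Sesquilinear

variable {W : Type*} [AddCommGroup W] [Module ℂ W] [Module ℝ W]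
  {B : LinearMap.BilinForm ℝ W}

lemma form_I_smul_left (hJ : ∀ u v, B (I • u) (I • v) = B u v) (u v : W) :
    B (I • u) v = -B u (I • v) := by
  rw [← hJ (I • u) v, smul_smul, I_mul_I, neg_smul, one_smul, map_neg, LinearMap.neg_apply]

variable [IsScalarTower ℝ ℂ W]

lemma smul_eq_re_smul_add_im_smul (c : ℂ) (u : W) : c • u = c.re • u + c.im • (I • u) := by
  conv_lhs => rw [← Complex.re_add_im c, add_smul, mul_smul]
  rw [← algebraMap_smul ℂ c.re u, ← algebraMap_smul ℂ c.im (I • u)]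
  rfl

/-- The sesquilinear form `B(u, v) + √-1 B(u, J v)` attached to a `J`-invariant real bilinear
form; it is linear in the first and conjugate-linear in the second variable. -/
def sesqForm (B : LinearMap.BilinForm ℝ W) (hJ : ∀ u v, B (I • u) (I • v) = B u v) :
    W →ₗ[ℂ] W →ₗ⋆[ℂ] ℂ :=
  LinearMap.mk₂'ₛₗ (RingHom.id ℂ) (starRingEnd ℂ) (fun u v => (B u v : ℂ) + I * (B u (I • v) : ℂ))
    (fun u u' v => by simp only [map_add, LinearMap.add_apply]; push_cast; ring)
    (fun c u v => by
      simp only [smul_eq_re_smul_add_im_smul c u, map_add, map_smul, LinearMap.add_apply,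
        LinearMap.smul_apply, form_I_smul_left hJ, smul_smul, I_mul_I, neg_smul, one_smul, map_neg,
        smul_eq_mul, neg_neg, RingHom.id_apply]
      refine Complex.ext ?_ ?_
      · simp [sub_eq_add_neg]
      · simp [add_comm])
    (fun u v v' => by simp only [smul_add, map_add]; push_cast; ring)
    (fun c u v => by
      rw [smul_comm I c, smul_eq_re_smul_add_im_smul c, smul_eq_re_smul_add_im_smul c (I • v),
        smul_smul I I]
      simp only [map_add, map_smul, I_mul_I, neg_smul, one_smul, map_neg, smul_eq_mul]
      refine Complex.ext ?_ ?_ <;> simp)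

variable {hJ : ∀ u v, B (I • u) (I • v) = B u v}

lemma sesqForm_apply (u v : W) : sesqForm B hJ u v = (B u v : ℂ) + I * (B u (I • v) : ℂ) := rfl

lemma star_sesqForm (hB : ∀ u v, B u v = B v u) (u v : W) :
    star (sesqForm B hJ u v) = sesqForm B hJ v u := by
  simp only [sesqForm_apply, star_add, star_mul', RCLike.star_def, conj_ofReal, conj_I]
  rw [hB v u, hB v (I • u), form_I_smul_left hJ]
  push_cast
  ring

lemma sesqForm_self (hB : ∀ u v, B u v = B v u) (u : W) : sesqForm B hJ u u = B u u := by
  have hzero : B u (I • u) = 0 := by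
    have hskew := form_I_smul_left hJ u u
    rw [hB (I • u) u] at hskew
    linarith
  simp [sesqForm_apply, hzero]

end Sesquilinear

section Charts

variable {n : ℕ} {M : Type*} [TopologicalSpace M] [ChartedSpace (Fin n → ℂ) M]

variable (n M) in
/-- The holomorphic charts of `M`. -/
abbrev holAtlas : Set (OpenPartialHomeomorph M (Fin n → ℂ)) :=
  IsManifold.maximalAtlas 𝓘(ℂ, Fin n → ℂ) ω M

/-- The derivative of the inverse of a chart, which sends the `k`-th basis vector to `∂/∂xᵏ`. All
tangent spaces are identified with `ℂⁿ`. -/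
noncomputable def symmDeriv (e : OpenPartialHomeomorph M (Fin n → ℂ)) (z : Fin n → ℂ) :
    (Fin n → ℂ) →L[ℂ] (Fin n → ℂ) :=
  mfderiv 𝓘(ℂ, Fin n → ℂ) 𝓘(ℂ, Fin n → ℂ) e.symm z

/-- The sesquilinear form on `ℂⁿ` attached to a `J`-invariant field of bilinear forms at `x`. -/
noncomputable def sesqFormAt (b : ∀ x : M, LinearMap.BilinForm ℝ (Tan (n := n) x))
    (hJ : ∀ x u v, b x (I • u) (I • v) = b x u v) (x : M) :
    (Fin n → ℂ) →ₗ[ℂ] (Fin n → ℂ) →ₗ⋆[ℂ] ℂ :=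
  sesqForm (W := Fin n → ℂ) (b x) (hJ x)

variable {e e' : OpenPartialHomeomorph M (Fin n → ℂ)} {z : Fin n → ℂ}
  {b : ∀ x : M, LinearMap.BilinForm ℝ (Tan (n := n) x)}

lemma star_sesqFormAt (hJ : ∀ x u v, b x (I • u) (I • v) = b x u v)
    (hb : ∀ x u v, b x u v = b x v u) (x : M) (u v : Fin n → ℂ) :
    star (sesqFormAt b hJ x u v) = sesqFormAt b hJ x v u :=
  star_sesqForm (B := (show LinearMap.BilinForm ℝ (Fin n → ℂ) from b x)) (hJ := hJ x)
    (hb x) u v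

lemma sesqFormAt_self (hJ : ∀ x u v, b x (I • u) (I • v) = b x u v)
    (hb : ∀ x u v, b x u v = b x v u) (x : M) (u : Fin n → ℂ) :
    sesqFormAt b hJ x u u = b x u u :=
  sesqForm_self (B := (show LinearMap.BilinForm ℝ (Fin n → ℂ) from b x)) (hJ := hJ x) (hb x) u

lemma coeff_apply (hJ : ∀ x u v, b x (I • u) (I • v) = b x u v) (i j : Fin n) :
    coeff b e z i j = sesqFormAt b hJ (e.symm z) (symmDeriv e z (Pi.single i 1))
      (symmDeriv e z (Pi.single j 1)) := rfl

lemma mdifferentiable_of_mem_holAtlas (he : e ∈ holAtlas n M) :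
    e.MDifferentiable 𝓘(ℂ, Fin n → ℂ) 𝓘(ℂ, Fin n → ℂ) :=
  ⟨(contMDiffOn_of_mem_maximalAtlas he).mdifferentiableOn (by simp),
    (contMDiffOn_symm_of_mem_maximalAtlas he).mdifferentiableOn (by simp)⟩

lemma symmDeriv_injective (he : e ∈ holAtlas n M) (hz : z ∈ e.target) :
    Function.Injective (symmDeriv e z) :=
  (mdifferentiable_of_mem_holAtlas he).symm.mfderiv_injective hz

lemma contDiffAt_transition (he : e ∈ holAtlas n M) (he' : e' ∈ holAtlas n M)
    (hz : z ∈ (e.symm ≫ₕ e').source) : ContDiffAt ℂ ω (e.symm ≫ₕ e') z := by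
  have h := ModelWithCorners.contDiffOn_extendCoordChange he he'
  rw [ModelWithCorners.extendCoordChange_source] at h
  simp only [modelWithCornersSelf_coe, Set.image_id] at h
  exact h.contDiffAt ((e.symm ≫ₕ e').open_source.mem_nhds hz)

lemma symmDeriv_eq_comp_fderiv (he : e ∈ holAtlas n M) (he' : e' ∈ holAtlas n M)
    (hz : z ∈ (e.symm ≫ₕ e').source) :
    symmDeriv e z = symmDeriv e' ((e.symm ≫ₕ e') z) ∘L fderiv ℂ (e.symm ≫ₕ e') z := by
  have hsymm : MDifferentiableAt 𝓘(ℂ, Fin n → ℂ) 𝓘(ℂ, Fin n → ℂ) e'.symm ((e.symm ≫ₕ e') z) :=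
    (mdifferentiable_of_mem_holAtlas he').mdifferentiableAt_symm (e'.map_source hz.2)
  have htrans : MDifferentiableAt 𝓘(ℂ, Fin n → ℂ) 𝓘(ℂ, Fin n → ℂ) (e.symm ≫ₕ e') z :=
    ((contDiffAt_transition he he' hz).differentiableAt (by simp)).mdifferentiableAt
  have hcomp := mfderiv_comp z hsymm htrans
  rw [mfderiv_eq_fderiv] at hcomp
  have hsymm_eq : (e.symm : (Fin n → ℂ) → M) =ᶠ[𝓝 z] e'.symm ∘ (e.symm ≫ₕ e') := by
    filter_upwards [(e.symm ≫ₕ e').open_source.mem_nhds hz] with w hw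
    exact (e'.left_inv hw.2).symm
  exact hsymm_eq.mfderiv_eq.trans hcomp

lemma jac_eq_transpose_toMatrix' (φ : (Fin n → ℂ) → (Fin n → ℂ)) (z : Fin n → ℂ) :
    jac φ z = (LinearMap.toMatrix' (fderiv ℂ φ z : (Fin n → ℂ) →ₗ[ℂ] (Fin n → ℂ)))ᵀ := by
  ext i a
  simp [jac, LinearMap.toMatrix'_apply]

lemma isUnit_jac_transition (he : e ∈ holAtlas n M) (he' : e' ∈ holAtlas n M)
    (hz : z ∈ (e.symm ≫ₕ e').source) : IsUnit (jac (e.symm ≫ₕ e') z) := by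
  have hinj : Function.Injective (fderiv ℂ (e.symm ≫ₕ e') z) := by
    have h := symmDeriv_injective he hz.1
    rw [symmDeriv_eq_comp_fderiv he he' hz] at h
    exact Function.Injective.of_comp h
  rw [jac_eq_transpose_toMatrix', Matrix.isUnit_transpose]
  refine (LinearMap.isUnit_toMatrix'_iff).2 ?_
  exact (Module.End.isUnit_iff _).2
    ⟨hinj, (LinearMap.injective_iff_surjective (f := (fderiv ℂ (e.symm ≫ₕ e') z).toLinearMap)).1
      hinj⟩

lemma symmDeriv_single_eq_sum_jac (he : e ∈ holAtlas n M) (he' : e' ∈ holAtlas n M)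
    (hz : z ∈ (e.symm ≫ₕ e').source) (i : Fin n) :
    symmDeriv e z (Pi.single i 1) = ∑ a, jac (e.symm ≫ₕ e') z i a •
      symmDeriv e' ((e.symm ≫ₕ e') z) (Pi.single a 1) := by
  rw [symmDeriv_eq_comp_fderiv he he' hz, ContinuousLinearMap.comp_apply,
    fderiv_single_eq_sum_jac, map_sum]
  exact Finset.sum_congr rfl fun a _ => map_smul _ _ _

lemma coeff_eq_pullbackMetric (hJ : ∀ x u v, b x (I • u) (I • v) = b x u v) (he : e ∈ holAtlas n M)
    (he' : e' ∈ holAtlas n M) (hz : z ∈ (e.symm ≫ₕ e').source) :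
    coeff b e z = pullbackMetric (e.symm ≫ₕ e') (coeff b e') z := by
  have hpoint : e'.symm ((e.symm ≫ₕ e') z) = e.symm z := e'.left_inv hz.2
  ext i j
  simp only [pullbackMetric, coeff_apply hJ, Matrix.mul_apply, Matrix.conjTranspose_apply, hpoint,
    symmDeriv_single_eq_sum_jac he he' hz, map_sum, LinearMap.sum_apply, LinearMap.map_smulₛₗ,
    LinearMap.smul_apply, Finset.sum_mul, Finset.mul_sum, smul_eq_mul, RingHom.id_apply,
    starRingEnd_apply]
  exact Finset.sum_congr rfl fun a _ => Finset.sum_congr rfl fun b _ => by ring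

namespace HermitianMetric

variable (g : HermitianMetric n M)

lemma isHermitian_mat (e : OpenPartialHomeomorph M (Fin n → ℂ)) (z : Fin n → ℂ) :
    (g.mat e z).IsHermitian := by
  ext i j
  rw [Matrix.conjTranspose_apply, mat, coeff_apply g.compat, coeff_apply g.compat]
  exact star_sesqFormAt g.compat g.symm _ _ _

lemma posDef_mat (he : e ∈ holAtlas n M) (hz : z ∈ e.target) : (g.mat e z).PosDef := by
  refine Matrix.PosDef.of_dotProduct_mulVec_pos (g.isHermitian_mat e z) fun c hc => ?_
  set w := symmDeriv e z (star c)
  have hw : w = ∑ i, star (c i) • symmDeriv e z (Pi.single i 1) := by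
    conv_lhs => rw [show w = symmDeriv e z (star c) from rfl, pi_eq_sum_univ' (star c), map_sum]
    exact Finset.sum_congr rfl fun a _ => map_smul _ _ _
  have hw0 : w ≠ 0 := by
    rw [Ne, map_eq_zero_iff _ (symmDeriv_injective he hz)]
    simpa using hc
  have hquad : star c ⬝ᵥ g.mat e z *ᵥ c = sesqFormAt g.form g.compat (e.symm z) w w := by
    simp only [hw, map_sum, LinearMap.sum_apply, LinearMap.map_smulₛₗ, LinearMap.smul_apply,
      RingHom.id_apply, starRingEnd_apply, star_star, smul_eq_mul, dotProduct, Matrix.mulVec, mat,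
      coeff_apply g.compat, Pi.star_apply, Finset.mul_sum]
    rw [Finset.sum_comm]
    exact Finset.sum_congr rfl fun i _ => Finset.sum_congr rfl fun j _ => by ring
  rw [hquad, sesqFormAt_self g.compat g.symm]
  exact_mod_cast g.pos (e.symm z) w hw0

lemma isUnit_mat (he : e ∈ holAtlas n M) (hz : z ∈ e.target) : IsUnit (g.mat e z) :=
  (g.posDef_mat he hz).isUnit

lemma contDiffAt_mat (he : e ∈ holAtlas n M) (hz : z ∈ e.target) :
    ContDiffAt ℝ ∞ (g.mat e) z :=
  contDiffAt_matrix_iff.2 fun i j =>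
    (g.smooth e he i j).contDiffAt (e.open_target.mem_nhds hz)

lemma mat_eq_pullbackMetric (he : e ∈ holAtlas n M) (he' : e' ∈ holAtlas n M)
    (hz : z ∈ (e.symm ≫ₕ e').source) :
    g.mat e z = pullbackMetric (e.symm ≫ₕ e') (g.mat e') z :=
  coeff_eq_pullbackMetric g.compat he he' hz

lemma mat_eventuallyEq_pullbackMetric (he : e ∈ holAtlas n M) (he' : e' ∈ holAtlas n M)
    (hz : z ∈ (e.symm ≫ₕ e').source) :
    g.mat e =ᶠ[𝓝 z] pullbackMetric (e.symm ≫ₕ e') (g.mat e') := by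
  filter_upwards [(e.symm ≫ₕ e').open_source.mem_nhds hz] with w hw
  exact g.mat_eq_pullbackMetric he he' hw

lemma traceSQ_symm_apply [IsManifold 𝓘(ℂ, Fin n → ℂ) ω M] (he : e ∈ holAtlas n M)
    (hz : z ∈ e.target) : g.traceSQ (e.symm z) = flowScalar hol (g.mat e) z := by
  set e' := chartAt (Fin n → ℂ) (e.symm z)
  have he' : e' ∈ holAtlas n M := IsManifold.chart_mem_maximalAtlas _
  have hz' : z ∈ (e.symm ≫ₕ e').source := ⟨hz, mem_chart_source _ _⟩
  have hw : (e.symm ≫ₕ e') z ∈ e'.target := e'.map_source hz'.2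
  have hsmooth : ContDiffAt ℝ 2 (g.mat e') ((e.symm ≫ₕ e') z) :=
    (g.contDiffAt_mat he' hw).of_le (ENat.LEInfty.out)
  calc g.traceSQ (e.symm z) = flowScalar hol (g.mat e') ((e.symm ≫ₕ e') z) :=
        traceSQ_eq hsmooth (g.isUnit_mat he' hw) (g.isHermitian_mat e' _)
    _ = flowScalar hol (pullbackMetric (e.symm ≫ₕ e') (g.mat e')) z :=
        (flowScalar_pullbackMetric ((contDiffAt_transition he he' hz').of_le le_top)
          (isUnit_jac_transition he he' hz') hsmooth (g.isUnit_mat he' hw)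
          (g.isHermitian_mat e' _)).symm
    _ = flowScalar hol (g.mat e) z :=
        flowScalar_congr (g.mat_eventuallyEq_pullbackMetric he he' hz').symm

end HermitianMetric

end Charts

section Volume

variable {n : ℕ}

lemma det_restrictScalars_fderiv (φ : (Fin n → ℂ) → (Fin n → ℂ)) (z : Fin n → ℂ) :
    ((fderiv ℂ φ z).restrictScalars ℝ).det = normSq (jac φ z).det := by
  rw [jac_eq_transpose_toMatrix', Matrix.det_transpose, LinearMap.det_toMatrix',
    ← Algebra.norm_complex_apply, ← LinearMap.det_restrictScalars]
  rfl

lemma re_det_pullbackMetric (φ : (Fin n → ℂ) → (Fin n → ℂ))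
    (G : (Fin n → ℂ) → Matrix (Fin n) (Fin n) ℂ) (z : Fin n → ℂ) :
    (pullbackMetric φ G z).det.re = normSq (jac φ z).det * (G (φ z)).det.re := by
  rw [pullbackMetric, Matrix.det_mul, Matrix.det_mul, Matrix.det_conjTranspose, mul_right_comm,
    RCLike.star_def, mul_conj, re_ofReal_mul]

variable {M : Type*} [TopologicalSpace M]

lemma measurableSet_target_inter_preimage [MeasurableSpace M] [BorelSpace M]
    (e : OpenPartialHomeomorph M (Fin n → ℂ)) {B : Set M} (hB : MeasurableSet B) :
    MeasurableSet (e.target ∩ e.symm ⁻¹' B) := by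
  have h := e.open_target.measurableSet.subtype_image
    ((continuousOn_iff_continuous_domRestrict.1 e.continuousOn_symm).measurable hB)
  convert h using 1
  ext z
  simp [and_comm]

lemma transition_image_eq (e e' : OpenPartialHomeomorph M (Fin n → ℂ)) (B : Set M) :
    (e.symm ≫ₕ e') '' (e.target ∩ e.symm ⁻¹' (B ∩ e'.source)) =
      e'.target ∩ e'.symm ⁻¹' (B ∩ e.source) := by
  have hset : e.target ∩ e.symm ⁻¹' (B ∩ e'.source) =
      (e.symm ≫ₕ e').source ∩ e.symm ⁻¹' B := by
    ext z
    simp [and_comm, and_left_comm]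
  rw [hset, OpenPartialHomeomorph.image_source_inter_eq']
  ext w
  simp only [OpenPartialHomeomorph.trans_target, OpenPartialHomeomorph.symm_symm,
    OpenPartialHomeomorph.trans_symm_eq_symm_trans_symm, OpenPartialHomeomorph.coe_trans,
    OpenPartialHomeomorph.symm_target, Set.mem_inter_iff, Set.mem_preimage, Function.comp_apply,
    and_assoc]
  refine and_congr_right fun _ => ⟨fun ⟨hsource, hB⟩ => ?_, fun ⟨hB, hsource⟩ => ?_⟩
  · exact ⟨by rwa [e.left_inv hsource] at hB, hsource⟩
  · exact ⟨hsource, by rwa [e.left_inv hsource]⟩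

variable [ChartedSpace (Fin n → ℂ) M] {e e' : OpenPartialHomeomorph M (Fin n → ℂ)}

namespace HermitianMetric

variable (g : HermitianMetric n M)

/-- The density of the volume measure with respect to the Lebesgue measure in a chart. -/
noncomputable def density (e : OpenPartialHomeomorph M (Fin n → ℂ)) (z : Fin n → ℂ) : ENNReal :=
  ENNReal.ofReal (g.mat e z).det.re

lemma ofReal_toReal_density (he : e ∈ holAtlas n M) {z : Fin n → ℂ} (hz : z ∈ e.target) :
    ((g.density e z).toReal : ℂ) = (g.mat e z).det := by
  have hpos := Complex.pos_iff.1 (g.posDef_mat he hz).det_pos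
  rw [density, ENNReal.toReal_ofReal hpos.1.le]
  exact Complex.ext rfl hpos.2

lemma density_eq_mul_density (he : e ∈ holAtlas n M) (he' : e' ∈ holAtlas n M) {z : Fin n → ℂ}
    (hz : z ∈ (e.symm ≫ₕ e').source) :
    g.density e z = ENNReal.ofReal |((fderiv ℂ (e.symm ≫ₕ e') z).restrictScalars ℝ).det| *
      g.density e' ((e.symm ≫ₕ e') z) := by
  rw [density, density, g.mat_eq_pullbackMetric he he' hz, re_det_pullbackMetric,
    det_restrictScalars_fderiv, abs_of_nonneg (normSq_nonneg _),
    ENNReal.ofReal_mul (normSq_nonneg _)]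

variable [MeasurableSpace M]

/-- The measure on the domain of a chart with the given density. -/
noncomputable def chartVol (e : OpenPartialHomeomorph M (Fin n → ℂ)) : Measure M :=
  Measure.map e.symm ((volume.restrict e.target).withDensity (g.density e))

lemma vol_eq_iSup_chartVol : g.vol = ⨆ e ∈ holAtlas n M, g.chartVol e := rfl

lemma chartVol_le_vol (he : e ∈ holAtlas n M) : g.chartVol e ≤ g.vol :=
  le_iSup₂_of_le (f := fun e (_ : e ∈ holAtlas n M) => g.chartVol e) e he le_rfl

variable [BorelSpace M]

lemma aemeasurable_symm (e : OpenPartialHomeomorph M (Fin n → ℂ)) :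
    AEMeasurable e.symm ((volume.restrict e.target).withDensity (g.density e)) :=
  (e.continuousOn_symm.aemeasurable e.open_target.measurableSet).mono_ac
    (withDensity_absolutelyContinuous _ _)

lemma chartVol_apply (e : OpenPartialHomeomorph M (Fin n → ℂ)) {B : Set M}
    (hB : MeasurableSet B) :
    g.chartVol e B = ∫⁻ z in e.target ∩ e.symm ⁻¹' B, g.density e z := by
  rw [chartVol, Measure.map_apply_of_aemeasurable (g.aemeasurable_symm e) hB, withDensity_apply',
    Measure.restrict_restrict' e.open_target.measurableSet, Set.inter_comm]

lemma chartVol_inter_source (e : OpenPartialHomeomorph M (Fin n → ℂ)) {B : Set M}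
    (hB : MeasurableSet B) : g.chartVol e (B ∩ e.source) = g.chartVol e B := by
  rw [g.chartVol_apply e hB, g.chartVol_apply e (hB.inter e.open_source.measurableSet)]
  congr 2
  ext z
  exact ⟨fun h => ⟨h.1, h.2.1⟩, fun h => ⟨h.1, h.2, e.map_target h.1⟩⟩

lemma chartVol_inter_source_comm (he : e ∈ holAtlas n M) (he' : e' ∈ holAtlas n M) {B : Set M}
    (hB : MeasurableSet B) : g.chartVol e (B ∩ e'.source) = g.chartVol e' (B ∩ e.source) := by
  have hB' := hB.inter e'.open_source.measurableSet
  have hmeas := measurableSet_target_inter_preimage e hB'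
  have hsub : e.target ∩ e.symm ⁻¹' (B ∩ e'.source) ⊆ (e.symm ≫ₕ e').source :=
    fun z hz => ⟨hz.1, hz.2.2⟩
  have hderiv : ∀ z ∈ e.target ∩ e.symm ⁻¹' (B ∩ e'.source),
      HasFDerivWithinAt (e.symm ≫ₕ e') ((fderiv ℂ (e.symm ≫ₕ e') z).restrictScalars ℝ)
        (e.target ∩ e.symm ⁻¹' (B ∩ e'.source)) z := fun z hz =>
    (((contDiffAt_transition he he' (hsub hz)).differentiableAt
      (by simp)).hasFDerivAt.restrictScalars ℝ).hasFDerivWithinAt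
  rw [g.chartVol_apply e hB', g.chartVol_apply e' (hB.inter e.open_source.measurableSet),
    ← transition_image_eq e e' B, lintegral_image_eq_lintegral_abs_det_fderiv_mul volume hmeas
      hderiv ((e.symm ≫ₕ e').injOn.mono hsub)]
  exact setLIntegral_congr_fun hmeas fun z hz => g.density_eq_mul_density he he' (hsub hz)

lemma vol_restrict_source (he : e ∈ holAtlas n M) : g.vol.restrict e.source = g.chartVol e := by
  have hs := e.open_source.measurableSet
  have hle : g.vol ≤ g.chartVol e + g.vol.restrict e.sourceᶜ := by
    rw [vol_eq_iSup_chartVol]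
    refine iSup₂_le fun e' he' => Measure.le_iff.2 fun B hB => ?_
    rw [← vol_eq_iSup_chartVol, Measure.add_apply, Measure.restrict_apply hB,
      ← measure_inter_add_sdiff B hs, g.chartVol_inter_source_comm he' he hB]
    exact add_le_add (measure_mono Set.inter_subset_left) (g.chartVol_le_vol he' _)
  refine le_antisymm (Measure.le_iff.2 fun B hB => ?_) (Measure.le_iff.2 fun B hB => ?_)
  · rw [Measure.restrict_apply hB]
    refine (hle _).trans ?_
    rw [Measure.add_apply, Measure.restrict_apply (hB.inter hs), g.chartVol_inter_source e hB,
      Set.inter_assoc, Set.inter_compl_self, Set.inter_empty, measure_empty, add_zero]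
  · rw [Measure.restrict_apply hB, ← g.chartVol_inter_source e hB]
    exact g.chartVol_le_vol he _

lemma integral_vol_eq_setIntegral (he : e ∈ holAtlas n M) {F : M → ℂ}
    (hF : ContinuousOn F e.source) (hzero : ∀ x, x ∉ e.source → F x = 0) :
    ∫ x, F x ∂g.vol = ∫ z in e.target, (g.mat e z).det * F (e.symm z) := by
  have ht := e.open_target.measurableSet
  have hdet : ContinuousOn (fun z => (g.mat e z).det) e.target := fun z hz =>
    (contDiffAt_det (g.contDiffAt_mat he hz)).continuousAt.continuousWithinAt
  have hdens : AEMeasurable (g.density e) (volume.restrict e.target) :=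
    ENNReal.measurable_ofReal.comp_aemeasurable
      (Complex.measurable_re.comp_aemeasurable (hdet.aemeasurable ht))
  have hmeas : AEStronglyMeasurable F (g.chartVol e) := by
    rw [← g.vol_restrict_source he]
    exact hF.aestronglyMeasurable e.open_source.measurableSet
  rw [← setIntegral_eq_integral_of_forall_compl_eq_zero hzero, g.vol_restrict_source he, chartVol,
    integral_map (g.aemeasurable_symm e) hmeas, integral_withDensity_eq_integral_toReal_smul₀ hdens
      (Filter.Eventually.of_forall fun z => ENNReal.ofReal_lt_top)]
  refine setIntegral_congr_fun ht fun z hz => ?_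
  simp only [Complex.real_smul, g.ofReal_toReal_density he hz]

end HermitianMetric

end Volume

/-! ### Integrals of functions with compact support in an open set -/

section Integrals

variable {X : Type*} [NormedAddCommGroup X] {U K : Set X}

lemma eventuallyEq_zero_of_eq_zero_off {E : Type*} [Zero E] {f : X → E} (hU : IsOpen U)
    (hK : IsCompact K) (hzero : ∀ z ∈ U, z ∉ K → f z = 0) {z : X} (hz : z ∈ U) (hzK : z ∉ K) :
    f =ᶠ[𝓝 z] fun _ => 0 := by
  filter_upwards [hU.mem_nhds hz, hK.isClosed.isOpen_compl.mem_nhds hzK] with w hw hwK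
    using hzero w hw hwK

variable [MeasurableSpace X] [BorelSpace X] {μ : Measure X} [IsFiniteMeasureOnCompacts μ]

lemma integrableOn_of_eq_zero_off_compact {E : Type*} [NormedAddCommGroup E] {f : X → E}
    (hU : IsOpen U) (hK : IsCompact K) (hKU : K ⊆ U) (hf : ContinuousOn f U)
    (hzero : ∀ z ∈ U, z ∉ K → f z = 0) : IntegrableOn f U μ :=
  ((hf.mono hKU).integrableOn_compact hK).of_forall_sdiff_eq_zero hU.measurableSet
    fun z hz => hzero z hz.1 hz.2

variable [NormedSpace ℝ X]

lemma hasDerivAt_setIntegral_mul (hU : IsOpen U) (hK : IsCompact K) (hKU : K ⊆ U) {ρ : X → ℂ}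
    (hρ : ContinuousOn ρ U) (hzero : ∀ z ∈ U, z ∉ K → ρ z = 0) {s : Set ℝ} (hs : IsOpen s) {a : ℝ}
    (ha : a ∈ s) {Φ : ℝ × X → ℂ} (hΦ : ∀ p ∈ s ×ˢ U, ContDiffAt ℝ 1 Φ p) :
    HasDerivAt (fun b => ∫ z in U, ρ z * Φ (b, z) ∂μ)
      (∫ z in U, ρ z * dirDeriv (paramDir X) Φ (a, z) ∂μ) a := by
  have hΦ_cont : ContinuousOn Φ (s ×ˢ U) := fun p hp =>
    (hΦ p hp).continuousAt.continuousWithinAt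
  have hderiv_cont : ContinuousOn (dirDeriv (paramDir X) Φ) (s ×ˢ U) := fun p hp =>
    (contDiffAt_dirDeriv (m := 0) (hΦ p hp)).continuousAt.continuousWithinAt
  have hslice {f : ℝ × X → ℂ} (hf : ContinuousOn f (s ×ˢ U)) {b : ℝ} (hb : b ∈ s) :
      ContinuousOn (fun z => ρ z * f (b, z)) U :=
    hρ.mul (hf.comp (by fun_prop) fun z hz => ⟨hb, hz⟩)
  obtain ⟨L, hL, hLs, hLc⟩ := local_compact_nhds (hs.mem_nhds ha)
  obtain ⟨C, hC⟩ := (hLc.prod hK).exists_bound_of_continuousOn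
    (hderiv_cont.mono (Set.prod_mono hLs hKU))
  refine (hasDerivAt_integral_of_dominated_loc_of_deriv_le (μ := μ.restrict U)
    (F' := fun b z => ρ z * dirDeriv (paramDir X) Φ (b, z)) (bound := fun z => C * ‖ρ z‖)
    hL ?_ ?_ ?_ ?_ ?_ ?_).2
  · filter_upwards [hs.mem_nhds ha] with b hb
    exact (hslice hΦ_cont hb).aestronglyMeasurable hU.measurableSet
  · exact integrableOn_of_eq_zero_off_compact hU hK hKU (hslice hΦ_cont ha)
      fun z hz hzK => by rw [hzero z hz hzK, zero_mul]
  · exact (hslice hderiv_cont ha).aestronglyMeasurable hU.measurableSet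
  · filter_upwards [ae_restrict_mem hU.measurableSet] with z hz b hb
    by_cases hzK : z ∈ K
    · rw [norm_mul, mul_comm]
      exact mul_le_mul_of_nonneg_right (hC (b, z) ⟨hb, hzK⟩) (norm_nonneg _)
    · simp [hzero z hz hzK]
  · exact ((integrableOn_of_eq_zero_off_compact hU hK hKU hρ hzero).norm).const_mul C
  · filter_upwards [ae_restrict_mem hU.measurableSet] with z hz b hb
    exact (hasDerivAt_dirDeriv_paramDir
      ((hΦ (b, z) ⟨hLs hb, hz⟩).differentiableAt (by norm_num))).const_mul (ρ z)

end Integrals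

section Divergence

variable {X : Type*} [NormedAddCommGroup X] [NormedSpace ℝ X] [FiniteDimensional ℝ X]
  [MeasurableSpace X] [BorelSpace X] {μ : Measure X} [μ.IsAddHaarMeasure] {U K : Set X}

lemma integral_fderiv_apply_eq_zero {Y : X → ℂ} (hY : ContDiff ℝ 1 Y)
    (hsupp : HasCompactSupport Y) (v : X) : ∫ z, fderiv ℝ Y z v ∂μ = 0 := by
  have hint : Integrable (fun z => fderiv ℝ Y z v) μ :=
    ((hY.continuous_fderiv (by simp)).clm_apply
      continuous_const).integrable_of_hasCompactSupport (hsupp.fderiv_apply ℝ v)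
  simpa using integral_mul_fderiv_eq_neg_fderiv_mul_of_integrable (μ := μ)
    (f := fun _ : X => (1 : ℂ)) (g := Y) (v := v) (by simp) (by simpa using hint)
    (by simpa using hY.continuous.integrable_of_hasCompactSupport hsupp)
    (fun x _ => differentiableAt_const _) (fun x _ => hY.differentiable (by simp) x)

lemma integral_dirDeriv_eq_zero {Y : X → ℂ} (hY : ContDiff ℝ 1 Y) (hsupp : HasCompactSupport Y)
    (ξ : X × X) : ∫ z, dirDeriv ξ Y z ∂μ = 0 := by
  have hint (v : X) : Integrable (fun z => fderiv ℝ Y z v) μ :=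
    ((hY.continuous_fderiv (by simp)).clm_apply
      continuous_const).integrable_of_hasCompactSupport (hsupp.fderiv_apply ℝ v)
  simp only [dirDeriv, smul_eq_mul]
  rw [integral_add (hint _) ((hint _).const_mul I), integral_const_mul,
    integral_fderiv_apply_eq_zero hY hsupp, integral_fderiv_apply_eq_zero hY hsupp, mul_zero,
    add_zero]

lemma setIntegral_dirDeriv_eq_zero (hU : IsOpen U) (hK : IsCompact K) (hKU : K ⊆ U) {Y : X → ℂ}
    (hY : ∀ z ∈ U, ContDiffAt ℝ 1 Y z) (hzero : ∀ z ∈ U, z ∉ K → Y z = 0) (ξ : X × X) :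
    ∫ z in U, dirDeriv ξ Y z ∂μ = 0 := by
  set Z : X → ℂ := U.indicator Y with hZ
  have hZU {z : X} (hz : z ∈ U) : Z =ᶠ[𝓝 z] Y := by
    filter_upwards [hU.mem_nhds hz] with w hw using Set.indicator_of_mem hw Y
  have hZ_zero (z : X) (hz : z ∉ K) : Z z = 0 := by
    by_cases hzU : z ∈ U
    · rw [hZ, Set.indicator_of_mem hzU, hzero z hzU hz]
    · rw [hZ, Set.indicator_of_notMem hzU]
  have hZK {z : X} (hz : z ∉ K) : Z =ᶠ[𝓝 z] fun _ => 0 :=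
    eventuallyEq_zero_of_eq_zero_off isOpen_univ hK (fun w _ => hZ_zero w) (Set.mem_univ z) hz
  have hZ_smooth : ContDiff ℝ 1 Z := by
    rw [contDiff_iff_contDiffAt]
    intro z
    by_cases hz : z ∈ U
    · exact (hY z hz).congr_of_eventuallyEq (hZU hz)
    · exact contDiffAt_const.congr_of_eventuallyEq (hZK fun h => hz (hKU h))
  rw [← integral_dirDeriv_eq_zero (μ := μ) hZ_smooth (HasCompactSupport.intro hK hZ_zero) ξ,
    ← setIntegral_eq_integral_of_forall_compl_eq_zero (s := U) (f := dirDeriv ξ Z)]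
  · exact setIntegral_congr_fun hU.measurableSet fun z hz => (dirDeriv_congr (hZU hz)).symm
  · intro z hz
    rw [dirDeriv_congr (hZK fun h => hz (hKU h)), dirDeriv_const]

lemma setIntegral_det_mul_laplacian_eq_zero {ι : Type*} [Fintype ι] [DecidableEq ι]
    {ζ : ι → X × X} {G : X → Matrix ι ι ℂ} (hU : IsOpen U) (hK : IsCompact K) (hKU : K ⊆ U)
    (hG : ∀ z ∈ U, ContDiffAt ℝ 1 G z) (hunit : ∀ z ∈ U, IsUnit (G z))
    (hT : ∀ z ∈ U, torsionMatrix ζ G z = 0) {v : X → ℂ} (hv : ∀ z ∈ U, ContDiffAt ℝ 2 v z)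
    (hzero : ∀ z ∈ U, z ∉ K → v z = 0) :
    ∫ z in U, (G z).det * laplacian ζ G v z ∂μ = 0 := by
  set Y : ι → X → ℂ := fun l y =>
    ∑ m, (G y).det * (G y)⁻¹ m l * dirDeriv (conjDir (ζ m)) v y
  have hY (l : ι) : ∀ z ∈ U, ContDiffAt ℝ 1 (Y l) z := fun z hz =>
    ContDiffAt.sum fun m _ => ((contDiffAt_det (hG z hz)).mul
      (contDiffAt_matrix_iff.1 (contDiffAt_inv (hG z hz) (hunit z hz)) m l)).mul
        (contDiffAt_dirDeriv (hv z hz))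
  have hY_zero (l : ι) : ∀ z ∈ U, z ∉ K → Y l z = 0 := fun z hz hzK =>
    Finset.sum_eq_zero fun m _ => by
      rw [dirDeriv_congr (eventuallyEq_zero_of_eq_zero_off hU hK hzero hz hzK), dirDeriv_const,
        mul_zero]
  have hint (l : ι) : IntegrableOn (dirDeriv (ζ l) (Y l)) U μ :=
    integrableOn_of_eq_zero_off_compact hU hK hKU
      (fun z hz => (contDiffAt_dirDeriv (m := 0) (hY l z hz)).continuousAt.continuousWithinAt)
      fun z hz hzK => by
        rw [dirDeriv_congr (eventuallyEq_zero_of_eq_zero_off hU hK (hY_zero l) hz hzK),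
          dirDeriv_const]
  rw [setIntegral_congr_fun (g := fun z => ∑ l, dirDeriv (ζ l) (Y l) z) hU.measurableSet
    fun z hz => det_mul_laplacian (hG z hz) (hunit z hz) (hT z hz) (hv z hz),
    integral_finsetSum _ fun l _ => hint l]
  exact Finset.sum_eq_zero fun l _ =>
    setIntegral_dirDeriv_eq_zero hU hK hKU (hY l) (hY_zero l) _

end Divergence

/-! ### Smooth functions and the divergence theorem -/

section SmoothFunctions

variable {n : ℕ} {M : Type*} [TopologicalSpace M] [ChartedSpace (Fin n → ℂ) M]
  {e e' : OpenPartialHomeomorph M (Fin n → ℂ)} {v : M → ℂ}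

lemma transition_mem_contDiffGroupoid_real (he : e ∈ holAtlas n M) (he' : e' ∈ holAtlas n M) :
    e.symm ≫ₕ e' ∈ contDiffGroupoid ∞ 𝓘(ℝ, Fin n → ℂ) := by
  have hreal {e e' : OpenPartialHomeomorph M (Fin n → ℂ)} (he : e ∈ holAtlas n M)
      (he' : e' ∈ holAtlas n M) : ContDiffOn ℝ ∞ (e.symm ≫ₕ e') (e.symm ≫ₕ e').source :=
    fun z hz => (((contDiffAt_transition he he' hz).of_le le_top).restrict_scalars
      ℝ).contDiffWithinAt
  rw [contDiffGroupoid, mem_groupoid_of_pregroupoid]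
  simpa [contDiffPregroupoid] using And.intro (hreal he he') (hreal he' he)

variable [IsManifold 𝓘(ℂ, Fin n → ℂ) ω M]

lemma chartAt_mem_holAtlas (x : M) : chartAt (Fin n → ℂ) x ∈ holAtlas n M :=
  IsManifold.chart_mem_maximalAtlas x

variable (n M) in
lemma isManifold_real : IsManifold 𝓘(ℝ, Fin n → ℂ) ∞ M :=
  have : HasGroupoid M (contDiffGroupoid ∞ 𝓘(ℝ, Fin n → ℂ)) :=
    ⟨fun he he' => transition_mem_contDiffGroupoid_real
      (IsManifold.subset_maximalAtlas he) (IsManifold.subset_maximalAtlas he')⟩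
  IsManifold.mk' _ _ _

lemma mem_maximalAtlas_real (he : e ∈ holAtlas n M) :
    e ∈ IsManifold.maximalAtlas 𝓘(ℝ, Fin n → ℂ) ∞ M := fun _ he' =>
  ⟨transition_mem_contDiffGroupoid_real he (IsManifold.subset_maximalAtlas he'),
    transition_mem_contDiffGroupoid_real (IsManifold.subset_maximalAtlas he') he⟩

lemma contDiffAt_comp_symm (hv : ContMDiff 𝓘(ℝ, Fin n → ℂ) 𝓘(ℝ, ℂ) ∞ v) (he : e ∈ holAtlas n M)
    {z : Fin n → ℂ} (hz : z ∈ e.target) : ContDiffAt ℝ ∞ (fun w => v (e.symm w)) z :=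
  (hv.comp_contMDiffOn (contMDiffOn_symm_of_mem_maximalAtlas
    (mem_maximalAtlas_real he))).contDiffOn.contDiffAt (e.open_target.mem_nhds hz)

lemma contMDiff_of_contDiffAt_comp_symm (hv : ∀ e ∈ holAtlas n M, ∀ z ∈ e.target,
    ContDiffAt ℝ ∞ (fun w => v (e.symm w)) z) : ContMDiff 𝓘(ℝ, Fin n → ℂ) 𝓘(ℝ, ℂ) ∞ v := by
  intro x
  have hx := mem_chart_source (Fin n → ℂ) x
  have hcomp : ContMDiffAt 𝓘(ℝ, Fin n → ℂ) 𝓘(ℝ, ℂ) ∞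
      (fun y => v ((chartAt (Fin n → ℂ) x).symm (chartAt (Fin n → ℂ) x y))) x :=
    (hv _ (chartAt_mem_holAtlas x) _ ((chartAt _ x).map_source hx)).contMDiffAt.comp x
      (contMDiffAt_of_mem_maximalAtlas (mem_maximalAtlas_real (chartAt_mem_holAtlas x)) hx)
  refine hcomp.congr_of_eventuallyEq ?_
  filter_upwards [(chartAt (Fin n → ℂ) x).open_source.mem_nhds hx] with y hy
  rw [(chartAt (Fin n → ℂ) x).left_inv hy]

lemma exists_smooth_partition [T2Space M] [CompactSpace M] :
    ∃ (s : Finset M) (ρ : M → M → ℂ), (∀ x, ∑ i ∈ s, ρ i x = 1) ∧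
      (∀ i, tsupport (ρ i) ⊆ (chartAt (Fin n → ℂ) i).source) ∧
      ∀ i, ContMDiff 𝓘(ℝ, Fin n → ℂ) 𝓘(ℝ, ℂ) ∞ (ρ i) := by
  have := isManifold_real n M
  obtain ⟨f, hf⟩ := SmoothPartitionOfUnity.exists_isSubordinate 𝓘(ℝ, Fin n → ℂ)
    (isClosed_univ (X := M)) (fun i : M => (chartAt (Fin n → ℂ) i).source)
    (fun i => (chartAt (Fin n → ℂ) i).open_source)
    (fun x _ => Set.mem_iUnion.2 ⟨x, mem_chart_source _ x⟩)
  have hfin := f.locallyFinite.finite_nonempty_of_compact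
  refine ⟨hfin.toFinset, fun i x => (f i x : ℂ), fun x => ?_, fun i => ?_, fun i =>
    Complex.ofRealCLM.contDiff.comp_contMDiff (f i).contMDiff⟩
  · have hone := f.sum_eq_one (Set.mem_univ x)
    rw [finsum_eq_sum_of_support_subset (s := hfin.toFinset)] at hone
    · rw [← Complex.ofReal_sum, hone, Complex.ofReal_one]
    · exact fun i hi => hfin.mem_toFinset.2 ⟨x, hi⟩
  · exact (closure_mono fun x hx => by simpa using hx).trans (hf i)

end SmoothFunctions

section LaplacianAlgebra

variable {X : Type*} [NormedAddCommGroup X] [NormedSpace ℝ X] {ι : Type*} [Fintype ι]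
  [DecidableEq ι] {ζ : ι → X × X} {G : X → Matrix ι ι ℂ} {x : X}

lemma laplacian_congr {H : X → Matrix ι ι ℂ} {v w : X → ℂ} (hGH : G x = H x) (h : v =ᶠ[𝓝 x] w) :
    laplacian ζ G v x = laplacian ζ H w x := by
  have hbar (m : ι) : dirDeriv (conjDir (ζ m)) v =ᶠ[𝓝 x] dirDeriv (conjDir (ζ m)) w := by
    filter_upwards [h.eventuallyEq_nhds] with y hy using dirDeriv_congr hy
  simp only [laplacian, hGH, dirDeriv_congr (hbar _)]

lemma laplacian_const (c : ℂ) : laplacian ζ G (fun _ => c) x = 0 := by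
  have hbar (m : ι) : dirDeriv (conjDir (ζ m)) (fun _ : X => c) = fun _ => 0 :=
    funext fun _ => dirDeriv_const c
  simp [laplacian, contract, hbar, dirDeriv_const]

lemma laplacian_sum {κ : Type*} {s : Finset κ} {v : κ → X → ℂ}
    (hv : ∀ i ∈ s, ContDiffAt ℝ 2 (v i) x) :
    laplacian ζ G (fun y => ∑ i ∈ s, v i y) x = ∑ i ∈ s, laplacian ζ G (v i) x := by
  have hdiff : ∀ᶠ y in 𝓝 x, ∀ i ∈ s, DifferentiableAt ℝ (v i) y := by
    rw [Filter.eventually_all_finset]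
    exact fun i hi => ((hv i hi).eventually (by norm_num)).mono fun y hy =>
      hy.differentiableAt (by norm_num)
  have hbar (m : ι) : dirDeriv (conjDir (ζ m)) (fun y => ∑ i ∈ s, v i y) =ᶠ[𝓝 x]
      fun y => ∑ i ∈ s, dirDeriv (conjDir (ζ m)) (v i) y := by
    filter_upwards [hdiff] with y hy using dirDeriv_sum hy
  have hsum (l m : ι) : dirDeriv (ζ l) (dirDeriv (conjDir (ζ m)) fun y => ∑ i ∈ s, v i y) x =
      ∑ i ∈ s, dirDeriv (ζ l) (dirDeriv (conjDir (ζ m)) (v i)) x := by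
    rw [dirDeriv_congr (hbar m), dirDeriv_sum fun i hi =>
      (contDiffAt_dirDeriv (m := 1) (hv i hi)).differentiableAt (by norm_num)]
  simp only [laplacian, hsum, contract_sum]

lemma contDiffAt_laplacian {m k : WithTop ℕ∞} {v : X → ℂ} (hG : ContDiffAt ℝ m G x)
    (hx : IsUnit (G x)) (hv : ContDiffAt ℝ k v x) (hm : m + 1 + 1 ≤ k := by norm_num) :
    ContDiffAt ℝ m (laplacian ζ G v) x :=
  contDiffAt_contract (contDiffAt_inv hG hx) fun _ _ =>
    contDiffAt_dirDeriv (contDiffAt_dirDeriv hv hm)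

end LaplacianAlgebra

section DivergenceTheorem

variable {n : ℕ} {M : Type*} [TopologicalSpace M] {e : OpenPartialHomeomorph M (Fin n → ℂ)}
  {v : M → ℂ}

lemma isCompact_image_tsupport [CompactSpace M] (hsupp : tsupport v ⊆ e.source) :
    IsCompact (e '' tsupport v) :=
  (isClosed_tsupport v).isCompact.image_of_continuousOn (e.continuousOn.mono hsupp)

lemma image_tsupport_subset_target (hsupp : tsupport v ⊆ e.source) :
    e '' tsupport v ⊆ e.target :=
  Set.image_subset_iff.2 fun _ hx => e.map_source (hsupp hx)

lemma comp_symm_eq_zero_of_notMem_image_tsupport {z : Fin n → ℂ} (hz : z ∈ e.target)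
    (hzK : z ∉ e '' tsupport v) : v (e.symm z) = 0 := by
  by_contra h
  exact hzK ⟨_, subset_tsupport v h, e.right_inv hz⟩

namespace HermitianMetric

variable [ChartedSpace (Fin n → ℂ) M] (g : HermitianMetric n M)

lemma IsKahler.torsionMatrix_eq_zero {g : HermitianMetric n M} (hg : g.IsKahler)
    (he : e ∈ holAtlas n M) {z : Fin n → ℂ} (hz : z ∈ e.target) :
    torsionMatrix hol (g.mat e) z = 0 := by
  ext i j k
  rw [← torsion_eq ((g.contDiffAt_mat he hz).differentiableAt (by simp)), hg e he z hz]
  rfl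

/-- The Laplacian `g^{l m̄} ∂_l ∂_m̄ v` of a function on `M`, computed at each point in the
preferred chart there. -/
noncomputable def laplacian (v : M → ℂ) (x : M) : ℂ :=
  HermitianFlow.laplacian hol (g.mat (chartAt (Fin n → ℂ) x))
    (fun z => v ((chartAt (Fin n → ℂ) x).symm z)) (chartAt (Fin n → ℂ) x x)

lemma laplacian_eq_zero_of_notMem_tsupport {x : M} (hx : x ∉ tsupport v) :
    g.laplacian v x = 0 := by
  have hxs := mem_chart_source (Fin n → ℂ) x
  rw [laplacian, laplacian_congr (w := fun _ => 0) rfl, laplacian_const]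
  have hcont : Tendsto (chartAt (Fin n → ℂ) x).symm (𝓝 (chartAt (Fin n → ℂ) x x)) (𝓝 x) := by
    simpa only [ContinuousAt, (chartAt (Fin n → ℂ) x).left_inv hxs] using
      (chartAt (Fin n → ℂ) x).continuousAt_symm ((chartAt (Fin n → ℂ) x).map_source hxs)
  exact hcont.eventually (notMem_tsupport_iff_eventuallyEq.1 hx)

variable [IsManifold 𝓘(ℂ, Fin n → ℂ) ω M]

lemma laplacian_symm_apply (hv : ContMDiff 𝓘(ℝ, Fin n → ℂ) 𝓘(ℝ, ℂ) ∞ v) (he : e ∈ holAtlas n M)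
    {z : Fin n → ℂ} (hz : z ∈ e.target) : g.laplacian v (e.symm z) =
      HermitianFlow.laplacian hol (g.mat e) (fun w => v (e.symm w)) z := by
  set e' := chartAt (Fin n → ℂ) (e.symm z)
  have he' : e' ∈ holAtlas n M := chartAt_mem_holAtlas _
  have hz' : z ∈ (e.symm ≫ₕ e').source := ⟨hz, mem_chart_source _ _⟩
  calc g.laplacian v (e.symm z) =
        HermitianFlow.laplacian hol (pullbackMetric (e.symm ≫ₕ e') (g.mat e'))
          (fun w => v (e'.symm ((e.symm ≫ₕ e') w))) z :=
        (laplacian_pullbackMetric ((contDiffAt_transition he he' hz').of_le le_top)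
          (isUnit_jac_transition he he' hz') ((contDiffAt_comp_symm hv he'
            (e'.map_source hz'.2)).of_le ENat.LEInfty.out)).symm
    _ = HermitianFlow.laplacian hol (g.mat e) (fun w => v (e.symm w)) z := by
        refine laplacian_congr (g.mat_eq_pullbackMetric he he' hz').symm ?_
        filter_upwards [(e.symm ≫ₕ e').open_source.mem_nhds hz'] with w hw
        exact congrArg v (e'.left_inv hw.2)

lemma contMDiff_laplacian (hv : ContMDiff 𝓘(ℝ, Fin n → ℂ) 𝓘(ℝ, ℂ) ∞ v) :
    ContMDiff 𝓘(ℝ, Fin n → ℂ) 𝓘(ℝ, ℂ) ∞ (g.laplacian v) := by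
  refine contMDiff_of_contDiffAt_comp_symm fun e he z hz => ?_
  refine (contDiffAt_laplacian (ζ := hol) (g.contDiffAt_mat he hz) (g.isUnit_mat he hz)
    (contDiffAt_comp_symm hv he hz) (by simp)).congr_of_eventuallyEq ?_
  filter_upwards [e.open_target.mem_nhds hz] with w hw using g.laplacian_symm_apply hv he hw

lemma laplacian_finset_sum {κ : Type*} {s : Finset κ} {v : κ → M → ℂ}
    (hv : ∀ i ∈ s, ContMDiff 𝓘(ℝ, Fin n → ℂ) 𝓘(ℝ, ℂ) ∞ (v i)) (x : M) :
    g.laplacian (fun y => ∑ i ∈ s, v i y) x = ∑ i ∈ s, g.laplacian (v i) x :=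
  laplacian_sum fun i hi => (contDiffAt_comp_symm (hv i hi) (chartAt_mem_holAtlas x)
    ((chartAt (Fin n → ℂ) x).map_source (mem_chart_source _ x))).of_le ENat.LEInfty.out

variable {g} [CompactSpace M] [MeasurableSpace M] [BorelSpace M]

lemma IsKahler.integral_laplacian_of_tsupport_subset (hg : g.IsKahler)
    (hv : ContMDiff 𝓘(ℝ, Fin n → ℂ) 𝓘(ℝ, ℂ) ∞ v) (he : e ∈ holAtlas n M)
    (hsupp : tsupport v ⊆ e.source) : ∫ x, g.laplacian v x ∂g.vol = 0 := by
  rw [g.integral_vol_eq_setIntegral he (g.contMDiff_laplacian hv).continuous.continuousOn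
      fun x hx => g.laplacian_eq_zero_of_notMem_tsupport fun h => hx (hsupp h),
    setIntegral_congr_fun e.open_target.measurableSet fun z hz =>
      congrArg ((g.mat e z).det * ·) (g.laplacian_symm_apply hv he hz)]
  exact setIntegral_det_mul_laplacian_eq_zero e.open_target (isCompact_image_tsupport hsupp)
    (image_tsupport_subset_target hsupp)
    (fun z hz => (g.contDiffAt_mat he hz).of_le ENat.LEInfty.out) (fun z hz => g.isUnit_mat he hz)
    (fun z hz => hg.torsionMatrix_eq_zero he hz)
    (fun z hz => (contDiffAt_comp_symm hv he hz).of_le ENat.LEInfty.out)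
    fun z hz hzK => comp_symm_eq_zero_of_notMem_image_tsupport hz hzK

lemma IsKahler.integral_laplacian [T2Space M] [IsFiniteMeasure g.vol] (hg : g.IsKahler)
    (hv : ContMDiff 𝓘(ℝ, Fin n → ℂ) 𝓘(ℝ, ℂ) ∞ v) : ∫ x, g.laplacian v x ∂g.vol = 0 := by
  obtain ⟨s, ρ, hsum, hsupp, hρ⟩ := exists_smooth_partition (n := n) (M := M)
  have hρv (i : M) : ContMDiff 𝓘(ℝ, Fin n → ℂ) 𝓘(ℝ, ℂ) ∞ fun x => ρ i x * v x :=
    contDiff_mul.comp_contMDiff ((hρ i).prodMk_space hv)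
  have hdecomp : v = fun x => ∑ i ∈ s, ρ i x * v x := by
    simp only [← Finset.sum_mul, hsum, one_mul]
  rw [hdecomp]
  simp only [g.laplacian_finset_sum fun i _ => hρv i]
  rw [integral_finsetSum s fun i _ =>
    (g.contMDiff_laplacian (hρv i)).continuous.integrable_of_hasCompactSupport
      (HasCompactSupport.of_compactSpace _)]
  exact Finset.sum_eq_zero fun i _ => hg.integral_laplacian_of_tsupport_subset (hρv i)
    (chartAt_mem_holAtlas i) (tsupport_mul_subset_left.trans (hsupp i))

end HermitianMetric

end DivergenceTheorem

/-! ### Smooth families of metrics -/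

section Family

variable {n : ℕ} {M : Type*} [TopologicalSpace M] [ChartedSpace (Fin n → ℂ) M]
  {e : OpenPartialHomeomorph M (Fin n → ℂ)} {z : Fin n → ℂ}

/-- The coefficients of a family of metrics in a chart, as a function on `ℝ × ℂⁿ` of the parameter
and the point. -/
noncomputable def familyMat (g : ℝ → HermitianMetric n M)
    (e : OpenPartialHomeomorph M (Fin n → ℂ)) (p : ℝ × (Fin n → ℂ)) : Matrix (Fin n) (Fin n) ℂ :=
  (g p.1).mat e p.2

/-- The trace `g^{i j̄} h_{i j̄}` of a `2`-tensor on `M`, computed at each point in the preferred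
chart there. -/
noncomputable def traceForm (g : HermitianMetric n M)
    (h : ∀ x : M, LinearMap.BilinForm ℝ (Tan (n := n) x)) (x : M) : ℂ :=
  ((g.mat (chartAt (Fin n → ℂ) x) (chartAt (Fin n → ℂ) x x))⁻¹ *
    coeff h (chartAt (Fin n → ℂ) x) (chartAt (Fin n → ℂ) x x)).trace

lemma traceForm_symm_apply [IsManifold 𝓘(ℂ, Fin n → ℂ) ω M] (g : HermitianMetric n M)
    {h : ∀ x : M, LinearMap.BilinForm ℝ (Tan (n := n) x)}
    (hJ : ∀ x u v, h x (I • u) (I • v) = h x u v) (he : e ∈ holAtlas n M) (hz : z ∈ e.target) :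
    traceForm g h (e.symm z) = ((g.mat e z)⁻¹ * coeff h e z).trace := by
  set e' := chartAt (Fin n → ℂ) (e.symm z)
  have he' : e' ∈ holAtlas n M := chartAt_mem_holAtlas _
  have hz' : z ∈ (e.symm ≫ₕ e').source := ⟨hz, mem_chart_source _ _⟩
  set P := jac (e.symm ≫ₕ e') z
  set G := g.mat e' ((e.symm ≫ₕ e') z)
  set B := coeff h e' ((e.symm ≫ₕ e') z)
  have hG : g.mat e z = P * G * Pᴴ := g.mat_eq_pullbackMetric he he' hz'
  have hB : coeff h e z = P * B * Pᴴ := coeff_eq_pullbackMetric hJ he he' hz'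
  calc traceForm g h (e.symm z) = (G⁻¹ * B).trace := rfl
    _ = (Pᴴ * (P * G * Pᴴ)⁻¹ * P * B).trace := by
        rw [inv_mul_mul_conjTranspose (isUnit_jac_transition he he' hz')]
    _ = ((P * G * Pᴴ)⁻¹ * (P * B * Pᴴ)).trace := by
        rw [mul_assoc, mul_assoc, Matrix.trace_mul_comm, mul_assoc]
    _ = ((g.mat e z)⁻¹ * coeff h e z).trace := by rw [hG, hB]

variable {g : ℝ → HermitianMetric n M} {ε : ℝ}
  {h : ∀ x : M, LinearMap.BilinForm ℝ (Tan (n := n) x)}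

lemma SmoothFamily.contDiffAt_familyMat (hg : SmoothFamily g ε) (he : e ∈ holAtlas n M)
    {p : ℝ × (Fin n → ℂ)} (hp : p ∈ Set.Ioo (-ε) ε ×ˢ e.target) :
    ContDiffAt ℝ ∞ (familyMat g e) p :=
  contDiffAt_matrix_iff.2 fun i j =>
    (hg e he i j).contDiffAt ((isOpen_Ioo.prod e.open_target).mem_nhds hp)

lemma zero_mem_Ioo (hε : 0 < ε) : (0 : ℝ) ∈ Set.Ioo (-ε) ε := ⟨neg_lt_zero.2 hε, hε⟩

lemma hasDerivAt_mat (hderiv : ∀ x u v, HasDerivAt (fun a => (g a).form x u v) (h x u v) 0)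
    (e : OpenPartialHomeomorph M (Fin n → ℂ)) (z : Fin n → ℂ) (i j : Fin n) :
    HasDerivAt (fun a => (g a).mat e z i j) (coeff h e z i j) 0 :=
  (hderiv _ _ _).ofReal_comp.add ((hderiv _ _ _).ofReal_comp.const_mul I)

lemma compat_of_hasDerivAt
    (hderiv : ∀ x u v, HasDerivAt (fun a => (g a).form x u v) (h x u v) 0) (x : M)
    (u v : Tan (n := n) x) : h x (I • u) (I • v) = h x u v :=
  (hderiv x (I • u) (I • v)).unique <|
    (hderiv x u v).congr_of_eventuallyEq <| .of_forall fun a => (g a).compat x u v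

variable (hε : 0 < ε) (hg : SmoothFamily g ε)
  (hderiv : ∀ x u v, HasDerivAt (fun a => (g a).form x u v) (h x u v) 0)

include hε hg hderiv

lemma coeff_eq_dirDeriv_familyMat (he : e ∈ holAtlas n M) (hz : z ∈ e.target) :
    coeff h e z = dirDeriv (paramDir _) (familyMat g e) (0, z) := by
  have hF := hg.contDiffAt_familyMat he (p := (0, z)) ⟨zero_mem_Ioo hε, hz⟩
  ext i j
  exact ((hasDerivAt_mat hderiv e z i j).unique (hasDerivAt_dirDeriv_paramDir
    ((contDiffAt_matrix_iff.1 hF i j).differentiableAt (by simp)))).trans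
      (dirDeriv_apply (hF.differentiableAt (by simp)) i j)

variable [IsManifold 𝓘(ℂ, Fin n → ℂ) ω M]

lemma traceForm_eq_trace_dirDeriv (he : e ∈ holAtlas n M) (hz : z ∈ e.target) :
    traceForm (g 0) h (e.symm z) = ((familyMat g e (0, z))⁻¹ *
      dirDeriv (paramDir _) (familyMat g e) (0, z)).trace := by
  rw [traceForm_symm_apply (g 0) (compat_of_hasDerivAt hderiv) he hz,
    coeff_eq_dirDeriv_familyMat hε hg hderiv he hz, familyMat]

lemma contMDiff_traceForm : ContMDiff 𝓘(ℝ, Fin n → ℂ) 𝓘(ℝ, ℂ) ∞ (traceForm (g 0) h) := by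
  refine contMDiff_of_contDiffAt_comp_symm fun e he z hz => ?_
  have hF := hg.contDiffAt_familyMat he (p := (0, z)) ⟨zero_mem_Ioo hε, hz⟩
  have hsmooth : ContDiffAt ℝ ∞ (fun w => ((familyMat g e (0, w))⁻¹ *
      dirDeriv (paramDir _) (familyMat g e) (0, w)).trace) z :=
    contDiffAt_slice (contDiffAt_trace ((contDiffAt_inv hF ((g 0).isUnit_mat he hz)).mul
      (contDiffAt_dirDeriv hF (by simp))))
  refine hsmooth.congr_of_eventuallyEq ?_
  filter_upwards [e.open_target.mem_nhds hz] with w hw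
    using traceForm_eq_trace_dirDeriv hε hg hderiv he hw

lemma dirDeriv_det_familyMat (he : e ∈ holAtlas n M) (hz : z ∈ e.target) :
    dirDeriv (paramDir _) (fun p => (familyMat g e p).det) (0, z) =
      ((g 0).mat e z).det * traceForm (g 0) h (e.symm z) := by
  have hF := hg.contDiffAt_familyMat he (p := (0, z)) ⟨zero_mem_Ioo hε, hz⟩
  rw [dirDeriv_det (hF.differentiableAt (by simp)) ((g 0).isUnit_mat he hz),
    traceForm_eq_trace_dirDeriv hε hg hderiv he hz, familyMat]

end Family

section IntegralVariation

variable {n : ℕ} {M : Type*} [TopologicalSpace M] [ChartedSpace (Fin n → ℂ) M]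
  {e : OpenPartialHomeomorph M (Fin n → ℂ)} {g : ℝ → HermitianMetric n M} {ε : ℝ}
  {h : ∀ x : M, LinearMap.BilinForm ℝ (Tan (n := n) x)} {F : ℝ → M → ℂ} {F' ρ : M → ℂ}

lemma continuous_of_continuousOn_comp_symm [IsManifold 𝓘(ℂ, Fin n → ℂ) ω M] {v : M → ℂ}
    (hv : ∀ e ∈ holAtlas n M, ContinuousOn (fun z => v (e.symm z)) e.target) : Continuous v := by
  refine continuous_iff_continuousAt.2 fun x => ?_
  have hx := mem_chart_source (Fin n → ℂ) x
  exact ((chartAt (Fin n → ℂ) x).symm.continuousAt_iff_continuousAt_comp_right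
    (by simp)).2 ((hv _ (chartAt_mem_holAtlas x)).continuousAt
      ((chartAt (Fin n → ℂ) x).open_target.mem_nhds ((chartAt _ x).map_source hx)))

section Regularity

variable (hF : ∀ e ∈ holAtlas n M, ∀ p ∈ Set.Ioo (-ε) ε ×ˢ e.target,
    ContDiffAt ℝ 1 (fun p : ℝ × (Fin n → ℂ) => F p.1 (e.symm p.2)) p)

include hF

lemma dirDeriv_paramDir_eq_of_hasDerivAt (hF' : ∀ x, HasDerivAt (fun a => F a x) (F' x) 0)
    (hε : 0 < ε) (he : e ∈ holAtlas n M) {z : Fin n → ℂ} (hz : z ∈ e.target) :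
    dirDeriv (paramDir _) (fun p : ℝ × (Fin n → ℂ) => F p.1 (e.symm p.2)) (0, z) =
      F' (e.symm z) :=
  (hasDerivAt_dirDeriv_paramDir ((hF e he (0, z) ⟨zero_mem_Ioo hε, hz⟩).differentiableAt
    (by simp))).unique (hF' (e.symm z))

variable [IsManifold 𝓘(ℂ, Fin n → ℂ) ω M]

lemma continuous_of_contDiffAt_family {a : ℝ} (ha : a ∈ Set.Ioo (-ε) ε) : Continuous (F a) :=
  continuous_of_continuousOn_comp_symm (n := n) fun e he z hz =>
    (contDiffAt_slice (hF e he (a, z) ⟨ha, hz⟩)).continuousAt.continuousWithinAt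

lemma continuous_of_hasDerivAt_family (hF' : ∀ x, HasDerivAt (fun a => F a x) (F' x) 0)
    (hε : 0 < ε) : Continuous F' :=
  continuous_of_continuousOn_comp_symm (n := n) fun e he => by
    refine ContinuousOn.congr (fun z hz => ?_) fun z hz =>
      (dirDeriv_paramDir_eq_of_hasDerivAt hF hF' hε he hz).symm
    exact (contDiffAt_slice (contDiffAt_dirDeriv (m := 0)
      (hF e he (0, z) ⟨zero_mem_Ioo hε, hz⟩))).continuousAt.continuousWithinAt

end Regularity

variable [IsManifold 𝓘(ℂ, Fin n → ℂ) ω M] [CompactSpace M] [MeasurableSpace M] [BorelSpace M]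

lemma hasDerivAt_integral_mul_of_tsupport_subset (hε : 0 < ε) (hg : SmoothFamily g ε)
    (hderiv : ∀ x u v, HasDerivAt (fun a => (g a).form x u v) (h x u v) 0)
    (hF : ∀ e ∈ holAtlas n M, ∀ p ∈ Set.Ioo (-ε) ε ×ˢ e.target,
      ContDiffAt ℝ 1 (fun p : ℝ × (Fin n → ℂ) => F p.1 (e.symm p.2)) p)
    (hF' : ∀ x, HasDerivAt (fun a => F a x) (F' x) 0) (he : e ∈ holAtlas n M)
    (hρ : Continuous ρ) (hsupp : tsupport ρ ⊆ e.source) :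
    HasDerivAt (fun a => ∫ x, ρ x * F a x ∂(g a).vol)
      (∫ x, ρ x * (F' x + F 0 x * traceForm (g 0) h x) ∂(g 0).vol) 0 := by
  have h0 := zero_mem_Ioo hε
  have hoff {v : M → ℂ} (x : M) (hx : x ∉ e.source) : ρ x * v x = 0 := by
    rw [image_eq_zero_of_notMem_tsupport fun hmem => hx (hsupp hmem), zero_mul]
  have hlocal {v : M → ℂ} (hv : Continuous v) (g : HermitianMetric n M) :
      ∫ x, ρ x * v x ∂g.vol =
        ∫ z in e.target, ρ (e.symm z) * ((g.mat e z).det * v (e.symm z)) := by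
    rw [g.integral_vol_eq_setIntegral he (hρ.fun_mul hv).continuousOn hoff]
    simp only [mul_left_comm]
  have hdet : ∀ p ∈ Set.Ioo (-ε) ε ×ˢ e.target,
      ContDiffAt ℝ 1 (fun p => (familyMat g e p).det) p := fun p hp =>
    contDiffAt_det ((hg.contDiffAt_familyMat he hp).of_le ENat.LEInfty.out)
  have hvar : ∀ z ∈ e.target,
      dirDeriv (paramDir _) (fun p => (familyMat g e p).det * F p.1 (e.symm p.2)) (0, z) =
        ((g 0).mat e z).det * (F' (e.symm z) + F 0 (e.symm z) *
          traceForm (g 0) h (e.symm z)) := fun z hz => by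
    rw [dirDeriv_mul ((hdet (0, z) ⟨h0, hz⟩).differentiableAt (by simp))
        ((hF e he (0, z) ⟨h0, hz⟩).differentiableAt (by simp)),
      dirDeriv_det_familyMat hε hg hderiv he hz,
      dirDeriv_paramDir_eq_of_hasDerivAt hF hF' hε he hz, familyMat]
    ring
  rw [hlocal ((continuous_of_hasDerivAt_family hF hF' hε).fun_add
      ((continuous_of_contDiffAt_family hF h0).fun_mul
        (contMDiff_traceForm hε hg hderiv).continuous)) (g 0),
    setIntegral_congr_fun e.open_target.measurableSet fun z hz =>
      congrArg (ρ (e.symm z) * ·) (hvar z hz).symm]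
  refine (hasDerivAt_setIntegral_mul e.open_target (isCompact_image_tsupport hsupp)
    (image_tsupport_subset_target hsupp) (hρ.comp_continuousOn e.continuousOn_symm)
    (fun z hz hzK => comp_symm_eq_zero_of_notMem_image_tsupport hz hzK) isOpen_Ioo h0
    fun p hp => (hdet p hp).mul (hF e he p hp)).congr_of_eventuallyEq ?_
  filter_upwards [isOpen_Ioo.mem_nhds h0] with a ha
    using hlocal (continuous_of_contDiffAt_family hF ha) (g a)

lemma hasDerivAt_integral_vol [T2Space M] (hε : 0 < ε) (hg : SmoothFamily g ε)
    (hderiv : ∀ x u v, HasDerivAt (fun a => (g a).form x u v) (h x u v) 0)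
    (hvol : ∀ a ∈ Set.Ioo (-ε) ε, IsFiniteMeasure (g a).vol)
    (hF : ∀ e ∈ holAtlas n M, ∀ p ∈ Set.Ioo (-ε) ε ×ˢ e.target,
      ContDiffAt ℝ 1 (fun p : ℝ × (Fin n → ℂ) => F p.1 (e.symm p.2)) p)
    (hF' : ∀ x, HasDerivAt (fun a => F a x) (F' x) 0) :
    HasDerivAt (fun a => ∫ x, F a x ∂(g a).vol)
      (∫ x, (F' x + F 0 x * traceForm (g 0) h x) ∂(g 0).vol) 0 := by
  have h0 := zero_mem_Ioo hε
  obtain ⟨s, ρ, hsum, hsupp, hρ⟩ := exists_smooth_partition (n := n) (M := M)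
  have hsplit {v : M → ℂ} (hv : Continuous v) {a : ℝ} (ha : a ∈ Set.Ioo (-ε) ε) :
      ∫ x, v x ∂(g a).vol = ∑ i ∈ s, ∫ x, ρ i x * v x ∂(g a).vol := by
    have := hvol a ha
    rw [← integral_finsetSum s fun i _ => ((hρ i).continuous.fun_mul
      hv).integrable_of_hasCompactSupport (HasCompactSupport.of_compactSpace _)]
    simp only [← Finset.sum_mul, hsum, one_mul]
  rw [hsplit ((continuous_of_hasDerivAt_family hF hF' hε).fun_add
    ((continuous_of_contDiffAt_family hF h0).fun_mul
      (contMDiff_traceForm hε hg hderiv).continuous)) h0]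
  refine (HasDerivAt.fun_sum fun i _ => hasDerivAt_integral_mul_of_tsupport_subset hε hg hderiv hF
    hF' (chartAt_mem_holAtlas i) (hρ i).continuous (hsupp i)).congr_of_eventuallyEq ?_
  filter_upwards [isOpen_Ioo.mem_nhds h0] with a ha
    using hsplit (continuous_of_contDiffAt_family hF ha) ha

end IntegralVariation

/-! ### Variations of a Kähler–Einstein metric -/

section KahlerEinstein

variable {n : ℕ} {M : Type*} [TopologicalSpace M] [ChartedSpace (Fin n → ℂ) M]
  {e : OpenPartialHomeomorph M (Fin n → ℂ)} {z : Fin n → ℂ} {c : ℂ}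

namespace HermitianMetric

/-- The equation `S = c g`; for a Kähler metric `S` is the Ricci curvature, so this is the Einstein
equation. -/
def HasEinsteinConstant (g : HermitianMetric n M) (c : ℂ) : Prop :=
  ∀ e ∈ holAtlas n M, ∀ z ∈ e.target, secondRicci hol (g.mat e) z = c • g.mat e z

lemma IsKahlerEinstein.exists_hasEinsteinConstant {g : HermitianMetric n M}
    (hg : g.IsKahlerEinstein) : ∃ c : ℂ, g.HasEinsteinConstant c := by
  obtain ⟨-, c, hc⟩ := hg
  refine ⟨c, fun e he z hz => ?_⟩
  ext j k
  rw [← chernS_eq ((g.contDiffAt_mat he hz).of_le ENat.LEInfty.out) (g.isUnit_mat he hz),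
    hc e he z hz, Matrix.smul_apply, smul_eq_mul]

variable {g : HermitianMetric n M}

lemma IsKahler.eventually_torsionMatrix_eq_zero (hg : g.IsKahler) (he : e ∈ holAtlas n M)
    (hz : z ∈ e.target) : ∀ᶠ w in 𝓝 z, torsionMatrix hol (g.mat e) w = 0 := by
  filter_upwards [e.open_target.mem_nhds hz] with w hw using hg.torsionMatrix_eq_zero he hw

lemma opF_eq [MeasurableSpace M] (he : e ∈ holAtlas n M) (hz : z ∈ e.target) (j k : Fin n) :
    g.opF e z j k = flowTensor hol (g.mat e) z j k
      - (1 / n : ℂ) * (∫ x, g.traceSQ x ∂g.vol) * g.mat e z j k := by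
  have hsmooth := g.contDiffAt_mat he hz
  rw [opF, chernS_eq (hsmooth.of_le ENat.LEInfty.out) (g.isUnit_mat he hz),
    torsionQ_eq (hsmooth.differentiableAt (by simp)) (g.isHermitian_mat e z), flowTensor,
    Matrix.sub_apply]

variable [IsManifold 𝓘(ℂ, Fin n → ℂ) ω M]

lemma IsKahler.traceSQ_eq_of_hasEinsteinConstant (hg : g.IsKahler) (hc : g.HasEinsteinConstant c)
    (x : M) : g.traceSQ x = n * c := by
  have hx := mem_chart_source (Fin n → ℂ) x
  have he := chartAt_mem_holAtlas (n := n) x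
  have hz := (chartAt (Fin n → ℂ) x).map_source hx
  rw [← (chartAt (Fin n → ℂ) x).left_inv hx, g.traceSQ_symm_apply he hz, flowScalar, flowTensor,
    hc _ he _ hz, hg.torsionMatrix_eq_zero he hz, torsionQuadratic_zero, sub_zero,
    Matrix.mul_smul, inv_mul_cancel_of_isUnit (g.isUnit_mat he hz)]
  simp [mul_comm]

end HermitianMetric

variable {g : ℝ → HermitianMetric n M} {ε : ℝ}
  {h : ∀ x : M, LinearMap.BilinForm ℝ (Tan (n := n) x)}

/- The normalization of the volume contributes `- c h` to the linearization, which cancels the term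
`c h` here. -/
lemma hasDerivAt_flowTensor_mat (hε : 0 < ε) (hg : SmoothFamily g ε)
    (hderiv : ∀ x u v, HasDerivAt (fun a => (g a).form x u v) (h x u v) 0)
    (hK : (g 0).IsKahler) (hc : (g 0).HasEinsteinConstant c) (he : e ∈ holAtlas n M)
    (hz : z ∈ e.target) (j k : Fin n) :
    HasDerivAt (fun a => flowTensor hol ((g a).mat e) z j k)
      (c * coeff h e z j k + roughLaplacian ((g 0).mat e) (coeff h e) z j k
        - curvAction ((g 0).mat e) (coeff h e) z j k) 0 := by
  have hF := hg.contDiffAt_familyMat he (p := (0, z)) ⟨zero_mem_Ioo hε, hz⟩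
  have hG : ContDiffAt ℝ 2 ((g 0).mat e) z :=
    ((g 0).contDiffAt_mat he hz).of_le ENat.LEInfty.out
  have hu := (g 0).isUnit_mat he hz
  have hcoeff : coeff h e =ᶠ[𝓝 z] fun w => dirDeriv (paramDir _) (familyMat g e) (0, w) := by
    filter_upwards [e.open_target.mem_nhds hz] with w hw
      using coeff_eq_dirDeriv_familyMat hε hg hderiv he hw
  have hH : ContDiffAt ℝ 2 (coeff h e) z :=
    (contDiffAt_slice (contDiffAt_dirDeriv (k := 3)
      (hF.of_le ENat.LEInfty.out))).congr_of_eventuallyEq hcoeff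
  have hvar := hasDerivAt_flowTensor_slice (ζ := hol) (hF.of_le ENat.LEInfty.out) hu
    (hK.torsionMatrix_eq_zero he hz) (hc e he z hz)
  refine ((entryCLM j k).restrictScalars ℝ |>.hasFDerivAt.comp_hasDerivAt 0 hvar).congr_deriv ?_
  rw [roughLaplacian_eq hG hu (.of_forall fun w => (g 0).isHermitian_mat e w) hH,
    curvAction_eq hG hu (hK.eventually_torsionMatrix_eq_zero he hz), hcoeff.self_of_nhds]
  simp only [secondCovDeriv_congr hcoeff]
  change c * _ - _ - _ = _
  rw [sub_eq_add_neg (c * _)]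
  rfl

variable [IsManifold 𝓘(ℂ, Fin n → ℂ) ω M]

lemma traceSQ_symm_apply_family (hg : SmoothFamily g ε) (he : e ∈ holAtlas n M)
    {p : ℝ × (Fin n → ℂ)} (hp : p ∈ Set.Ioo (-ε) ε ×ˢ e.target) :
    (g p.1).traceSQ (e.symm p.2) = flowScalar (fun i => sliceDir (hol i)) (familyMat g e) p := by
  obtain ⟨a, z⟩ := p
  have hslice := flowScalar_slice (ζ := hol) (F := familyMat g e) (a := a) (x := z)
    ((hg.contDiffAt_familyMat he hp).of_le ENat.LEInfty.out) ((g a).isUnit_mat he hp.2)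
  exact ((g a).traceSQ_symm_apply he hp.2).trans hslice

lemma contDiffAt_traceSQ_family (hg : SmoothFamily g ε) (he : e ∈ holAtlas n M)
    {p : ℝ × (Fin n → ℂ)} (hp : p ∈ Set.Ioo (-ε) ε ×ˢ e.target) :
    ContDiffAt ℝ 1 (fun p : ℝ × (Fin n → ℂ) => (g p.1).traceSQ (e.symm p.2)) p := by
  refine (contDiffAt_flowScalar (k := 3) (ζ := fun i => sliceDir (hol i))
    ((hg.contDiffAt_familyMat he hp).of_le ENat.LEInfty.out)
    ((g p.1).isUnit_mat he hp.2)).congr_of_eventuallyEq ?_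
  filter_upwards [(isOpen_Ioo.prod e.open_target).mem_nhds hp] with q hq
    using traceSQ_symm_apply_family hg he hq

lemma hasDerivAt_traceSQ (hε : 0 < ε) (hg : SmoothFamily g ε)
    (hderiv : ∀ x u v, HasDerivAt (fun a => (g a).form x u v) (h x u v) 0)
    (hK : (g 0).IsKahler) (hc : (g 0).HasEinsteinConstant c) (x : M) :
    HasDerivAt (fun a => (g a).traceSQ x)
      (-(g 0).laplacian (traceForm (g 0) h) x - c * traceForm (g 0) h x) 0 := by
  set e := chartAt (Fin n → ℂ) x
  have hx : e.symm (e x) = x := e.left_inv (mem_chart_source _ x)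
  have he : e ∈ holAtlas n M := chartAt_mem_holAtlas x
  have hz : e x ∈ e.target := e.map_source (mem_chart_source _ x)
  have hp : ((0 : ℝ), e x) ∈ Set.Ioo (-ε) ε ×ˢ e.target := ⟨zero_mem_Ioo hε, hz⟩
  have htrace : (fun w => ((familyMat g e (0, w))⁻¹ *
      dirDeriv (paramDir _) (familyMat g e) (0, w)).trace) =ᶠ[𝓝 (e x)]
      fun w => traceForm (g 0) h (e.symm w) := by
    filter_upwards [e.open_target.mem_nhds hz] with w hw
      using (traceForm_eq_trace_dirDeriv hε hg hderiv he hw).symm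
  rw [← hx]
  refine (hasDerivAt_dirDeriv_paramDir
    ((contDiffAt_traceSQ_family hg he hp).differentiableAt (by simp))).congr_deriv ?_
  rw [dirDeriv_congr (g := flowScalar (fun i => sliceDir (hol i)) (familyMat g e)) ?_,
    dirDeriv_flowScalar_slice ((hg.contDiffAt_familyMat he hp).of_le ENat.LEInfty.out)
      ((g 0).isUnit_mat he hz) (.of_forall fun w => (g 0).isHermitian_mat e w)
      (hK.eventually_torsionMatrix_eq_zero he hz) (hc e he _ hz),
    laplacian_congr (G := fun w => familyMat g e (0, w)) (H := (g 0).mat e) rfl htrace,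
    ← traceForm_eq_trace_dirDeriv hε hg hderiv he hz,
    (g 0).laplacian_symm_apply (contMDiff_traceForm hε hg hderiv) he hz]
  filter_upwards [(isOpen_Ioo.prod e.open_target).mem_nhds hp] with q hq
    using traceSQ_symm_apply_family hg he hq

variable [T2Space M] [CompactSpace M] [MeasurableSpace M] [BorelSpace M]

lemma integral_traceForm_eq_zero (hε : 0 < ε) (hg : SmoothFamily g ε)
    (hvol : ∀ a ∈ Set.Ioo (-ε) ε, (g a).vol Set.univ = 1)
    (hderiv : ∀ x u v, HasDerivAt (fun a => (g a).form x u v) (h x u v) 0) :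
    ∫ x, traceForm (g 0) h x ∂(g 0).vol = 0 := by
  have hvar := hasDerivAt_integral_vol (F := fun _ _ => 1) (F' := 0) hε hg hderiv
    (fun a ha => ⟨by rw [hvol a ha]; exact ENNReal.one_lt_top⟩)
    (fun _ _ _ _ => contDiffAt_const) fun _ => hasDerivAt_const _ _
  have hone : (fun a => ∫ _, (1 : ℂ) ∂(g a).vol) =ᶠ[𝓝 0] fun _ => 1 := by
    filter_upwards [isOpen_Ioo.mem_nhds (zero_mem_Ioo hε)] with a ha
    simp [Measure.real, hvol a ha]
  simpa using hvar.unique ((hasDerivAt_const (0 : ℝ) (1 : ℂ)).congr_of_eventuallyEq hone)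

lemma hasDerivAt_integral_traceSQ (hε : 0 < ε) (hg : SmoothFamily g ε)
    (hvol : ∀ a ∈ Set.Ioo (-ε) ε, (g a).vol Set.univ = 1)
    (hderiv : ∀ x u v, HasDerivAt (fun a => (g a).form x u v) (h x u v) 0)
    (hK : (g 0).IsKahler) (hc : (g 0).HasEinsteinConstant c) :
    HasDerivAt (fun a => ∫ x, (g a).traceSQ x ∂(g a).vol) 0 0 := by
  have hfin : ∀ a ∈ Set.Ioo (-ε) ε, IsFiniteMeasure (g a).vol := fun a ha =>
    ⟨by rw [hvol a ha]; exact ENNReal.one_lt_top⟩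
  have := hfin 0 (zero_mem_Ioo hε)
  set u := traceForm (g 0) h
  have hu : ContMDiff 𝓘(ℝ, Fin n → ℂ) 𝓘(ℝ, ℂ) ∞ u := contMDiff_traceForm hε hg hderiv
  have hint {v : M → ℂ} (hv : Continuous v) : Integrable v (g 0).vol :=
    hv.integrable_of_hasCompactSupport (HasCompactSupport.of_compactSpace _)
  refine (hasDerivAt_integral_vol hε hg hderiv hfin
    (fun e he p hp => contDiffAt_traceSQ_family hg he hp)
    (hasDerivAt_traceSQ hε hg hderiv hK hc)).congr_deriv ?_
  calc ∫ x, (-(g 0).laplacian u x - c * u x + (g 0).traceSQ x * u x) ∂(g 0).vol =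
        ∫ x, ((n * c - c) * u x - (g 0).laplacian u x) ∂(g 0).vol := by
        congr 1 with x
        rw [hK.traceSQ_eq_of_hasEinsteinConstant hc]
        ring
    _ = (n * c - c) * ∫ x, u x ∂(g 0).vol - ∫ x, (g 0).laplacian u x ∂(g 0).vol := by
        rw [integral_sub ((hint hu.continuous).const_mul _)
          (hint ((g 0).contMDiff_laplacian hu).continuous), integral_const_mul]
    _ = 0 := by
        rw [integral_traceForm_eq_zero hε hg hvol hderiv, hK.integral_laplacian hu, mul_zero,
          sub_zero]

end KahlerEinstein

end HermitianFlow

open HermitianFlow in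
theorem mainTheorem9 {n : ℕ} {M : Type*} [TopologicalSpace M] [T2Space M] [CompactSpace M]
    [ChartedSpace (Fin n → ℂ) M] [IsManifold 𝓘(ℂ, Fin n → ℂ) ω M]
    [MeasurableSpace M] [BorelSpace M]
    (ε : ℝ) (hε : 0 < ε)
    (g : ℝ → HermitianFlow.HermitianMetric n M)
    (hsmooth : HermitianFlow.SmoothFamily g ε)
    (hvol : ∀ a ∈ Set.Ioo (-ε) ε, (g a).vol Set.univ = 1)
    (h : ∀ x : M, LinearMap.BilinForm ℝ (TangentSpace 𝓘(ℂ, Fin n → ℂ) x))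
    (hderiv : ∀ x u v, HasDerivAt (fun a => (g a).form x u v) (h x u v) 0)
    (hKE : (g 0).IsKahlerEinstein) :
    ∀ e ∈ IsManifold.maximalAtlas 𝓘(ℂ, Fin n → ℂ) ω M, ∀ z ∈ e.target, ∀ k l : Fin n,
      HasDerivAt (fun a => (g a).opF e z k l)
        (HermitianFlow.roughLaplacian ((g 0).mat e) (HermitianFlow.coeff h e) z k l
          - HermitianFlow.curvAction ((g 0).mat e) (HermitianFlow.coeff h e) z k l) 0 := by
  intro e he z hz k l
  obtain ⟨c, hc⟩ := hKE.exists_hasEinsteinConstant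
  have hK : (g 0).IsKahler := hKE.1
  have hn : (n : ℂ) ≠ 0 := Nat.cast_ne_zero.2 (Fin.pos k).ne'
  have hint0 : ∫ x, (g 0).traceSQ x ∂(g 0).vol = n * c := by
    simp [hK.traceSQ_eq_of_hasEinsteinConstant hc, MeasureTheory.Measure.real,
      hvol 0 (zero_mem_Ioo hε)]
  have hflow := hasDerivAt_flowTensor_mat hε hsmooth hderiv hK hc he hz k l
  have hint := hasDerivAt_integral_traceSQ hε hsmooth hvol hderiv hK hc
  have hmat := hasDerivAt_mat hderiv e z k l
  simp only [HermitianMetric.opF_eq he hz]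
  refine (hflow.sub ((hint.const_mul (1 / n : ℂ)).mul hmat)).congr_deriv ?_
  rw [hint0]
  field_simp
  ring
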